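/- Let $N\ge 2$ and $[N]=\{1,\dots,N\}$. Let $q$ and $q_{ij}$ ($1\le i<j\le N$) be commuting indeterminates, put $q_{ii}=1$ and $q_{ji}=q^2q_{ij}^{-1}$ for $i<j$, and let $F=\mathbb{C}(q,q_{ij})$, with the conjugate-linear involution $q^*=q$, $q_{ij}^*=q_{ji}$. Put $$R=\sum_{i,j}q_{ij}\,e_{ii}\otimes e_{jj}+(1-q^2)\sum_{i<j}e_{ij}\otimes e_{ji},\qquad \hat R=\Sigma R,\quad \Sigma=\sum_{i,j}e_{ij}\otimes e_{ji}.$$ Let $\mathcal{O}=\mathcal{O}^{\mathbb{R}}_{q,Q}(M_N(\mathbb{C}))$ be the unital $F$-algebra generated by the entries of two $N\times N$ matrices $X,Y$ subject to $$R_{12}X_{01}X_{02}=X_{02}X_{01}R_{12},\quad R_{12}Y_{02}Y_{01}=Y_{01}Y_{02}R_{12},\quad X_{01}R_{12}Y_{02}=Y_{02}R_{12}X_{01},$$ with the $*$-structure $X_{ij}^*=Y_{ji}$. For a map $\sigma$ from $[m]$ to $[N]$ let $(-q)_{\sigma,c}=\prod_{a<b,\ \sigma(a)>\sigma(b)}(-q_{\sigma(b)\sigma(a)})$.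 *Coefficients.* Let $u=\sum_{\sigma\in S_N}(-q)_{\sigma,c}\,e_{\sigma(1)}\otimes\cdots\otimes e_{\sigma(N)}$, $v=u^*$, $\|u\|^2=vu$, $[n]=\sum_{k<n}q^{2k}$ and $[n]!=[1]\cdots[n]$. Put $\sigma_{q,Q}(0)=1$ and, for $1\le k\le N$, $$\sigma_{q,Q}(k)=q^{-(k-1)k}\,\frac{1}{\|u\|^2}\,\frac{[N]!}{[k]!\,[N-k]!}\;v\big((XY)_{01}\hat R_{12}\hat R_{23}\cdots\hat R_{k-1,k}\big)^k u .$$ *Minors.* For a matrix $M$ that satisfies the relations of $X$, and $J=\{j_1<\dots<j_m\}$, $K\subset[N]$ with $|J|=|K|=m$, let $[M]_{q,Q,J,K}=\sum_{\tau}(-q)_{\tau,c}M_{j_1\tau(1)}\cdots M_{j_m\tau(m)}$, where $\tau$ runs over the injective maps $[m]\to K$. For a matrix $M$ that satisfies the relations of $Y$ let $[M]_{q,Q,J,K}=([M^*]_{q,Q,K,J})^*$. Let $D'=\mathrm{diag}(q^{N-1},\dots,q,1)$, $(-q)_{i<K}=\prod_{k\in K,\,i<k}(-q_{ik})$ and $(-q)_{K>j}=\prod_{k\in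 K,\,k>j}(-q_{kj})$. **Theorem 1.2.** Let $t$ be a central indeterminate, i.e. work in $\mathcal{O}[t]$. Then $\mathcal{C}_N=\sum_{k=0}^N\sigma_{q,Q}(k)t^{N-k}$ is central in $\mathcal{O}[t]$, the matrix $tI_N+XY$ is invertible over the localization $\mathcal{O}[t][\mathcal{C}_N^{-1}]$, and for all $i,j\in[N]$ $$\big((tI_N+XY)^{-1}\big)_{ij}=\frac{1}{\mathcal{C}_N}\,P_{ij},\qquad P_{ij}=\sum_{\substack{K\subset[N]\\ i,j\in K}}t^{N-|K|}(-q)_{i<K}(-q)_{K>j}\sum_{\substack{L\subset[N]\\ |L|=|K|-1}}[D'Y]_{q,Q,L,K\setminus\{i\}}\,[XD']_{q,Q,K\setminus\{j\},L}.$$ Moreover these expressions are deformations of the commutative ones in which all coefficients are, up to sign, integral power products of the parameters. Let $x_{ij},y_{ij}$ be commuting variables with matrices $x,y$. For $(z,z_0)=(P_{ij},\ \mathrm{adj}(tI_N+xy)_{ij})$, for all $i,j$, and for $(z,z_0)=(\mathcal{C}_N,\ \det(tI_N+xy))$, there is a finite set of ordered words $w=t^eY_{a_1b_1}\cdots Y_{a_rb_r}X_{c_1d_1}\cdots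 X_{c_sd_s}$, with signs $\varepsilon_w=\pm1$ and Laurent monomials $m_w$ in $q$ and the $q_{ij}$, such that the words are pairwise distinct when they are read as commutative monomials in $t$, $y_{ij}$, $x_{ij}$, and such that $z=\sum_w\varepsilon_w m_w w$ in $\mathcal{O}[t]$, while $z_0=\sum_w\varepsilon_w w$ in the commuting variables. -/

import Mathlib

open scoped Kronecker Polynomial nonZeroDivisors
open Matrix

noncomputable section

namespace MultiQuantum

/-! ## The field of parameters -/

/-- Labels of the independent indeterminates: `none` for `q`, and `some (i, j)`, `i < j`, for
`q_ij`. There are `1 + (N choose 2)` of them. -/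
abbrev ParamIndex (N : ℕ) : Type := Option {p : Fin N × Fin N // p.1 < p.2}

/-- The polynomial ring over `ℂ` in the independent indeterminates. -/
abbrev ParamPoly (N : ℕ) : Type := MvPolynomial (ParamIndex N) ℂ

/-- The field of fractions over the indeterminates. -/
def ParamField (N : ℕ) : Type := FractionRing (ParamPoly N)

instance instFieldParamField (N : ℕ) : Field (ParamField N) :=
  inferInstanceAs (Field (FractionRing (ParamPoly N)))

instance instAlgebraParamField (N : ℕ) : Algebra (ParamPoly N) (ParamField N) :=
  inferInstanceAs (Algebra (ParamPoly N) (FractionRing (ParamPoly N)))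

instance instIsFractionRingParamField (N : ℕ) : IsFractionRing (ParamPoly N) (ParamField N) :=
  inferInstanceAs (IsFractionRing (ParamPoly N) (FractionRing (ParamPoly N)))

/-- The indeterminate with a given label, as an element of the field. -/
def param {N : ℕ} (a : ParamIndex N) : ParamField N :=
  algebraMap (ParamPoly N) (ParamField N) (MvPolynomial.X a)

/-- The parameter `q`. -/
def qq (N : ℕ) : ParamField N := param none

/-- The matrix `Q = (q_ij)`: `q_ii = 1`, the `q_ij` with `i < j` are indeterminates, and
`q_ji = q ^ 2 / q_ij` for `i < j`. -/
def QQ {N : ℕ} : Matrix (Fin N) (Fin N) (ParamField N) := Matrix.of fun i j =>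
  if h : i < j then param (some ⟨(i, j), h⟩)
  else if h : j < i then qq N ^ 2 * (param (some ⟨(j, i), h⟩))⁻¹
  else 1

lemma param_ne_zero {N : ℕ} (a : ParamIndex N) : param a ≠ 0 := by
  intro h
  have h2 := (map_eq_zero_iff _ (IsFractionRing.injective (ParamPoly N) (ParamField N))).1 h
  exact MvPolynomial.X_ne_zero a h2

lemma QQ_self {N : ℕ} (i : Fin N) : QQ i i = 1 := by simp [QQ]

lemma QQ_mul_QQ {N : ℕ} {i j : Fin N} (h : i ≠ j) : QQ i j * QQ j i = qq N ^ 2 := by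
  rcases lt_or_gt_of_ne h with h | h
  · have := param_ne_zero (some (⟨(i, j), h⟩ : {p : Fin N × Fin N // p.1 < p.2}))
    simp only [QQ, Matrix.of_apply, h, h.not_gt, dite_true, dite_false]
    field_simp
  · have := param_ne_zero (some (⟨(j, i), h⟩ : {p : Fin N × Fin N // p.1 < p.2}))
    simp only [QQ, Matrix.of_apply, h, h.not_gt, dite_true, dite_false]
    field_simp

/-! ### The involution of the field: `q* = q`, `q_ij* = q_ji`, conjugate-linear over `ℂ` -/

/-- The monomials in the indeterminates. -/
def monomials (N : ℕ) : Submonoid (ParamPoly N) :=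
  Submonoid.closure (Set.range MvPolynomial.X)

lemma monomials_le (N : ℕ) : monomials N ≤ (ParamPoly N)⁰ := by
  rw [monomials, Submonoid.closure_le]
  rintro _ ⟨a, rfl⟩
  exact mem_nonZeroDivisors_of_ne_zero (MvPolynomial.X_ne_zero a)

/-- The Laurent polynomial ring in the indeterminates, inside the field. -/
abbrev Laurent (N : ℕ) : Subalgebra (ParamPoly N) (ParamField N) :=
  Localization.subalgebra.ofField (ParamField N) (monomials N) (monomials_le N)

lemma inv_param_mem {N : ℕ} (a : ParamIndex N) : (param a)⁻¹ ∈ Laurent N := by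
  have h : MvPolynomial.X a ∈ monomials N := Submonoid.subset_closure ⟨a, rfl⟩
  have h1 : IsUnit (algebraMap (ParamPoly N) (Laurent N) (MvPolynomial.X a)) :=
    IsLocalization.map_units (Laurent N) (⟨_, h⟩ : monomials N)
  obtain ⟨b, hb⟩ := h1.exists_right_inv
  have hb2 : param a * (b : ParamField N) = 1 := congrArg Subtype.val hb
  rw [inv_eq_of_mul_eq_one_right hb2]
  exact b.2

/-- The indeterminate as a Laurent polynomial. -/
def lparam {N : ℕ} (a : ParamIndex N) : Laurent N :=
  algebraMap (ParamPoly N) (Laurent N) (MvPolynomial.X a)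

/-- The inverse of the indeterminate as a Laurent polynomial. -/
def lparamInv {N : ℕ} (a : ParamIndex N) : Laurent N := ⟨(param a)⁻¹, inv_param_mem a⟩

lemma lparam_mul_inv {N : ℕ} (a : ParamIndex N) : lparam a * lparamInv a = 1 :=
  Subtype.ext (mul_inv_cancel₀ (param_ne_zero a))

/-- The image of an indeterminate under the involution: `q ↦ q` and `q_ij ↦ q ^ 2 / q_ij`. -/
def starGen {N : ℕ} : ParamIndex N → Laurent N
  | none => lparam none
  | some p => lparam none ^ 2 * lparamInv (some p)

/-- The involution on polynomials. -/
def starPoly (N : ℕ) : ParamPoly N →+* Laurent N :=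
  MvPolynomial.eval₂Hom
    (((algebraMap (ParamPoly N) (Laurent N)).comp MvPolynomial.C).comp (starRingEnd ℂ)) starGen

lemma starPoly_X {N : ℕ} (a : ParamIndex N) : starPoly N (MvPolynomial.X a) = starGen a := by
  simp [starPoly]

lemma starPoly_C {N : ℕ} (z : ℂ) : starPoly N (MvPolynomial.C z) =
    algebraMap (ParamPoly N) (Laurent N) (MvPolynomial.C (starRingEnd ℂ z)) := by
  simp [starPoly]

lemma isUnit_starGen {N : ℕ} (a : ParamIndex N) : IsUnit (starGen a) := by
  have h : ∀ b : ParamIndex N, IsUnit (lparam b) := fun b =>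
    .of_mul_eq_one _ (lparam_mul_inv b)
  have h' : ∀ b : ParamIndex N, IsUnit (lparamInv b) := fun b =>
    .of_mul_eq_one _ ((mul_comm _ _).trans (lparam_mul_inv b))
  cases a with
  | none => exact h _
  | some p => exact ((h _).pow 2).mul (h' _)

lemma isUnit_starPoly {N : ℕ} (y : monomials N) : IsUnit (starPoly N y) := by
  obtain ⟨y, hy⟩ := y
  induction hy using Submonoid.closure_induction with
  | mem x hx =>
    obtain ⟨a, rfl⟩ := hx
    simpa only [starPoly_X] using isUnit_starGen a
  | one => simp
  | mul x y _ _ hx hy => simpa using hx.mul hy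

/-- The involution on Laurent polynomials. -/
def starLaurent (N : ℕ) : Laurent N →+* Laurent N :=
  IsLocalization.lift (M := monomials N) isUnit_starPoly

lemma starLaurent_algebraMap {N : ℕ} (p : ParamPoly N) :
    starLaurent N (algebraMap (ParamPoly N) (Laurent N) p) = starPoly N p :=
  IsLocalization.lift_eq _ p

lemma starLaurent_lparam {N : ℕ} (a : ParamIndex N) : starLaurent N (lparam a) = starGen a := by
  rw [lparam, starLaurent_algebraMap, starPoly_X]

lemma starLaurent_starGen {N : ℕ} (a : ParamIndex N) :
    starLaurent N (starGen a) = lparam a := by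
  cases a with
  | none => exact starLaurent_lparam none
  | some p =>
    have h1 : starLaurent N (lparam (some p)) * starLaurent N (lparamInv (some p)) = 1 := by
      rw [← map_mul, lparam_mul_inv, map_one]
    rw [starLaurent_lparam] at h1
    have h0 := lparam_mul_inv (some p)
    have h0' := lparam_mul_inv (none : ParamIndex N)
    have h2 : starLaurent N (starGen (some p)) =
        lparam none ^ 2 * starLaurent N (lparamInv (some p)) := by
      rw [starGen, map_mul, map_pow, starLaurent_lparam, starGen]
    rw [h2]
    simp only [starGen] at h1
    calc lparam none ^ 2 * starLaurent N (lparamInv (some p))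
        = (lparam (some p) * lparamInv (some p)) *
          (lparam none ^ 2 * starLaurent N (lparamInv (some p))) := by rw [h0, one_mul]
      _ = lparam (some p) * (lparam none ^ 2 * lparamInv (some p) *
          starLaurent N (lparamInv (some p))) := by ring
      _ = lparam (some p) := by rw [h1, mul_one]

lemma starLaurent_comp (N : ℕ) :
    (starLaurent N).comp (starLaurent N) = RingHom.id (Laurent N) := by
  apply IsLocalization.ringHom_ext (monomials N)
  apply MvPolynomial.ringHom_ext
  · intro z
    simp [starLaurent_algebraMap, starPoly_C]
  · intro a
    simp only [RingHom.comp_apply, starLaurent_algebraMap, starPoly_X, starLaurent_starGen,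
      RingHom.id_apply, lparam]

/-- The involution on Laurent polynomials, as an automorphism. -/
def starLaurentEquiv (N : ℕ) : Laurent N ≃+* Laurent N :=
  RingEquiv.ofRingHom (starLaurent N) (starLaurent N) (starLaurent_comp N) (starLaurent_comp N)

/-- The involution on the field of parameters. -/
def starField (N : ℕ) : ParamField N ≃+* ParamField N :=
  IsFractionRing.ringEquivOfRingEquiv (A := Laurent N) (B := Laurent N) (starLaurentEquiv N)

lemma starField_coe {N : ℕ} (a : Laurent N) :
    starField N (a : ParamField N) = (starLaurent N a : ParamField N) :=
  IsFractionRing.ringEquivOfRingEquiv_algebraMap (starLaurentEquiv N) a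

lemma starField_starField {N : ℕ} (x : ParamField N) : starField N (starField N x) = x := by
  have h : (starField N).trans (starField N) = RingEquiv.refl (ParamField N) := by
    have h1 : (starLaurentEquiv N).trans (starLaurentEquiv N) = RingEquiv.refl (Laurent N) :=
      RingEquiv.ext fun a => RingHom.congr_fun (starLaurent_comp N) a
    rw [starField, ← IsFractionRing.ringEquivOfRingEquiv_comp, h1,
      IsFractionRing.ringEquivOfRingEquiv_refl]
  exact RingEquiv.congr_fun h x

instance instStarRingParamField (N : ℕ) : StarRing (ParamField N) where
  star := starField N
  star_involutive := starField_starField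
  star_mul a b := by rw [map_mul, mul_comm]
  star_add a b := map_add _ a b

lemma star_param_none (N : ℕ) : star (qq N) = qq N := by
  change starField N ((lparam none : Laurent N) : ParamField N) = _
  rw [starField_coe, starLaurent_lparam]; rfl

lemma star_param_some {N : ℕ} (p : {p : Fin N × Fin N // p.1 < p.2}) :
    star (param (some p)) = qq N ^ 2 * (param (some p))⁻¹ := by
  change starField N ((lparam (some p) : Laurent N) : ParamField N) = _
  rw [starField_coe, starLaurent_lparam]; rfl

lemma star_QQ {N : ℕ} (i j : Fin N) : star (QQ i j) = QQ j i := by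
  rcases lt_trichotomy i j with h | rfl | h
  · simp only [QQ, Matrix.of_apply, h, h.not_gt, dite_true, dite_false, star_param_some]
  · rw [QQ_self, star_one]
  · have h1 : star (param (some ⟨(j, i), h⟩)) = QQ i j := by
      rw [star_param_some]
      simp only [QQ, Matrix.of_apply, h, h.not_gt, dite_true, dite_false]
    rw [← h1, star_star]
    simp only [QQ, Matrix.of_apply, h, dite_true]

lemma star_algebraMap_C {N : ℕ} (z : ℂ) :
    star (algebraMap (ParamPoly N) (ParamField N) (MvPolynomial.C z)) =
      algebraMap (ParamPoly N) (ParamField N) (MvPolynomial.C (starRingEnd ℂ z)) := by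
  change starField N ((algebraMap (ParamPoly N) (Laurent N) (MvPolynomial.C z) : Laurent N) :
    ParamField N) = _
  rw [starField_coe, starLaurent_algebraMap, starPoly_C]; rfl

/-! ## The `R`-matrix -/

/-- `R = ∑ q_ij e_ii ⊗ e_jj + (1 - q ^ 2) ∑_{i < j} e_ij ⊗ e_ji`. -/
def RMat (N : ℕ) : Matrix (Fin N × Fin N) (Fin N × Fin N) (ParamField N) :=
  ∑ i, ∑ j, QQ i j • (Matrix.single i i 1 ⊗ₖ Matrix.single j j 1) +
    (1 - qq N ^ 2) • ∑ i, ∑ j, if i < j then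
      (Matrix.single i j 1 ⊗ₖ Matrix.single j i 1) else 0

/-- The flip operator `Σ = ∑ e_ij ⊗ e_ji`. -/
def flipMat (N : ℕ) : Matrix (Fin N × Fin N) (Fin N × Fin N) (ParamField N) :=
  ∑ i, ∑ j, (Matrix.single i j 1 ⊗ₖ Matrix.single j i 1)

/-- `R̂ = Σ ∘ R`. -/
def RHat (N : ℕ) : Matrix (Fin N × Fin N) (Fin N × Fin N) (ParamField N) :=
  flipMat N * RMat N

/-! ## The algebra generated by the entries of `X` and `Y` -/

/-- The generators: the entries of `X` and of `Y`. -/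
inductive Gen (N : ℕ) : Type
  | X (i j : Fin N) : Gen N
  | Y (i j : Fin N) : Gen N

/-- The free algebra on the generators. -/
abbrev FreeAlg (N : ℕ) : Type := FreeAlgebra (ParamField N) (Gen N)

/-- The matrix `X` with entries in the free algebra. -/
def freeX (N : ℕ) : Matrix (Fin N) (Fin N) (FreeAlg N) :=
  Matrix.of fun i j => FreeAlgebra.ι (ParamField N) (Gen.X i j)

/-- The matrix `Y` with entries in the free algebra. -/
def freeY (N : ℕ) : Matrix (Fin N) (Fin N) (FreeAlg N) :=
  Matrix.of fun i j => FreeAlgebra.ι (ParamField N) (Gen.Y i j)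

/-- `M_01`: the matrix `M` acting in the first of two legs. -/
def leg₁ {N : ℕ} {S : Type*} [Semiring S] (M : Matrix (Fin N) (Fin N) S) :
    Matrix (Fin N × Fin N) (Fin N × Fin N) S := M ⊗ₖ (1 : Matrix (Fin N) (Fin N) S)

/-- `M_02`: the matrix `M` acting in the second of two legs. -/
def leg₂ {N : ℕ} {S : Type*} [Semiring S] (M : Matrix (Fin N) (Fin N) S) :
    Matrix (Fin N × Fin N) (Fin N × Fin N) S := (1 : Matrix (Fin N) (Fin N) S) ⊗ₖ M

/-- A matrix of scalars, with entries read in an algebra. -/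
def scal {N : ℕ} (S : Type*) [Semiring S] [Algebra (ParamField N) S] {m n : Type*}
    (M : Matrix m n (ParamField N)) : Matrix m n S := M.map (algebraMap (ParamField N) S)

/-- The defining relations, entry by entry:
`R X₁ X₂ = X₂ X₁ R`, `R Y₂ Y₁ = Y₁ Y₂ R` and `X₁ R Y₂ = Y₂ R X₁`. -/
inductive Rel (N : ℕ) : FreeAlg N → FreeAlg N → Prop
  | XX (a b : Fin N × Fin N) : Rel N
      ((scal (FreeAlg N) (RMat N) * leg₁ (freeX N) * leg₂ (freeX N)) a b)
      ((leg₂ (freeX N) * leg₁ (freeX N) * scal (FreeAlg N) (RMat N)) a b)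
  | YY (a b : Fin N × Fin N) : Rel N
      ((scal (FreeAlg N) (RMat N) * leg₂ (freeY N) * leg₁ (freeY N)) a b)
      ((leg₁ (freeY N) * leg₂ (freeY N) * scal (FreeAlg N) (RMat N)) a b)
  | XY (a b : Fin N × Fin N) : Rel N
      ((leg₁ (freeX N) * scal (FreeAlg N) (RMat N) * leg₂ (freeY N)) a b)
      ((leg₂ (freeY N) * scal (FreeAlg N) (RMat N) * leg₁ (freeX N)) a b)

/-- The multiparameter quantized algebra of functions on `M_N(ℂ)` as a real variety. -/
def OqR (N : ℕ) : Type := RingQuot (Rel N)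

instance instRingOqR (N : ℕ) : Ring (OqR N) :=
  inferInstanceAs (Ring (RingQuot (Rel N)))

instance instAlgebraOqR (N : ℕ) : Algebra (ParamField N) (OqR N) :=
  inferInstanceAs (Algebra (ParamField N) (RingQuot (Rel N)))

/-- The quotient map from the free algebra. -/
def toOqR (N : ℕ) : FreeAlg N →ₐ[ParamField N] OqR N := RingQuot.mkAlgHom (ParamField N) (Rel N)

/-- The generating matrix `X`. -/
def matX (N : ℕ) : Matrix (Fin N) (Fin N) (OqR N) :=
  (freeX N).map (toOqR N)

/-- The generating matrix `Y`. -/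
def matY (N : ℕ) : Matrix (Fin N) (Fin N) (OqR N) :=
  (freeY N).map (toOqR N)

lemma mkAlgHom_of_rel {N : ℕ} {x y : FreeAlg N} (h : Rel N x y) :
    toOqR N x = toOqR N y :=
  RingQuot.mkAlgHom_rel _ h

lemma map_scal {N : ℕ} {m n : Type*} (M : Matrix m n (ParamField N)) :
    (scal (FreeAlg N) M).map (toOqR N) = scal (OqR N) M := by
  ext a b; simp [scal]

lemma map_mul_toOqR {N : ℕ} (M P : Matrix (Fin N × Fin N) (Fin N × Fin N) (FreeAlg N)) :
    (M * P).map (toOqR N) = M.map (toOqR N) * P.map (toOqR N) := by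
  ext a b; simp [Matrix.mul_apply]

lemma map_leg₁ {N : ℕ} (M : Matrix (Fin N) (Fin N) (FreeAlg N)) :
    (leg₁ M).map (toOqR N) =
      leg₁ (M.map (toOqR N)) := by
  ext a b
  by_cases h : a.2 = b.2 <;> simp [leg₁, Matrix.kroneckerMap_apply, Matrix.one_apply, h]

lemma map_leg₂ {N : ℕ} (M : Matrix (Fin N) (Fin N) (FreeAlg N)) :
    (leg₂ M).map (toOqR N) =
      leg₂ (M.map (toOqR N)) := by
  ext a b
  by_cases h : a.1 = b.1 <;> simp [leg₂, Matrix.kroneckerMap_apply, Matrix.one_apply, h]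

lemma matX_def (N : ℕ) :
    matX N = (freeX N).map (toOqR N) := rfl

lemma matY_def (N : ℕ) :
    matY N = (freeY N).map (toOqR N) := rfl

lemma rel_XX (N : ℕ) : scal (OqR N) (RMat N) * leg₁ (matX N) * leg₂ (matX N) =
    leg₂ (matX N) * leg₁ (matX N) * scal (OqR N) (RMat N) := by
  have h : (scal (FreeAlg N) (RMat N) * leg₁ (freeX N) * leg₂ (freeX N)).map
        (toOqR N) =
      (leg₂ (freeX N) * leg₁ (freeX N) * scal (FreeAlg N) (RMat N)).map
        (toOqR N) := by
    ext a b; exact mkAlgHom_of_rel (.XX a b)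
  simpa only [map_mul_toOqR, map_scal, map_leg₁, map_leg₂, ← matX_def, ← matY_def] using h

lemma rel_YY (N : ℕ) : scal (OqR N) (RMat N) * leg₂ (matY N) * leg₁ (matY N) =
    leg₁ (matY N) * leg₂ (matY N) * scal (OqR N) (RMat N) := by
  have h : (scal (FreeAlg N) (RMat N) * leg₂ (freeY N) * leg₁ (freeY N)).map
        (toOqR N) =
      (leg₁ (freeY N) * leg₂ (freeY N) * scal (FreeAlg N) (RMat N)).map
        (toOqR N) := by
    ext a b; exact mkAlgHom_of_rel (.YY a b)
  simpa only [map_mul_toOqR, map_scal, map_leg₁, map_leg₂, ← matX_def, ← matY_def] using h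

lemma rel_XY (N : ℕ) : leg₁ (matX N) * scal (OqR N) (RMat N) * leg₂ (matY N) =
    leg₂ (matY N) * scal (OqR N) (RMat N) * leg₁ (matX N) := by
  have h : (leg₁ (freeX N) * scal (FreeAlg N) (RMat N) * leg₂ (freeY N)).map
        (toOqR N) =
      (leg₂ (freeY N) * scal (FreeAlg N) (RMat N) * leg₁ (freeX N)).map
        (toOqR N) := by
    ext a b; exact mkAlgHom_of_rel (.XY a b)
  simpa only [map_mul_toOqR, map_scal, map_leg₁, map_leg₂, ← matX_def, ← matY_def] using h

/-! ### The `*`-structure: `X_ij* = Y_ji` and `Y_ij* = X_ji` -/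

/-- The scalars, embedded in the opposite algebra through the involution of the field. -/
def starScalar (N : ℕ) : ParamField N →+* (OqR N)ᵐᵒᵖ where
  toFun c := MulOpposite.op (algebraMap (ParamField N) (OqR N) (star c))
  map_one' := by simp
  map_mul' a b := by
    rw [← MulOpposite.op_mul, ← map_mul, star_mul]
  map_zero' := by simp
  map_add' a b := by simp

/-- The `*`-structure on the generators. -/
def starOnGen {N : ℕ} : Gen N → OqR N
  | .X i j => matY N j i
  | .Y i j => matX N j i

/-- The opposite algebra as an algebra over the field of parameters through `starScalar`. -/
abbrev starAlgebra (N : ℕ) : Algebra (ParamField N) (OqR N)ᵐᵒᵖ :=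
  (starScalar N).toAlgebra' fun c x => by
    obtain ⟨x, rfl⟩ := MulOpposite.op_surjective x
    change MulOpposite.op _ * MulOpposite.op _ = MulOpposite.op _ * MulOpposite.op _
    rw [← MulOpposite.op_mul, ← MulOpposite.op_mul, Algebra.commutes]

/-- The conjugate-linear antihomomorphism of the free algebra that extends `starOnGen`. -/
def starFree (N : ℕ) : FreeAlg N →+* (OqR N)ᵐᵒᵖ :=
  letI := starAlgebra N
  (FreeAlgebra.lift (ParamField N) fun g => MulOpposite.op (starOnGen g)).toRingHom

lemma starFree_ι {N : ℕ} (g : Gen N) :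
    starFree N (FreeAlgebra.ι (ParamField N) g) = MulOpposite.op (starOnGen g) :=
  let _ := starAlgebra N
  FreeAlgebra.lift_ι_apply _ g

lemma starFree_algebraMap {N : ℕ} (c : ParamField N) :
    starFree N (algebraMap (ParamField N) (FreeAlg N) c) =
      MulOpposite.op (algebraMap (ParamField N) (OqR N) (star c)) :=
  let _ := starAlgebra N
  (FreeAlgebra.lift (ParamField N) fun g => MulOpposite.op (starOnGen g)).commutes c

/-- The conjugate transpose, followed by the exchange of the two legs. -/
def dag {N : ℕ} (M : Matrix (Fin N × Fin N) (Fin N × Fin N) (FreeAlg N)) :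
    Matrix (Fin N × Fin N) (Fin N × Fin N) (OqR N) :=
  Matrix.of fun a b => (starFree N (M b.swap a.swap)).unop

lemma dag_mul {N : ℕ} (M P : Matrix (Fin N × Fin N) (Fin N × Fin N) (FreeAlg N)) :
    dag (M * P) = dag P * dag M := by
  ext a b
  simp only [dag, Matrix.of_apply, Matrix.mul_apply, map_sum, map_mul, Finset.unop_sum,
    MulOpposite.unop_mul]
  exact Fintype.sum_equiv (Equiv.prodComm _ _) _ _ fun c => rfl

lemma dag_leg₁_X (N : ℕ) : dag (leg₁ (freeX N)) = leg₂ (matY N) := by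
  ext a b
  rcases eq_or_ne (a.1) (b.1) with h | h
  · simp [dag, leg₁, leg₂, freeX, starFree_ι, starOnGen, Matrix.one_apply, h]
  · simp [dag, leg₁, leg₂, freeX, Matrix.one_apply, h, h.symm]

lemma dag_leg₂_X (N : ℕ) : dag (leg₂ (freeX N)) = leg₁ (matY N) := by
  ext a b
  rcases eq_or_ne (a.2) (b.2) with h | h
  · simp [dag, leg₁, leg₂, freeX, starFree_ι, starOnGen, Matrix.one_apply, h]
  · simp [dag, leg₁, leg₂, freeX, Matrix.one_apply, h, h.symm]

lemma dag_leg₁_Y (N : ℕ) : dag (leg₁ (freeY N)) = leg₂ (matX N) := by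
  ext a b
  rcases eq_or_ne (a.1) (b.1) with h | h
  · simp [dag, leg₁, leg₂, freeY, starFree_ι, starOnGen, Matrix.one_apply, h]
  · simp [dag, leg₁, leg₂, freeY, Matrix.one_apply, h, h.symm]

lemma dag_leg₂_Y (N : ℕ) : dag (leg₂ (freeY N)) = leg₁ (matX N) := by
  ext a b
  rcases eq_or_ne (a.2) (b.2) with h | h
  · simp [dag, leg₁, leg₂, freeY, starFree_ι, starOnGen, Matrix.one_apply, h]
  · simp [dag, leg₁, leg₂, freeY, Matrix.one_apply, h, h.symm]

lemma RMat_apply {N : ℕ} (a b : Fin N × Fin N) : RMat N a b =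
    (if a = b then QQ a.1 a.2 else 0) +
      if a.1 < a.2 ∧ b = a.swap then 1 - qq N ^ 2 else 0 := by
  obtain ⟨a1, a2⟩ := a
  obtain ⟨b1, b2⟩ := b
  simp only [RMat, Matrix.add_apply, Matrix.sum_apply, Matrix.smul_apply,
    Matrix.kroneckerMap_apply, apply_ite (fun M : Matrix (Fin N × Fin N) (Fin N × Fin N)
      (ParamField N) => M (a1, a2) (b1, b2)), Matrix.zero_apply, smul_eq_mul]
  congr 1
  · rw [Finset.sum_eq_single a1 (by intro c _ hc; simp [Matrix.single_apply, hc]) (by simp),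
      Finset.sum_eq_single a2 (by intro c _ hc; simp [Matrix.single_apply, hc]) (by simp)]
    by_cases h1 : a1 = b1 <;> by_cases h2 : a2 = b2 <;> simp [h1, h2]
  · rw [Finset.sum_eq_single a1 (by intro c _ hc; simp [Matrix.single_apply, hc]) (by simp),
      Finset.sum_eq_single a2 (by intro c _ hc; simp [Matrix.single_apply, hc]) (by simp)]
    by_cases h1 : a2 = b1 <;> by_cases h2 : a1 = b2 <;> by_cases h3 : a1 < a2 <;>
      simp_all [eq_comm]

lemma star_RMat {N : ℕ} (a b : Fin N × Fin N) :
    star (RMat N b.swap a.swap) = RMat N a b := by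
  obtain ⟨a1, a2⟩ := a
  obtain ⟨b1, b2⟩ := b
  simp only [RMat_apply, star_add, apply_ite star, star_QQ, star_zero, star_sub, star_one,
    star_pow, star_param_none, Prod.swap_prod_mk, Prod.mk.injEq]
  congr 1
  · by_cases h1 : a1 = b1 <;> by_cases h2 : a2 = b2 <;> simp [h1, h2, eq_comm]
  · refine if_congr ⟨?_, ?_⟩ rfl rfl
    · rintro ⟨h, rfl, rfl⟩; exact ⟨h, rfl, rfl⟩
    · rintro ⟨h, rfl, rfl⟩; exact ⟨h, rfl, rfl⟩

lemma dag_RMat (N : ℕ) : dag (scal (FreeAlg N) (RMat N)) = scal (OqR N) (RMat N) := by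
  ext a b
  simp only [dag, scal, Matrix.of_apply, Matrix.map_apply, starFree_algebraMap, star_RMat,
    MulOpposite.unop_op]

lemma starFree_eq_of_dag {N : ℕ} {M P : Matrix (Fin N × Fin N) (Fin N × Fin N) (FreeAlg N)}
    (h : dag M = dag P) (a b : Fin N × Fin N) : starFree N (M a b) = starFree N (P a b) :=
  MulOpposite.unop_injective (congrFun (congrFun h b.swap) a.swap)

lemma starFree_rel {N : ℕ} ⦃x y : FreeAlg N⦄ (h : Rel N x y) :
    starFree N x = starFree N y := by
  cases h with
  | XX a b =>
    apply starFree_eq_of_dag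
    simpa only [dag_mul, dag_leg₁_X, dag_leg₂_X, dag_RMat, mul_assoc] using (rel_YY N).symm
  | YY a b =>
    apply starFree_eq_of_dag
    simpa only [dag_mul, dag_leg₁_Y, dag_leg₂_Y, dag_RMat, mul_assoc] using (rel_XX N).symm
  | XY a b =>
    apply starFree_eq_of_dag
    simpa only [dag_mul, dag_leg₁_X, dag_leg₂_X, dag_leg₁_Y, dag_leg₂_Y, dag_RMat, mul_assoc]
      using rel_XY N

/-- The `*`-structure as an antihomomorphism of rings. -/
def starHom (N : ℕ) : OqR N →+* (OqR N)ᵐᵒᵖ := RingQuot.lift ⟨starFree N, starFree_rel⟩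

lemma starHom_mk {N : ℕ} (x : FreeAlg N) :
    starHom N (toOqR N x) = starFree N x := by
  have h : toOqR N x = RingQuot.mkRingHom (Rel N) x :=
    RingHom.congr_fun (RingQuot.mkAlgHom_coe (ParamField N) (Rel N)) x
  rw [h]
  exact RingQuot.lift_mkRingHom_apply (starFree N) starFree_rel x

lemma starHom_X {N : ℕ} (i j : Fin N) :
    starHom N (matX N i j) = MulOpposite.op (matY N j i) := by
  rw [matX_def, Matrix.map_apply, starHom_mk, freeX, Matrix.of_apply, starFree_ι, starOnGen]

lemma starHom_Y {N : ℕ} (i j : Fin N) :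
    starHom N (matY N i j) = MulOpposite.op (matX N j i) := by
  rw [matY_def, Matrix.map_apply, starHom_mk, freeY, Matrix.of_apply, starFree_ι, starOnGen]

lemma starHom_algebraMap {N : ℕ} (c : ParamField N) :
    starHom N (algebraMap (ParamField N) (OqR N) c) =
      MulOpposite.op (algebraMap (ParamField N) (OqR N) (star c)) := by
  rw [← (toOqR N).commutes, starHom_mk, starFree_algebraMap]

lemma toOqR_surjective (N : ℕ) : Function.Surjective (toOqR N) :=
  RingQuot.mkAlgHom_surjective (ParamField N) (Rel N)

lemma starHom_starHom {N : ℕ} (x : OqR N) :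
    (starHom N (starHom N x).unop).unop = x := by
  obtain ⟨x, rfl⟩ := toOqR_surjective N x
  induction x using FreeAlgebra.induction with
  | grade0 c =>
    rw [AlgHom.commutes, starHom_algebraMap, MulOpposite.unop_op, starHom_algebraMap,
      MulOpposite.unop_op, star_star]
  | grade1 g =>
    cases g with
    | X i j =>
      change (starHom N (starHom N (matX N i j)).unop).unop = matX N i j
      rw [starHom_X, MulOpposite.unop_op, starHom_Y, MulOpposite.unop_op]
    | Y i j =>
      change (starHom N (starHom N (matY N i j)).unop).unop = matY N i j
      rw [starHom_Y, MulOpposite.unop_op, starHom_X, MulOpposite.unop_op]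
  | mul a b ha hb => rw [map_mul, map_mul, MulOpposite.unop_mul, map_mul,
      MulOpposite.unop_mul, ha, hb]
  | add a b ha hb => rw [map_add, map_add, MulOpposite.unop_add, map_add,
      MulOpposite.unop_add, ha, hb]

instance instStarRingOqR (N : ℕ) : StarRing (OqR N) where
  star x := (starHom N x).unop
  star_involutive := starHom_starHom
  star_mul a b := by rw [map_mul, MulOpposite.unop_mul]
  star_add a b := by rw [map_add, MulOpposite.unop_add]

lemma star_matX {N : ℕ} (i j : Fin N) : star (matX N i j) = matY N j i := by
  change (starHom N _).unop = _
  rw [starHom_X, MulOpposite.unop_op]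

lemma star_matY {N : ℕ} (i j : Fin N) : star (matY N i j) = matX N j i := by
  change (starHom N _).unop = _
  rw [starHom_Y, MulOpposite.unop_op]

lemma star_algebraMap {N : ℕ} (c : ParamField N) :
    star (algebraMap (ParamField N) (OqR N) c) = algebraMap (ParamField N) (OqR N) (star c) := by
  change (starHom N _).unop = _
  rw [starHom_algebraMap, MulOpposite.unop_op]

/-! ## The coefficients `σ_{q,Q}(k)` -/

/-- `(-q)_{σ,c} = ∏ (-q_{σ(j)σ(i)})`, over the pairs `i < j` with `σ(i) > σ(j)`. -/
def negqC {N m : ℕ} (σ : Fin m → Fin N) : ParamField N :=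
  ∏ p : Fin m × Fin m with p.1 < p.2 ∧ σ p.2 < σ p.1, -QQ (σ p.2) (σ p.1)

/-- The Levi-Civita tensor `u = ∑_σ (-q)_{σ,c} e_{σ(1)} ⊗ ⋯ ⊗ e_{σ(N)}`. A tensor in
`(ℂ^N)^{⊗N}` is given by its coordinates, indexed by the maps `Fin N → Fin N`. -/
def uVec (N : ℕ) : (Fin N → Fin N) → ParamField N :=
  ∑ σ : Equiv.Perm (Fin N), negqC σ • Pi.single (σ : Fin N → Fin N) 1

/-- The row vector `v = u*`. -/
def vVec (N : ℕ) : (Fin N → Fin N) → ParamField N := star (uVec N)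

/-- `‖u‖² = u* u`. -/
def normSqU (N : ℕ) : ParamField N := vVec N ⬝ᵥ uVec N

/-- The `q`-number `[n] = 1 + q ^ 2 + ⋯ + q ^ (2 (n - 1))`. -/
def qNum (N n : ℕ) : ParamField N := ∑ k ∈ Finset.range n, qq N ^ (2 * k)

/-- The `q`-factorial `[n]! = [1] [2] ⋯ [n]`. -/
def qFact (N n : ℕ) : ParamField N := ∏ k ∈ Finset.range n, qNum N (k + 1)

/-- `α_k = ‖u‖⁻² [N]! / ([k]! [N - k]!)`. -/
def alpha (N k : ℕ) : ParamField N :=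
  (normSqU N)⁻¹ * (qFact N N / (qFact N k * qFact N (N - k)))

/-- The matrix `M` acting in the leg `k` (counted from `0`) of `N` legs. -/
def atLeg {N : ℕ} {S : Type*} [Zero S] (k : Fin N) (M : Matrix (Fin N) (Fin N) S) :
    Matrix (Fin N → Fin N) (Fin N → Fin N) S := Matrix.of fun a b =>
  if ∀ m, m ≠ k → a m = b m then M (a k) (b k) else 0

/-- The two-leg matrix `M` acting in the distinct legs `k` and `l` of `N` legs. -/
def atLegs {N : ℕ} {S : Type*} [Zero S] (k l : Fin N)
    (M : Matrix (Fin N × Fin N) (Fin N × Fin N) S) :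
    Matrix (Fin N → Fin N) (Fin N → Fin N) S := Matrix.of fun a b =>
  if ∀ m, m ≠ k → m ≠ l → a m = b m then M (a k, a l) (b k, b l) else 0

/-- `(XY)_{01} R̂_{12} R̂_{23} ⋯ R̂_{k-1,k}` for `1 ≤ k ≤ N`. -/
def chain {N : ℕ} (k : ℕ) (h1 : 1 ≤ k) (hk : k ≤ N) :
    Matrix (Fin N → Fin N) (Fin N → Fin N) (OqR N) :=
  atLeg ⟨0, by omega⟩ (matX N * matY N) *
    (List.ofFn fun m : Fin (k - 1) =>
      atLegs (⟨m, by omega⟩ : Fin N) ⟨m + 1, by omega⟩ (scal (OqR N) (RHat N))).prod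

/-- The coefficients of the Cayley-Hamilton identity: `σ(0) = 1` and
`σ(k) = q ^ (-(k - 1) k) α_k v ((XY)_{01} R̂_{12} ⋯ R̂_{k-1,k}) ^ k u` for `1 ≤ k ≤ N`
(and `0` for `k > N`). -/
def sigma (N k : ℕ) : OqR N :=
  if h1 : 1 ≤ k then
    if hk : k ≤ N then
      algebraMap (ParamField N) (OqR N) ((qq N ^ ((k - 1) * k))⁻¹ * alpha N k) *
        ((fun a => algebraMap (ParamField N) (OqR N) (vVec N a)) ⬝ᵥ
          (chain k h1 hk ^ k *ᵥ fun a => algebraMap (ParamField N) (OqR N) (uVec N a)))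
    else 0
  else 1

/-! ## Quantum minors -/

/-- The quantum minor, with rows `J` and columns `K` of the same size, of a matrix that satisfies
the relations of `X`: with `J = {j_1 < ⋯ < j_m}`, it is
`∑_τ (-q)_{τ,c} M_{j_1 τ(1)} ⋯ M_{j_m τ(m)}` over the injective `τ : [m] → K`. -/
def minorX {N : ℕ} (M : Matrix (Fin N) (Fin N) (OqR N)) (J K : Finset (Fin N)) : OqR N :=
  ∑ τ : Fin J.card ↪ K, algebraMap (ParamField N) (OqR N) (negqC fun n => (τ n : Fin N)) *
    (List.ofFn fun n => M (J.orderEmbOfFin rfl n) (τ n)).prod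

/-- The quantum minor, with rows `J` and columns `K` of the same size, of a matrix that satisfies
the relations of `Y`: `[M]_{J,K} = ([M*]_{K,J})*`, where `M*` is the conjugate transpose. -/
def minorY {N : ℕ} (M : Matrix (Fin N) (Fin N) (OqR N)) (J K : Finset (Fin N)) : OqR N :=
  star (minorX Mᴴ K J)

/-- `D' = diag(q ^ (N - 1), …, q, 1)`. -/
def DPrime (N : ℕ) : Matrix (Fin N) (Fin N) (OqR N) :=
  Matrix.diagonal fun i => algebraMap (ParamField N) (OqR N) (qq N ^ (N - 1 - (i : ℕ)))

/-- `(-q)_{i < K} = ∏_{k ∈ K, i < k} (-q_ik)`. -/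
def negqLeft {N : ℕ} (i : Fin N) (K : Finset (Fin N)) : ParamField N :=
  ∏ k ∈ K with i < k, -QQ i k

/-- `(-q)_{K > j} = ∏_{k ∈ K, k > j} (-q_kj)`. -/
def negqRight {N : ℕ} (K : Finset (Fin N)) (j : Fin N) : ParamField N :=
  ∏ k ∈ K with j < k, -QQ k j

/-! ## The matrix `t I + X Y` and its inverse -/

/-- The matrix `t I + X Y`, over the polynomial ring in the central indeterminate `t`. -/
def tIXY (N : ℕ) : Matrix (Fin N) (Fin N) (OqR N)[X] :=
  Matrix.diagonal (fun _ => Polynomial.X) + (matX N * matY N).map Polynomial.C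

/-- `C_N = ∑_k σ(k) t ^ (N - k)`. -/
def bigC (N : ℕ) : (OqR N)[X] :=
  ∑ k ∈ Finset.range (N + 1), Polynomial.C (sigma N k) * Polynomial.X ^ (N - k)

/-- The numerator
`∑_{K ∋ i, j} t ^ (N - |K|) (-q)_{i < K} (-q)_{K > j} ∑_L [D'Y]_{L, K∖i} [XD']_{K∖j, L}`,
where `L` runs over the sets with `|K| - 1` elements. -/
def numer (N : ℕ) (i j : Fin N) : (OqR N)[X] :=
  ∑ K : Finset (Fin N) with i ∈ K ∧ j ∈ K,
    Polynomial.X ^ (N - K.card) * Polynomial.C (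
      algebraMap (ParamField N) (OqR N) (negqLeft i K * negqRight K j) *
        ∑ L ∈ Finset.univ.powersetCard (K.card - 1),
          minorY (DPrime N * matY N) L (K.erase i) * minorX (matX N * DPrime N) (K.erase j) L)

/-- The powers of a central element form an Ore set, so that the element can be inverted
formally. -/
abbrev oreSetOfCentral {S : Type*} [Ring S] {c : S} (hc : c ∈ Set.center S) :
    OreLocalization.OreSet (Submonoid.powers c) where
  ore_right_cancel r₁ r₂ s h := by
    have hs : (s : S) ∈ Set.center S := by
      obtain ⟨n, hn⟩ := s.2
      rw [← hn]
      exact (Submonoid.center S).pow_mem hc n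
    exact ⟨s, by rw [(hs.comm r₁).eq, (hs.comm r₂).eq, h]⟩
  oreNum r _ := r
  oreDenom _ s := s
  ore_eq r s := by
    have hs : (s : S) ∈ Set.center S := by
      obtain ⟨n, hn⟩ := s.2
      rw [← hn]
      exact (Submonoid.center S).pow_mem hc n
    exact (hs.comm r).eq

/-! ## Deformations of commutative polynomials -/

/-- The ordered words `t ^ e Y_{y_1} ⋯ Y_{y_a} X_{x_1} ⋯ X_{x_b}`, as the exponent `e` with the
two lists of index pairs. -/
abbrev YXWord (N : ℕ) : Type := ℕ × List (Fin N × Fin N) × List (Fin N × Fin N)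

/-- The value of an ordered word in the quantum algebra with `t` adjoined. -/
def YXWord.quantum {N : ℕ} (w : YXWord N) : (OqR N)[X] :=
  Polynomial.X ^ w.1 * Polynomial.C
    ((w.2.1.map fun p => matY N p.1 p.2).prod * (w.2.2.map fun p => matX N p.1 p.2).prod)

/-- The polynomial ring over `ℤ` in `t` and in commuting variables `X_ij` and `Y_ij`. -/
abbrev CommPoly (N : ℕ) : Type := (MvPolynomial (Gen N) ℤ)[X]

/-- The matrix of the commuting variables `X_ij`. -/
def commX (N : ℕ) : Matrix (Fin N) (Fin N) (CommPoly N) :=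
  Matrix.of fun i j => Polynomial.C (MvPolynomial.X (Gen.X i j))

/-- The matrix of the commuting variables `Y_ij`. -/
def commY (N : ℕ) : Matrix (Fin N) (Fin N) (CommPoly N) :=
  Matrix.of fun i j => Polynomial.C (MvPolynomial.X (Gen.Y i j))

/-- The matrix `t I + X Y` in commuting variables. -/
def commTIXY (N : ℕ) : Matrix (Fin N) (Fin N) (CommPoly N) :=
  Matrix.diagonal (fun _ => Polynomial.X) + commX N * commY N

/-- The value of an ordered word in commuting variables. -/
def YXWord.classical {N : ℕ} (w : YXWord N) : CommPoly N :=
  Polynomial.X ^ w.1 *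
    ((w.2.1.map fun p => commY N p.1 p.2).prod * (w.2.2.map fun p => commX N p.1 p.2).prod)

/-- The integral power product `q ^ a ∏ q_ij ^ b_ij` of the parameters. -/
def paramMonomial {N : ℕ} (a : ℤ) (b : Fin N → Fin N → ℤ) : ParamField N :=
  qq N ^ a * ∏ i, ∏ j, QQ i j ^ b i j

/-- `z` is a deformation of the commutative polynomial `z₀` in which all coefficients are, up to
the sign, integral power products of the parameters, the factors being arranged with the `Y_ij`
before the `X_ij`: `z` is a combination of ordered words with coefficients
`± q ^ a ∏ q_ij ^ b_ij`, and the same words with the same signs, read in commuting variables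
(where they are pairwise distinct, so that no terms combine or vanish), add up to `z₀`. -/
def IsDeformation {N : ℕ} (z : (OqR N)[X]) (z₀ : CommPoly N) : Prop :=
  ∃ (T : Finset (YXWord N)) (ε : YXWord N → ℤˣ) (a : YXWord N → ℤ)
    (b : YXWord N → Fin N → Fin N → ℤ),
    Set.InjOn YXWord.classical (T : Set (YXWord N)) ∧
    z = ∑ w ∈ T, (((ε w : ℤˣ) : ℤ) : (OqR N)[X]) * Polynomial.C
      (algebraMap (ParamField N) (OqR N) (paramMonomial (a w) (b w))) * w.quantum ∧
    z₀ = ∑ w ∈ T, (((ε w : ℤˣ) : ℤ) : CommPoly N) * w.classical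

end MultiQuantum

end

open MultiQuantum
open scoped OreLocalization

/-!
The proof works with operators on a quantum exterior algebra, written as matrices indexed by finite
sets: left and right multiplications by a generator (`lCreate`, `rCreate`) and left and right removals
of a generator (`lAnnih`, `rAnnih`). All quantum minors of `X` and of `Y` are collected in matrices
`minorsX` and `minorsY` of the same shape. Their Laplace expansions along the first and the last row or
column become commutation rules with these operators; that row and column expansions give the same
minors (`transpose_qMinor`) follows by induction on the degree from the Euler operator, as no
`q`-integer vanishes. The commutators of left removals with right multiplications are the entries
`braidMat` of the braiding of a vector past the exterior algebra, and an entry of `X` moves past all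
minors of `Y` at once by means of this braiding (`QSystem.exchange`).

Let `tau k` be the weighted trace of the products of the minors of size `k` of `Y` and of `X`, and let
`adjCoeff k` be the same expression with two indices left open. Laplace expansion, the exchange
relation and a contraction of scalar operators yield
`X Y * adjCoeff k + adjCoeff (k + 1) = tau (k + 1)` (`QSystem.mul_adjCoeff_add`), the recursion of the
coefficients of an adjugate. It telescopes to `(t + X Y) * genAdj = genTau` for the generating
polynomials. Taking weighted traces gives Newton's identities (`QSystem.newton`), which express the
`tau k` through the weighted traces of the powers of `X Y`. These power sums commute with `X` by the
exchange of `X` with `X Y` through `R` (`Intertwines.commute`), and with `Y` by passing to the opposite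
algebra. Hence the `tau k` are central, and `genAdj` is an inverse of `t + X Y` on both sides, up to
`genTau`.

It remains to identify `genTau` and `genAdj` with the given expressions.

* For the coefficients `σ(k)`, the relations of `X`, `Y` and `R̂` turn the power of the chain, applied to
  the Levi-Civita tensor, into `X` and `Y` acting on its first `k` legs, since the tensor is an
  eigenvector of every `R̂` (`BraidRelations.pow_mul_wedge`). This inserts minors into the tensor, and
  contracting the indices (`sum_words`) gives the weighted sum of products of minors with `X` on the
  left. This sum is `tau k` for the reversed order of the indices with `X` and `Y` exchanged, and it
  agrees with `tau k` because the power sums of `Y X` and of `X Y` agree (`QSystem.powerSum_dual`,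
  `QSystem.tau_dual`).
* The numerators are `genAdj` written out in minors (`QSystem.adjCoeff_apply`, `numer_eq`).

For the last part, the same theory applies to commuting entries over the rationals with `q = q_ij = 1`.
There the power sums, hence the `tau k`, depend only on `X Y`, so that `Y` may be replaced by the unit
matrix; therefore `genTau` is the determinant and `genAdj` the adjugate of `t + X Y`
(`genTau_of_comm`, `genAdj_of_comm`). Both in the algebra and in the commuting variables, the
contractions of minors expand over the same words, with coefficients that differ only by a monomial in
the parameters (`isDeformation_of_minorSum`), and these words are distinct as commutative monomials
(`classical_minorWord_injective`).
-/

open scoped Kronecker Polynomial nonZeroDivisors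
open Matrix

noncomputable section

namespace MultiQuantum

/-! ### Multiparameters and `q`-integers -/

/-- The `q`-integer `1 + q ^ 2 + ⋯ + q ^ (2 (n - 1))`. -/
def qInt {F : Type*} [Field F] (q : F) (n : ℕ) : F := ∑ k ∈ Finset.range n, q ^ (2 * k)

/-- A multiparameter: a nonzero scalar `q` and a matrix `Q` with `Q i i = 1` and
`Q i j * Q j i = q ^ 2` off the diagonal, such that no positive `q`-integer vanishes. -/
structure IsParam {I F : Type*} [Field F] (q : F) (Q : I → I → F) : Prop where
  ne_zero : q ≠ 0
  diag : ∀ i, Q i i = 1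
  qInt_ne_zero : ∀ n, qInt q (n + 1) ≠ 0
  mul_swap : ∀ {i j}, i ≠ j → Q i j * Q j i = q ^ 2

section Scalars

variable {I F : Type*} [Field F] {q : F} {p : I → I → F}

lemma IsParam.apply_ne_zero (hp : IsParam q p) (i j : I) : p i j ≠ 0 := by
  rcases eq_or_ne i j with rfl | h
  · rw [hp.diag]; exact one_ne_zero
  · intro h0
    have := hp.mul_swap h
    rw [h0, zero_mul] at this
    exact pow_ne_zero 2 hp.ne_zero this.symm

lemma IsParam.swap (hp : IsParam q p) : IsParam q (fun i j => p j i) :=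
  ⟨hp.ne_zero, hp.diag, hp.qInt_ne_zero, fun h => hp.mul_swap h.symm⟩

@[simp] lemma qInt_zero (q : F) : qInt q 0 = 0 := by simp [qInt]

lemma qInt_succ (q : F) (n : ℕ) : qInt q (n + 1) = qInt q n + q ^ (2 * n) := by
  rw [qInt, Finset.sum_range_succ, ← qInt]

lemma qInt_succ' (q : F) (n : ℕ) : qInt q (n + 1) = 1 + q ^ 2 * qInt q n := by
  rw [qInt, Finset.sum_range_succ', qInt, Finset.mul_sum, add_comm, mul_zero, pow_zero]
  exact congrArg _ (Finset.sum_congr rfl fun k _ => by ring)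

lemma one_sub_sq_mul_qInt (q : F) (n : ℕ) : (1 - q ^ 2) * qInt q n = 1 - q ^ (2 * n) := by
  induction n with
  | zero => simp
  | succ n ih => rw [qInt_succ, mul_add, ih]; ring

variable [LinearOrder I]

lemma sum_pow_card_lt (q : F) (S : Finset I) :
    ∑ t ∈ S, q ^ (2 * (S.filter (· < t)).card) = qInt q S.card := by
  induction S using Finset.induction_on_max with
  | empty => simp
  | insert a s ha ih =>
    have has : a ∉ s := fun h => lt_irrefl _ (ha a h)
    rw [Finset.sum_insert has, Finset.card_insert_of_notMem has, qInt_succ, ← ih, add_comm]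
    congr 1
    · refine Finset.sum_congr rfl fun t ht => ?_
      rw [Finset.filter_insert, if_neg (ha t ht).not_gt]
    · rw [Finset.filter_insert, if_neg (lt_irrefl a), Finset.filter_true_of_mem ha]

lemma sum_pow_card_gt (q : F) (S : Finset I) :
    ∑ t ∈ S, q ^ (2 * (S.filter (t < ·)).card) = qInt q S.card :=
  sum_pow_card_lt (I := Iᵒᵈ) q S

end Scalars

/-! ### Creation and annihilation operators of the quantum exterior algebra -/

section Fock

variable {I F : Type*} [LinearOrder I] [Field F]

/-- The weighted creation operator `e_K ↦ (∏_{k ∈ K} f c k) e_{K ∪ {c}}` for `c ∉ K`, and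
`e_K ↦ 0` for `c ∈ K`, as a matrix indexed by finite sets. -/
def create (f : I → I → F) (c : I) : Matrix (Finset I) (Finset I) F :=
  Matrix.of fun J K => if c ∉ K ∧ J = insert c K then ∏ k ∈ K, f c k else 0

/-- The weighted annihilation operator `e_K ↦ (∏_{k ∈ K \ {c}} f c k) e_{K \ {c}}` for `c ∈ K`,
and `e_K ↦ 0` for `c ∉ K`. -/
def annih (f : I → I → F) (c : I) : Matrix (Finset I) (Finset I) F :=
  Matrix.of fun J K => if c ∉ J ∧ K = insert c J then ∏ k ∈ J, f c k else 0

variable [Fintype I]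

lemma map_create_mul_apply {R n : Type*} [Ring R] (φ : F →+* R) (f : I → I → F) (c : I)
    (M : Matrix (Finset I) n R) (J : Finset I) (L : n) :
    ((create f c).map φ * M) J L =
      if c ∈ J then φ (∏ k ∈ J.erase c, f c k) * M (J.erase c) L else 0 := by
  rw [Matrix.mul_apply]
  split_ifs with h
  · rw [Finset.sum_eq_single (J.erase c)]
    · simp [create, Finset.insert_erase h]
    · intro K _ hK
      rw [Matrix.map_apply, create, Matrix.of_apply, if_neg, map_zero, zero_mul]
      rintro ⟨h1, rfl⟩
      exact hK (Finset.erase_insert h1).symm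
    · simp
  · refine Finset.sum_eq_zero fun K _ => ?_
    rw [Matrix.map_apply, create, Matrix.of_apply, if_neg, map_zero, zero_mul]
    rintro ⟨h1, rfl⟩
    exact h (Finset.mem_insert_self _ _)

lemma map_annih_mul_apply {R n : Type*} [Ring R] (φ : F →+* R) (f : I → I → F) (c : I)
    (M : Matrix (Finset I) n R) (J : Finset I) (L : n) :
    ((annih f c).map φ * M) J L =
      if c ∉ J then φ (∏ k ∈ J, f c k) * M (insert c J) L else 0 := by
  rw [Matrix.mul_apply]
  split_ifs with h
  · rw [Finset.sum_eq_zero]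
    intro K _
    rw [Matrix.map_apply, annih, Matrix.of_apply, if_neg (fun h' => h'.1 h), map_zero, zero_mul]
  · rw [Finset.sum_eq_single (insert c J)]
    · simp [annih, h]
    · intro K _ hK
      rw [Matrix.map_apply, annih, Matrix.of_apply, if_neg (fun h' => hK h'.2), map_zero,
        zero_mul]
    · simp

lemma create_mul_apply {n : Type*} (f : I → I → F) (c : I)
    (M : Matrix (Finset I) n F) (J : Finset I) (L : n) :
    (create f c * M) J L =
      if c ∈ J then (∏ k ∈ J.erase c, f c k) * M (J.erase c) L else 0 :=
  map_create_mul_apply (RingHom.id F) f c M J L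

lemma annih_mul_apply {n : Type*} (f : I → I → F) (c : I)
    (M : Matrix (Finset I) n F) (J : Finset I) (L : n) :
    (annih f c * M) J L =
      if c ∉ J then (∏ k ∈ J, f c k) * M (insert c J) L else 0 :=
  map_annih_mul_apply (RingHom.id F) f c M J L

lemma transpose_create (f : I → I → F) (c : I) : (create f c)ᵀ = annih f c := rfl

lemma transpose_annih (f : I → I → F) (c : I) : (annih f c)ᵀ = create f c := rfl

lemma create_mul_create {f g : I → I → F} {c d : I} (h : c ≠ d) {u v : F}
    (huv : u * f c d = v * g d c) :
    u • (create f c * create g d) = v • (create g d * create f c) := by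
  ext J L
  rw [← mul_one (create g d), ← mul_one (create f c)]
  simp only [Matrix.smul_apply, Matrix.mul_assoc, create_mul_apply, smul_eq_mul, Matrix.one_mul]
  by_cases hc : c ∈ J <;> by_cases hd : d ∈ J <;> simp [hc, hd, h, h.symm]
  rw [Finset.erase_right_comm, ← Finset.mul_prod_erase (J.erase c) (f c) (a := d) (by simp [*, h.symm]),
    ← Finset.mul_prod_erase (J.erase d) (g d) (a := c) (by simp [*]), Finset.erase_right_comm]
  linear_combination ((∏ x ∈ (J.erase d).erase c, f c x) * (∏ x ∈ (J.erase d).erase c, g d x) *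
    (1 : Matrix (Finset I) (Finset I) F) ((J.erase d).erase c) L) * huv

lemma create_mul_create_self (f g : I → I → F) (c : I) : create f c * create g c = 0 := by
  ext J L
  rw [create_mul_apply, ← mul_one (create g c)]
  simp [create_mul_apply]

lemma annih_mul_annih {f g : I → I → F} {c d : I} (h : c ≠ d) {u v : F}
    (huv : u * g d c = v * f c d) :
    u • (annih f c * annih g d) = v • (annih g d * annih f c) := by
  have := congrArg Matrix.transpose (create_mul_create (f := g) (g := f) h.symm huv)
  simpa [Matrix.transpose_mul, transpose_create] using this

lemma annih_mul_annih_self (f g : I → I → F) (c : I) : annih f c * annih g c = 0 := by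
  have := congrArg Matrix.transpose (create_mul_create_self g f c)
  simpa [Matrix.transpose_mul, transpose_create] using this

/-- For different generators, removal and multiplication commute up to a scalar that depends only on
how the two weights see the other generator. -/
lemma annih_mul_create {f g : I → I → F} {c d : I} (h : c ≠ d) :
    annih f c * create g d = (f c d * g d c) • (create g d * annih f c) := by
  ext J L
  rw [← mul_one (create g d), ← mul_one (annih f c)]
  simp only [Matrix.smul_apply, Matrix.mul_assoc, create_mul_apply, annih_mul_apply, smul_eq_mul,
    Matrix.one_mul]
  by_cases hc : c ∈ J <;> by_cases hd : d ∈ J <;> simp [hc, hd, h, h.symm]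
  rw [Finset.erase_insert_of_ne h, Finset.prod_insert (by simp [hc]),
    ← Finset.mul_prod_erase J (f c) hd]
  ring

lemma annih_mul_create_self (f g : I → I → F) (c : I) :
    annih f c * create g c =
      Matrix.diagonal fun J => if c ∈ J then 0 else (∏ k ∈ J, f c k) * ∏ k ∈ J, g c k := by
  ext J L
  rw [← mul_one (create g c)]
  simp only [create_mul_apply, annih_mul_apply, Matrix.diagonal_apply, Matrix.one_apply]
  by_cases hc : c ∈ J <;> by_cases hJ : J = L <;> simp_all

lemma create_mul_annih_self (f g : I → I → F) (c : I) :
    create f c * annih g c = Matrix.diagonal fun J =>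
      if c ∈ J then (∏ k ∈ J.erase c, f c k) * ∏ k ∈ J.erase c, g c k else 0 := by
  ext J L
  rw [← mul_one (annih g c)]
  simp only [create_mul_apply, annih_mul_apply, Matrix.diagonal_apply, Matrix.one_apply]
  by_cases hc : c ∈ J <;> by_cases hJ : J = L <;> simp_all [Finset.insert_erase]

lemma create_mul_diagonal (f : I → I → F) (c : I) (g h : Finset I → F)
    (hgh : ∀ J, c ∉ J → g J = h (insert c J)) :
    create f c * Matrix.diagonal g = Matrix.diagonal h * create f c := by
  ext J L
  rw [Matrix.mul_diagonal, Matrix.diagonal_mul, create, Matrix.of_apply]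
  split_ifs with h1
  · rw [hgh L h1.1, h1.2, mul_comm]
  · simp

lemma annih_mul_diagonal (f : I → I → F) (c : I) (g h : Finset I → F)
    (hgh : ∀ J, c ∉ J → g (insert c J) = h J) :
    annih f c * Matrix.diagonal g = Matrix.diagonal h * annih f c := by
  ext J L
  rw [Matrix.mul_diagonal, Matrix.diagonal_mul, annih, Matrix.of_apply]
  split_ifs with h1
  · rw [h1.2, hgh J h1.1, mul_comm]
  · simp

/-! ### Left and right multiplications and contractions -/

/-- Left multiplication by the generator `c` of the quantum exterior algebra. -/
def lCreate (p : I → I → F) : I → Matrix (Finset I) (Finset I) F :=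
  create fun c k => if k < c then -p c k else 1

/-- Right multiplication by the generator `c` of the quantum exterior algebra. -/
def rCreate (p : I → I → F) : I → Matrix (Finset I) (Finset I) F :=
  create fun c k => if c < k then -p k c else 1

/-- Removal of the generator `c` on the left. -/
def lAnnih (p : I → I → F) : I → Matrix (Finset I) (Finset I) F :=
  annih fun c k => if k < c then -p k c else 1

/-- Removal of the generator `c` on the right. -/
def rAnnih (p : I → I → F) : I → Matrix (Finset I) (Finset I) F :=
  annih fun c k => if c < k then -p c k else 1

/-- The operator with `e_K ↦ g |K| e_K`. -/
def degMat (I : Type*) [LinearOrder I] {F : Type*} [Field F] (g : ℕ → F) :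
    Matrix (Finset I) (Finset I) F := Matrix.diagonal fun K => g K.card

/-- The operator with `e_K ↦ (∏_{k ∈ K} w k) e_K`. -/
def weightMat (w : I → F) : Matrix (Finset I) (Finset I) F := Matrix.diagonal fun K => ∏ k ∈ K, w k

/-- The weight `q ^ (2 #{k > c})`. -/
def wGt (I : Type*) [LinearOrder I] [Fintype I] {F : Type*} [Field F] (q : F) (c : I) : F :=
  q ^ (2 * (Finset.univ.filter (c < ·)).card)

/-- The weight `q ^ (2 #{k < c})`. -/
def wLt (I : Type*) [LinearOrder I] [Fintype I] {F : Type*} [Field F] (q : F) (c : I) : F :=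
  q ^ (2 * (Finset.univ.filter (· < c)).card)

/-- The entries of the braiding of a vector past the exterior algebra, up to a sign depending on the
degree. They are the commutators of the left removals with the right multiplications. -/
def braidMat (p : I → I → F) (s c : I) : Matrix (Finset I) (Finset I) F :=
  lAnnih p c * rCreate p s - rCreate p s * lAnnih p c

variable {q : F} {p : I → I → F}

lemma degMat_mul_degMat (g h : ℕ → F) :
    degMat I g * degMat I h = degMat I fun n => g n * h n := by
  simp [degMat, Matrix.diagonal_mul_diagonal]

lemma degMat_mul_create (f : I → I → F) (c : I) (g : ℕ → F) :
    degMat I g * create f c = create f c * degMat I fun n => g (n + 1) :=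
  (create_mul_diagonal f c _ _ fun J hJ => by rw [Finset.card_insert_of_notMem hJ]).symm

lemma weightMat_mul_create (f : I → I → F) (c : I) (w : I → F) :
    weightMat w * create f c = w c • (create f c * weightMat w) := by
  rw [weightMat, ← Matrix.mul_smul, ← Matrix.diagonal_smul]
  exact (create_mul_diagonal f c _ _ fun J hJ => by simp [Finset.prod_insert hJ]).symm

lemma weightMat_mul_degMat (w : I → F) (g : ℕ → F) :
    weightMat w * degMat I g = degMat I g * weightMat w := by
  simp [degMat, weightMat, Matrix.diagonal_mul_diagonal, mul_comm]

lemma lCreate_mul_lCreate {a b : I} (h : a < b) :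
    lCreate p b * lCreate p a = -p b a • (lCreate p a * lCreate p b) := by
  have := create_mul_create (f := fun c k => if k < c then -p c k else 1)
    (g := fun c k => if k < c then -p c k else 1) h.ne' (u := 1) (v := -p b a)
    (by simp [h, h.not_gt])
  simpa [lCreate] using this

lemma lCreate_mul_self (a : I) : lCreate p a * lCreate p a = 0 := create_mul_create_self _ _ _

lemma lCreate_mul_rCreate (c d : I) :
    lCreate p c * rCreate p d = rCreate p d * lCreate p c := by
  rcases eq_or_ne c d with rfl | h
  · rw [lCreate, rCreate, create_mul_create_self, create_mul_create_self]
  · have := create_mul_create (f := fun c k => if k < c then -p c k else 1)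
      (g := fun c k => if c < k then -p k c else 1) h (u := 1) (v := 1) (by simp)
    simpa [lCreate, rCreate] using this

lemma rAnnih_mul_lAnnih (c d : I) :
    rAnnih p c * lAnnih p d = lAnnih p d * rAnnih p c := by
  rcases eq_or_ne c d with rfl | h
  · rw [lAnnih, rAnnih, annih_mul_annih_self, annih_mul_annih_self]
  · have := annih_mul_annih (f := fun c k => if c < k then -p c k else 1)
      (g := fun c k => if k < c then -p k c else 1) h (u := 1) (v := 1) (by simp)
    simpa [lAnnih, rAnnih] using this

lemma lAnnih_mul_lAnnih {a b : I} (h : a < b) :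
    lAnnih p a * lAnnih p b = -p a b • (lAnnih p b * lAnnih p a) := by
  have := annih_mul_annih (f := fun c k => if k < c then -p k c else 1)
    (g := fun c k => if k < c then -p k c else 1) h.ne (u := 1) (v := -p a b)
    (by simp [h, h.not_gt])
  simpa [lAnnih] using this

lemma lAnnih_mul_self (a : I) : lAnnih p a * lAnnih p a = 0 := annih_mul_annih_self _ _ _

/-- A weight and its transpose multiply to a power of `q`, because `p c k * p k c = q ^ 2`. -/
lemma prod_ite_neg_mul (hp : IsParam q p) {S : Finset I} {c : I} (hc : c ∉ S)
    (P : I → Prop) [DecidablePred P] :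
    (∏ k ∈ S, if P k then -p c k else 1) * (∏ k ∈ S, if P k then -p k c else 1) =
      q ^ (2 * (S.filter P).card) := by
  rw [← Finset.prod_mul_distrib, pow_mul, ← Finset.prod_const, Finset.prod_filter]
  refine Finset.prod_congr rfl fun k hk => ?_
  have : c ≠ k := fun h => hc (h ▸ hk)
  split_ifs
  · rw [neg_mul_neg, hp.mul_swap this]
  · simp

lemma filter_erase_lt (S : Finset I) (c : I) : (S.erase c).filter (· < c) = S.filter (· < c) := by
  ext k; simp +contextual [ne_of_lt]

lemma filter_erase_gt (S : Finset I) (c : I) : (S.erase c).filter (c < ·) = S.filter (c < ·) := by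
  ext k; simp +contextual [ne_of_gt]

lemma lCreate_mul_lAnnih_self (hp : IsParam q p) (c : I) : lCreate p c * lAnnih p c =
    Matrix.diagonal fun J => if c ∈ J then q ^ (2 * (J.filter (· < c)).card) else 0 := by
  rw [lCreate, lAnnih, create_mul_annih_self]
  congr 1; ext J
  rw [prod_ite_neg_mul hp (Finset.notMem_erase c J), filter_erase_lt]

lemma rCreate_mul_rAnnih_self (hp : IsParam q p) (c : I) : rCreate p c * rAnnih p c =
    Matrix.diagonal fun J => if c ∈ J then q ^ (2 * (J.filter (c < ·)).card) else 0 := by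
  rw [rCreate, rAnnih, create_mul_annih_self]
  congr 1; ext J
  rw [mul_comm (∏ k ∈ J.erase c, _), prod_ite_neg_mul hp (Finset.notMem_erase c J),
    filter_erase_gt]

lemma lAnnih_mul_lCreate_self (hp : IsParam q p) (c : I) : lAnnih p c * lCreate p c =
    Matrix.diagonal fun J => if c ∈ J then 0 else q ^ (2 * (J.filter (· < c)).card) := by
  rw [lCreate, lAnnih, annih_mul_create_self]
  congr 1; ext J
  split_ifs with h
  · rfl
  · rw [mul_comm (∏ k ∈ J, _), prod_ite_neg_mul hp h]

lemma rAnnih_mul_rCreate_self (hp : IsParam q p) (c : I) : rAnnih p c * rCreate p c =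
    Matrix.diagonal fun J => if c ∈ J then 0 else q ^ (2 * (J.filter (c < ·)).card) := by
  rw [rCreate, rAnnih, annih_mul_create_self]
  congr 1; ext J
  split_ifs with h
  · rfl
  · rw [prod_ite_neg_mul hp h]

lemma sum_diagonal {ι : Type*} (s : Finset ι) (g : ι → Finset I → F) :
    ∑ t ∈ s, Matrix.diagonal (g t) = Matrix.diagonal fun J => ∑ t ∈ s, g t J := by
  ext J L
  rw [Matrix.sum_apply]
  by_cases h : J = L <;> simp [h]

/-- The Euler operator: removing a generator on the left and restoring it multiplies, summed over
the generators, by the `q`-integer of the degree. -/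
lemma sum_lCreate_mul_lAnnih (hp : IsParam q p) :
    ∑ t, lCreate p t * lAnnih p t = degMat I (qInt q) := by
  simp only [lCreate_mul_lAnnih_self hp, sum_diagonal, degMat]
  congr 1; ext J
  rw [Finset.sum_ite_mem, Finset.univ_inter, sum_pow_card_lt]

lemma sum_rCreate_mul_rAnnih (hp : IsParam q p) :
    ∑ t, rCreate p t * rAnnih p t = degMat I (qInt q) := by
  simp only [rCreate_mul_rAnnih_self hp, sum_diagonal, degMat]
  congr 1; ext J
  rw [Finset.sum_ite_mem, Finset.univ_inter, sum_pow_card_gt]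

/-- The generators outside of `J`, weighted by the number of all larger generators and of the smaller
ones in `J`. -/
lemma sum_weight_compl (q : F) (J : Finset I) :
    ∑ c ∈ Jᶜ, q ^ (2 * (Finset.univ.filter (c < ·)).card) * q ^ (2 * (J.filter (· < c)).card) =
      q ^ (2 * J.card) * qInt q (Fintype.card I - J.card) := by
  rw [← Finset.card_compl, ← sum_pow_card_gt, Finset.mul_sum]
  refine Finset.sum_congr rfl fun c hc => ?_
  have hc : c ∉ J := Finset.mem_compl.1 hc
  rw [← pow_add, ← pow_add, ← mul_add, ← mul_add]
  congr 2
  have h1 : Finset.univ.filter (c < ·) = J.filter (c < ·) ∪ Jᶜ.filter (c < ·) := by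
    rw [← Finset.filter_union, Finset.union_compl]
  have h2 : J = J.filter (c < ·) ∪ J.filter (· < c) := by
    rw [← Finset.filter_or, Finset.filter_true_of_mem]
    intro k hk
    exact (ne_of_mem_of_not_mem hk hc).symm.lt_or_gt
  rw [h1, Finset.card_union_of_disjoint]
  · conv_rhs => rw [h2]
    rw [Finset.card_union_of_disjoint]
    · rw [← h2]; omega
    · rw [Finset.disjoint_filter]; intro k _ h; exact h.not_gt
  · exact Finset.disjoint_filter_filter disjoint_compl_right

lemma sum_weight_compl' (q : F) (J : Finset I) :
    ∑ c ∈ Jᶜ, q ^ (2 * (Finset.univ.filter (· < c)).card) * q ^ (2 * (J.filter (c < ·)).card) =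
      q ^ (2 * J.card) * qInt q (Fintype.card I - J.card) :=
  sum_weight_compl (I := Iᵒᵈ) q J

/-- The Euler operator of the complement: adding and removing a generator on the left. -/
lemma sum_lAnnih_mul_lCreate (hp : IsParam q p) :
    ∑ t, wGt I q t • (lAnnih p t * lCreate p t) =
      degMat I fun n => q ^ (2 * n) * qInt q (Fintype.card I - n) := by
  simp only [lAnnih_mul_lCreate_self hp, ← Matrix.diagonal_smul, sum_diagonal, degMat]
  congr 1; ext J
  rw [← sum_weight_compl, ← Finset.sum_filter_add_sum_filter_not _ (· ∈ J), Finset.sum_eq_zero,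
    zero_add]
  · refine Finset.sum_congr (by ext; simp) fun t ht => ?_
    simp [Finset.mem_compl.1 ht, wGt]
  · intro t ht; simp [(Finset.mem_filter.1 ht).2]

lemma sum_rAnnih_mul_rCreate (hp : IsParam q p) :
    ∑ t, wLt I q t • (rAnnih p t * rCreate p t) =
      degMat I fun n => q ^ (2 * n) * qInt q (Fintype.card I - n) := by
  simp only [rAnnih_mul_rCreate_self hp, ← Matrix.diagonal_smul, sum_diagonal, degMat]
  congr 1; ext J
  rw [← sum_weight_compl', ← Finset.sum_filter_add_sum_filter_not _ (· ∈ J), Finset.sum_eq_zero,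
    zero_add]
  · refine Finset.sum_congr (by ext; simp) fun t ht => ?_
    simp [Finset.mem_compl.1 ht, wLt]
  · intro t ht; simp [(Finset.mem_filter.1 ht).2]

lemma rAnnih_mul_rCreate_of_ne {i j : I} (h : j ≠ i) :
    rAnnih p j * rCreate p i = -p j i • (rCreate p i * rAnnih p j) := by
  rw [rAnnih, rCreate, annih_mul_create h]
  rcases lt_or_gt_of_ne h with h' | h' <;> simp [h', h'.not_gt]

/-- The quantum Clifford relation between multiplication and removal of the same generator on the
right. -/
lemma rAnnih_mul_rCreate_eq (hp : IsParam q p) (i : I) :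
    rAnnih p i * rCreate p i = 1 - rCreate p i * rAnnih p i -
      (1 - q ^ 2) • ∑ t with i < t, rCreate p t * rAnnih p t := by
  simp only [rAnnih_mul_rCreate_self hp, rCreate_mul_rAnnih_self hp, sum_diagonal,
    ← Matrix.diagonal_smul, ← Matrix.diagonal_one, Matrix.diagonal_sub]
  congr 1; ext J
  have h : ∑ t with i < t, (if t ∈ J then q ^ (2 * (J.filter (t < ·)).card) else 0) =
      qInt q (J.filter (i < ·)).card := by
    rw [← sum_pow_card_gt, ← Finset.sum_filter, Finset.filter_filter]
    refine Finset.sum_congr (by ext; simp [and_comm]) fun t ht => ?_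
    congr 3
    ext k
    simp only [Finset.mem_filter] at ht ⊢
    exact ⟨fun h => ⟨⟨h.1, ht.2.trans h.2⟩, h.2⟩, fun h => ⟨h.1.1, h.2⟩⟩
  rw [Pi.smul_apply, h, smul_eq_mul, one_sub_sq_mul_qInt]
  split_ifs <;> ring

lemma braidMat_of_gt {s c : I} (h : c < s) : braidMat p s c = 0 := by
  rw [braidMat, lAnnih, rCreate, annih_mul_create h.ne]
  simp [h.not_gt]

lemma braidMat_of_lt (hp : IsParam q p) {s c : I} (h : s < c) :
    braidMat p s c = -(1 - q ^ 2) • (rCreate p s * lAnnih p c) := by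
  rw [braidMat, lAnnih, rCreate, annih_mul_create h.ne']
  simp only [h, if_true, neg_mul_neg]
  rw [hp.mul_swap h.ne]
  module

/-- The two terms of the commutator live on the sets without and with `c`, with the same formula for
the eigenvalue. -/
lemma braidMat_self (hp : IsParam q p) (c : I) :
    braidMat p c c = Matrix.diagonal fun J => ∏ k ∈ J, -p k c := by
  rw [braidMat, lAnnih, rCreate, annih_mul_create_self, create_mul_annih_self,
    Matrix.diagonal_sub]
  congr 1; ext J
  have key : ∀ S : Finset I, c ∉ S → (∏ k ∈ S, if k < c then -p k c else 1) *
      (∏ k ∈ S, if c < k then -p k c else 1) = ∏ k ∈ S, -p k c := by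
    intro S hS
    rw [← Finset.prod_mul_distrib]
    refine Finset.prod_congr rfl fun k hk => ?_
    have hne : k ≠ c := ne_of_mem_of_not_mem hk hS
    rcases lt_or_gt_of_ne hne with h | h <;> simp [h, h.not_gt]
  split_ifs with h
  · rw [mul_comm, key _ (Finset.notMem_erase c J), ← Finset.mul_prod_erase J _ h, hp.diag]
    ring
  · rw [key J h, sub_zero]

/-- The braiding operators commute with the removal of a generator through the `R`-matrix. -/
lemma lAnnih_mul_braidMat (hp : IsParam q p) (b s c : I) :
    lAnnih p b * braidMat p s c = -p b c • (braidMat p s c * lAnnih p b) -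
      if b < c then (1 - q ^ 2) • (braidMat p s b * lAnnih p c) else 0 := by
  rcases lt_trichotomy s c with h | rfl | h
  · rcases lt_trichotomy b c with hb | rfl | hb
    · rw [if_pos hb, braidMat_of_lt hp h, braidMat, Matrix.mul_smul, ← Matrix.mul_assoc, sub_mul,
        Matrix.mul_assoc (rCreate p s), lAnnih_mul_lAnnih hb, Matrix.smul_mul,
        Matrix.mul_assoc (rCreate p s), Matrix.mul_smul]
      module
    · rw [if_neg (lt_irrefl b), braidMat_of_lt hp h, Matrix.smul_mul, Matrix.mul_smul,
        Matrix.mul_assoc, lAnnih_mul_self, ← Matrix.mul_assoc]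
      have h2 := braidMat_of_lt hp h
      rw [braidMat, sub_eq_iff_eq_add] at h2
      rw [h2, add_mul, Matrix.smul_mul, Matrix.mul_assoc, lAnnih_mul_self]
      simp
    · rw [if_neg hb.not_gt, braidMat_of_lt hp h, Matrix.smul_mul, Matrix.mul_smul,
        ← Matrix.mul_assoc]
      have h2 := braidMat_of_lt hp (h.trans hb)
      rw [braidMat, sub_eq_iff_eq_add] at h2
      rw [h2, add_mul, Matrix.smul_mul, Matrix.mul_assoc, Matrix.mul_assoc,
        lAnnih_mul_lAnnih hb, Matrix.mul_smul]
      have h3 := hp.mul_swap hb.ne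
      rw [sub_zero]
      match_scalars
      linear_combination (1 - q ^ 2) * h3
  · have h0 : (if b < s then (1 - q ^ 2) • (braidMat p s b * lAnnih p s) else 0) = 0 := by
      split_ifs with hb
      · rw [braidMat_of_gt hb]; simp
      · rfl
    rw [h0, sub_zero, braidMat_self hp, ← Matrix.smul_mul, ← Matrix.diagonal_smul]
    exact annih_mul_diagonal _ _ _ _ fun J hJ => by simp [Finset.prod_insert hJ]
  · rw [braidMat_of_gt h]
    split_ifs with hb
    · rw [braidMat_of_gt (hb.trans h)]; simp
    · simp

end Fock

/-! ### Scalar operators over an algebra -/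

section Lift

variable {I F A : Type*} [LinearOrder I] [Fintype I] [Field F] [Ring A] [Algebra F A]

/-- An operator with scalar coefficients, read over an algebra. -/
def liftMat (A : Type*) [Ring A] [Algebra F A] :
    Matrix (Finset I) (Finset I) F →+* Matrix (Finset I) (Finset I) A :=
  (algebraMap F A).mapMatrix

/-- Multiplication of all coefficients by an element of the algebra, as a scalar matrix. -/
def sc : A →+* Matrix (Finset I) (Finset I) A := Matrix.scalar (Finset I)

lemma sc_mul_apply (a : A) (M : Matrix (Finset I) (Finset I) A) (J K : Finset I) :
    ((sc a : Matrix (Finset I) (Finset I) A) * M) J K = a * M J K := by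
  simp [sc, Matrix.scalar_apply]

lemma mul_sc_apply (a : A) (M : Matrix (Finset I) (Finset I) A) (J K : Finset I) :
    (M * (sc a : Matrix (Finset I) (Finset I) A)) J K = M J K * a := by
  simp [sc, Matrix.scalar_apply]

lemma liftMat_apply (S : Matrix (Finset I) (Finset I) F) (J K : Finset I) :
    liftMat A S J K = algebraMap F A (S J K) := rfl

lemma liftMat_mul_sc (S : Matrix (Finset I) (Finset I) F) (a : A) :
    liftMat A S * sc a = sc a * liftMat A S := by
  ext J K
  rw [mul_sc_apply, sc_mul_apply, liftMat_apply, Algebra.commutes]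

lemma liftMat_smul (c : F) (S : Matrix (Finset I) (Finset I) F) :
    liftMat A (c • S) = c • liftMat A S := by
  ext J K
  rw [Matrix.smul_apply, liftMat_apply, liftMat_apply, Matrix.smul_apply, smul_eq_mul, map_mul,
    Algebra.smul_def]

lemma transpose_liftMat_mul (S : Matrix (Finset I) (Finset I) F)
    (M : Matrix (Finset I) (Finset I) A) : (liftMat A S * M)ᵀ = Mᵀ * liftMat A Sᵀ := by
  ext J K
  simp [Matrix.mul_apply, liftMat_apply, Algebra.commutes]

lemma transpose_mul_liftMat (S : Matrix (Finset I) (Finset I) F)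
    (M : Matrix (Finset I) (Finset I) A) : (M * liftMat A S)ᵀ = liftMat A Sᵀ * Mᵀ := by
  ext J K
  simp [Matrix.mul_apply, liftMat_apply, Algebra.commutes]

lemma transpose_sc_mul (a : A) (M : Matrix (Finset I) (Finset I) A) :
    (sc a * M)ᵀ = sc a * Mᵀ := by
  ext J K
  simp only [Matrix.transpose_apply, sc_mul_apply]

lemma transpose_mul_sc (a : A) (M : Matrix (Finset I) (Finset I) A) :
    (M * sc a)ᵀ = Mᵀ * (sc a : Matrix (Finset I) (Finset I) A) := by
  ext J K
  simp only [Matrix.transpose_apply, mul_sc_apply]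

lemma liftMat_create_mul_apply (f : I → I → F) (c : I)
    (M : Matrix (Finset I) (Finset I) A) (J L : Finset I) :
    (liftMat A (create f c) * M) J L =
      if c ∈ J then algebraMap F A (∏ k ∈ J.erase c, f c k) * M (J.erase c) L else 0 :=
  map_create_mul_apply (algebraMap F A) f c M J L

lemma liftMat_annih_mul_apply (f : I → I → F) (c : I)
    (M : Matrix (Finset I) (Finset I) A) (J L : Finset I) :
    (liftMat A (annih f c) * M) J L =
      if c ∉ J then algebraMap F A (∏ k ∈ J, f c k) * M (insert c J) L else 0 :=
  map_annih_mul_apply (algebraMap F A) f c M J L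

lemma mul_liftMat_annih_apply (f : I → I → F) (c : I)
    (M : Matrix (Finset I) (Finset I) A) (J L : Finset I) :
    (M * liftMat A (annih f c)) J L =
      if c ∈ L then algebraMap F A (∏ k ∈ L.erase c, f c k) * M J (L.erase c) else 0 := by
  have h := congrFun (congrFun (transpose_mul_liftMat (annih f c) M) L) J
  rw [Matrix.transpose_apply] at h
  rw [h, transpose_annih, liftMat_create_mul_apply, Matrix.transpose_apply]

lemma liftMat_degMat_mul_apply (g : ℕ → F) (M : Matrix (Finset I) (Finset I) A)
    (J K : Finset I) : (liftMat A (degMat I g) * M) J K = g J.card • M J K := by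
  have : liftMat A (degMat I g) = Matrix.diagonal fun K => algebraMap F A (g K.card) := by
    ext J K
    by_cases h : J = K <;> simp [liftMat_apply, degMat, Matrix.diagonal_apply, h]
  rw [this, Matrix.diagonal_mul, Algebra.smul_def]

lemma mul_liftMat_degMat_apply (g : ℕ → F) (M : Matrix (Finset I) (Finset I) A)
    (J K : Finset I) : (M * liftMat A (degMat I g)) J K = g K.card • M J K := by
  have h := congrFun (congrFun (transpose_mul_liftMat (degMat I g) M) K) J
  rw [Matrix.transpose_apply] at h
  rw [h, degMat, Matrix.diagonal_transpose, ← degMat, liftMat_degMat_mul_apply,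
    Matrix.transpose_apply]

end Lift

/-! ### Ordered products of generators of a quantum exterior algebra -/

section OrdProd

variable {I F B : Type*} [LinearOrder I] [Field F] [Ring B] [Algebra F B]

/-- The product of the `β j`, `j ∈ J`, in ascending order. -/
def ordProd (β : I → B) (J : Finset I) : B := ((J.sort (· ≤ ·)).map β).prod

@[simp] lemma ordProd_empty (β : I → B) : ordProd β ∅ = 1 := by simp [ordProd]

lemma ordProd_insert_of_lt (β : I → B) {J : Finset I} {a : I} (h : ∀ b ∈ J, a < b) :
    ordProd β (insert a J) = β a * ordProd β J := by
  rw [ordProd, Finset.sort_insert _ (fun b hb => (h b hb).le) (fun ha => lt_irrefl _ (h a ha))]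
  simp [ordProd]

variable {Q : I → I → F} {β : I → B}

/-- Normal ordering of a product with a further generator on the left. -/
lemma mul_ordProd (h0 : ∀ a, β a * β a = 0)
    (h1 : ∀ a b, a < b → β b * β a = -Q a b • (β a * β b)) (t : I) (J : Finset I) :
    β t * ordProd β J =
      if t ∉ J then (∏ k ∈ J, if k < t then -Q k t else 1) • ordProd β (insert t J) else 0 := by
  induction J using Finset.induction_on_min with
  | empty => simp [ordProd]
  | insert m J hm ih =>
    have hmJ : m ∉ J := fun h => lt_irrefl _ (hm m h)
    rw [ordProd_insert_of_lt β hm]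
    rcases lt_trichotomy t m with h | rfl | h
    · have ht : ∀ b ∈ insert m J, t < b := by
        intro b hb
        rcases Finset.mem_insert.1 hb with rfl | hb
        · exact h
        · exact h.trans (hm b hb)
      have ht' : t ∉ insert m J := fun hh => lt_irrefl _ (ht t hh)
      rw [if_pos ht', ordProd_insert_of_lt β ht, ordProd_insert_of_lt β hm, Finset.prod_eq_one,
        one_smul]
      intro k hk
      rw [if_neg (ht k hk).not_gt]
    · rw [← mul_assoc, h0, zero_mul, if_neg (by simp)]
    · rw [← mul_assoc, h1 m t h, smul_mul_assoc, mul_assoc, ih]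
      by_cases htJ : t ∈ J
      · simp [htJ]
      · have hmt : ∀ b ∈ insert t J, m < b := by
          intro b hb
          rcases Finset.mem_insert.1 hb with rfl | hb
          · exact h
          · exact hm b hb
        rw [if_pos htJ, if_pos (by simp [htJ, h.ne']), Finset.prod_insert hmJ, if_pos h,
          Finset.insert_comm, ordProd_insert_of_lt β hmt, mul_smul_comm, smul_smul]

/-- Normal ordering of a product with a further generator on the right. -/
lemma ordProd_mul (h0 : ∀ a, β a * β a = 0)
    (h1 : ∀ a b, a < b → β b * β a = -Q a b • (β a * β b)) (t : I) (J : Finset I) :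
    ordProd β J * β t =
      if t ∉ J then (∏ k ∈ J, if t < k then -Q t k else 1) • ordProd β (insert t J) else 0 := by
  induction J using Finset.induction_on_min with
  | empty => simp [ordProd]
  | insert m J hm ih =>
    have hmJ : m ∉ J := fun h => lt_irrefl _ (hm m h)
    rw [ordProd_insert_of_lt β hm, mul_assoc, ih]
    by_cases htJ : t ∈ J
    · simp [htJ]
    · rw [if_pos htJ, mul_smul_comm, mul_ordProd h0 h1, Finset.prod_insert hmJ]
      rcases eq_or_ne m t with rfl | hmt
      · simp
      · rw [if_pos (by simp [hmt, hmJ]), if_pos (by simp [hmt.symm, htJ]), smul_smul,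
          Finset.insert_comm, Finset.prod_insert htJ]
        have h2 : (∏ k ∈ J, if k < m then -Q k m else 1) = 1 :=
          Finset.prod_eq_one fun k hk => by rw [if_neg (hm k hk).not_gt]
        rw [h2]
        congr 1
        ring

end OrdProd

/-! ### The matrix of quantum minors -/

section Minor

variable {I F A : Type*} [LinearOrder I] [Fintype I] [Field F] [Ring A] [Algebra F A]

/-- The relation `R X₁ X₂ = X₂ X₁ R`, entry by entry. -/
structure IsQuantumMatrix (q : F) (Q : I → I → F) (x : I → I → A) : Prop where
  rel : ∀ a b c d, Q a b • (x a c * x b d) + (if a < b then (1 - q ^ 2) • (x b c * x a d) else 0) =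
    Q c d • (x b d * x a c) + (if d < c then (1 - q ^ 2) • (x b c * x a d) else 0)

/-- The coaction `ξ_j ↦ ∑ l, x_jl ξ_l` on the generators of the quantum exterior algebra. -/
def rowOp (Q : I → I → F) (x : I → I → A) (j : I) : Matrix (Finset I) (Finset I) A :=
  ∑ l, sc (x j l) * liftMat A (lCreate (fun a b => Q b a) l)

/-- The matrix of all quantum minors `[x]_{J,K}`: the coefficient of `ξ_K` in the product of the
images of the `ξ_j`, `j ∈ J`. -/
def qMinor (Q : I → I → F) (x : I → I → A) : Matrix (Finset I) (Finset I) A :=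
  Matrix.of fun J K => ordProd (rowOp Q x) J K ∅

variable {q : F} {Q : I → I → F} {x : I → I → A}

lemma IsQuantumMatrix.swap (h : IsQuantumMatrix q Q x) :
    IsQuantumMatrix q (fun i j => Q j i) (fun i j => x j i) where
  rel a b c d := by
    have := h.rel d c b a
    exact this.symm

/-- A quadratic expression in the generators vanishes if its coefficients are `Q`-symmetric. -/
lemma sum_quadratic_eq_zero (y : I → I → A) (h : ∀ c d, c < d → y c d = Q c d • y d c) :
    ∑ c, ∑ d, sc (y c d) * liftMat A (lCreate (fun a b => Q b a) c * lCreate (fun a b => Q b a) d)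
      = 0 := by
  set f : I → I → Matrix (Finset I) (Finset I) A := fun c d => sc (y c d) *
    liftMat A (lCreate (fun a b => Q b a) c * lCreate (fun a b => Q b a) d) with hf
  have h1 : ∀ c d, f c d = (if c < d then f c d else 0) + if d < c then f c d else 0 := by
    intro c d
    rcases lt_trichotomy c d with h | rfl | h
    · simp [h, h.not_gt]
    · simp only [hf, lCreate_mul_self, map_zero, mul_zero, lt_irrefl, if_false, add_zero]
    · simp [h, h.not_gt]
  have h2 : ∑ c, ∑ d, (if d < c then f c d else 0) = ∑ c, ∑ d, if c < d then f d c else 0 :=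
    Finset.sum_comm
  change ∑ c, ∑ d, f c d = 0
  rw [Finset.sum_congr rfl fun c _ => Finset.sum_congr rfl fun d _ => h1 c d]
  simp only [Finset.sum_add_distrib]
  rw [h2, ← Finset.sum_add_distrib]
  refine Finset.sum_eq_zero fun c _ => ?_
  rw [← Finset.sum_add_distrib]
  refine Finset.sum_eq_zero fun d _ => ?_
  split_ifs with hcd
  · simp only [hf]
    rw [lCreate_mul_lCreate hcd, liftMat_smul, h c d hcd]
    ext J K
    simp [sc_mul_apply]
  · simp

lemma rowOp_mul_rowOp (a b : I) : rowOp Q x a * rowOp Q x b =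
    ∑ c, ∑ d, sc (x a c * x b d) *
      liftMat A (lCreate (fun a b => Q b a) c * lCreate (fun a b => Q b a) d) := by
  rw [rowOp, rowOp, Finset.sum_mul]
  refine Finset.sum_congr rfl fun c _ => ?_
  rw [Finset.mul_sum]
  refine Finset.sum_congr rfl fun d _ => ?_
  rw [map_mul, map_mul, mul_assoc, ← mul_assoc (liftMat A _), liftMat_mul_sc]
  simp only [mul_assoc]

lemma rowOp_mul_self (hp : IsParam q Q) (h : IsQuantumMatrix q Q x) (a : I) :
    rowOp Q x a * rowOp Q x a = 0 := by
  rw [rowOp_mul_rowOp]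
  refine sum_quadratic_eq_zero (fun c d => x a c * x a d) fun c d hcd => ?_
  have := h.rel a a c d
  simpa [hp.diag, hcd.not_gt] using this

/-- The images of the generators under the coaction satisfy the relations of the exterior algebra. -/
lemma rowOp_mul_of_lt (hp : IsParam q Q) (h : IsQuantumMatrix q Q x) {a b : I} (hab : a < b) :
    rowOp Q x b * rowOp Q x a = -Q a b • (rowOp Q x a * rowOp Q x b) := by
  rw [neg_smul, ← add_eq_zero_iff_eq_neg, rowOp_mul_rowOp, rowOp_mul_rowOp]
  have := sum_quadratic_eq_zero (Q := Q) (fun c d => x b c * x a d + Q a b • (x a c * x b d))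
    fun c d hcd => ?_
  · rw [← this]
    simp only [Finset.smul_sum, ← Finset.sum_add_distrib]
    refine Finset.sum_congr rfl fun c _ => Finset.sum_congr rfl fun d _ => ?_
    rw [map_add, add_mul]
    congr 1
    ext J K
    rw [Matrix.smul_apply, sc_mul_apply, sc_mul_apply, smul_mul_assoc]
  · have h1 := h.rel a b c d
    have h2 := h.rel a b d c
    rw [if_pos hab, if_neg hcd.not_gt, add_zero] at h1
    rw [if_pos hab, if_pos hcd, add_left_inj] at h2
    rw [smul_add, h2, ← h1, smul_smul, hp.mul_swap hcd.ne]
    module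

lemma liftMat_create_vac (Q : I → I → F) (c : I) :
    ∀ K, lCreate Q c K ∅ = rCreate Q c K ∅ := by
  intro K; simp [lCreate, rCreate, create]

/-- On the vacuum, left and right multiplication agree. -/
lemma mul_liftMat_vac (M : Matrix (Finset I) (Finset I) A) (Q : I → I → F) (c : I)
    (K : Finset I) :
    (M * liftMat A (lCreate Q c)) K ∅ = (M * liftMat A (rCreate Q c)) K ∅ := by
  simp only [Matrix.mul_apply, liftMat_apply, liftMat_create_vac]

lemma rowOp_mul_rCreate (a c : I) : rowOp Q x a * liftMat A (rCreate (fun a b => Q b a) c) =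
    liftMat A (rCreate (fun a b => Q b a) c) * rowOp Q x a := by
  rw [rowOp, Finset.sum_mul, Finset.mul_sum]
  refine Finset.sum_congr rfl fun l _ => ?_
  rw [mul_assoc, ← map_mul, lCreate_mul_rCreate, map_mul, ← mul_assoc, ← liftMat_mul_sc,
    mul_assoc]

lemma ordProd_rowOp_mul_rCreate (J : Finset I) (c : I) :
    ordProd (rowOp Q x) J * liftMat A (rCreate (fun a b => Q b a) c) =
    liftMat A (rCreate (fun a b => Q b a) c) * ordProd (rowOp Q x) J := by
  induction J using Finset.induction_on_min with
  | empty => simp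
  | insert m J hm ih =>
    rw [ordProd_insert_of_lt _ hm, mul_assoc, ih, ← mul_assoc, rowOp_mul_rCreate, mul_assoc]

/-- Expansion of the quantum minors along the first row. -/
lemma lAnnih_mul_qMinor (hp : IsParam q Q) (h : IsQuantumMatrix q Q x) (t : I) :
    liftMat A (lAnnih Q t) * qMinor Q x =
      ∑ c, sc (x t c) * (qMinor Q x * liftMat A (lAnnih Q c)) := by
  ext J K
  have h1 := congrFun (congrFun (mul_ordProd (rowOp_mul_self hp h)
    (fun a b => rowOp_mul_of_lt hp h) t J) K) ∅
  rw [lAnnih, liftMat_annih_mul_apply]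
  trans (rowOp Q x t * ordProd (rowOp Q x) J) K ∅
  · rw [h1]
    split_ifs with hJ
    · rfl
    · rw [Matrix.smul_apply, Algebra.smul_def]; rfl
  · rw [rowOp, Finset.sum_mul, Matrix.sum_apply, Matrix.sum_apply]
    refine Finset.sum_congr rfl fun c _ => ?_
    rw [mul_assoc, sc_mul_apply, sc_mul_apply, lCreate, liftMat_create_mul_apply,
      mul_liftMat_annih_apply]
    rfl

/-- Expansion of the quantum minors along the last row. -/
lemma rAnnih_mul_qMinor (hp : IsParam q Q) (h : IsQuantumMatrix q Q x) (t : I) :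
    liftMat A (rAnnih Q t) * qMinor Q x =
      ∑ c, (qMinor Q x * liftMat A (rAnnih Q c)) * sc (x t c) := by
  ext J K
  have h1 := congrFun (congrFun (ordProd_mul (rowOp_mul_self hp h)
    (fun a b => rowOp_mul_of_lt hp h) t J) K) ∅
  rw [rAnnih, liftMat_annih_mul_apply]
  trans (ordProd (rowOp Q x) J * rowOp Q x t) K ∅
  · rw [h1]
    split_ifs with hJ
    · rfl
    · rw [Matrix.smul_apply, Algebra.smul_def]; rfl
  · rw [rowOp, Finset.mul_sum, Matrix.sum_apply, Matrix.sum_apply]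
    refine Finset.sum_congr rfl fun c _ => ?_
    rw [← mul_assoc, mul_liftMat_vac, mul_assoc, ← liftMat_mul_sc, ← mul_assoc,
      ordProd_rowOp_mul_rCreate, mul_sc_apply, mul_sc_apply, rCreate, liftMat_create_mul_apply,
      mul_liftMat_annih_apply]
    rfl

lemma qMinor_empty (K : Finset I) : qMinor Q x ∅ K = if K = ∅ then 1 else 0 := by
  simp [qMinor, Matrix.one_apply]

lemma neg_ne_zero_ite (hp : IsParam q Q) (P : Prop) [Decidable P] (a b : I) :
    (if P then -Q a b else 1) ≠ 0 := by
  split_ifs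
  · exact neg_ne_zero.2 (hp.apply_ne_zero a b)
  · exact one_ne_zero

/-- Left multiplication by `lAnnih Q t` moves the row `insert t J` to the row `J`, up to a nonzero
scalar. -/
lemma apply_insert_of_lAnnih (hp : IsParam q Q) {M : Matrix (Finset I) (Finset I) A} {J K : Finset I}
    {t : I} (ht : t ∉ J) (h : (liftMat A (lAnnih Q t) * M) J K = 0) : M (insert t J) K = 0 := by
  rw [lAnnih, liftMat_annih_mul_apply, if_pos ht, ← Algebra.smul_def] at h
  exact (smul_eq_zero_iff_right
    (Finset.prod_ne_zero_iff.2 fun k _ => neg_ne_zero_ite hp _ _ _)).1 h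

lemma apply_insert_of_rAnnih (hp : IsParam q Q) {M : Matrix (Finset I) (Finset I) A} {J K : Finset I}
    {t : I} (ht : t ∉ J) (h : (liftMat A (rAnnih Q t) * M) J K = 0) : M (insert t J) K = 0 := by
  rw [rAnnih, liftMat_annih_mul_apply, if_pos ht, ← Algebra.smul_def] at h
  exact (smul_eq_zero_iff_right
    (Finset.prod_ne_zero_iff.2 fun k _ => neg_ne_zero_ite hp _ _ _)).1 h

lemma qMinor_eq_zero (hp : IsParam q Q) (h : IsQuantumMatrix q Q x) {J K : Finset I}
    (hJK : J.card ≠ K.card) : qMinor Q x J K = 0 := by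
  induction J using Finset.induction_on generalizing K with
  | empty =>
    rw [qMinor_empty, if_neg]
    rintro rfl; exact hJK rfl
  | insert t J ht ih =>
    refine apply_insert_of_lAnnih (A := A) hp ht ?_
    rw [lAnnih_mul_qMinor hp h, Matrix.sum_apply]
    refine Finset.sum_eq_zero fun c _ => ?_
    rw [sc_mul_apply, lAnnih, mul_liftMat_annih_apply]
    split_ifs with hc
    · rw [ih, mul_zero, mul_zero]
      rw [Finset.card_insert_of_notMem ht] at hJK
      have := Finset.card_erase_add_one hc
      omega
    · rw [mul_zero]

lemma qMinor_mul_degMat (hp : IsParam q Q) (h : IsQuantumMatrix q Q x) (g : ℕ → F) :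
    qMinor Q x * liftMat A (degMat I g) = liftMat A (degMat I g) * qMinor Q x := by
  ext J K
  rw [mul_liftMat_degMat_apply, liftMat_degMat_mul_apply]
  by_cases hJK : J.card = K.card
  · rw [hJK]
  · rw [qMinor_eq_zero hp h hJK, smul_zero, smul_zero]

lemma transpose_qMinor_mul_lCreate (hp : IsParam q Q) (h : IsQuantumMatrix q Q x) (t : I) :
    (qMinor (fun i j => Q j i) (fun i j => x j i))ᵀ * liftMat A (lCreate Q t) =
      ∑ c, sc (x c t) * (liftMat A (lCreate Q c) * (qMinor (fun i j => Q j i) (fun i j => x j i))ᵀ) := by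
  have h1 := congrArg Matrix.transpose (lAnnih_mul_qMinor hp.swap h.swap t)
  rw [transpose_liftMat_mul, Matrix.transpose_sum] at h1
  simp only [transpose_sc_mul, transpose_mul_liftMat] at h1
  exact h1

lemma transpose_qMinor_mul_rCreate (hp : IsParam q Q) (h : IsQuantumMatrix q Q x) (t : I) :
    (qMinor (fun i j => Q j i) (fun i j => x j i))ᵀ * liftMat A (rCreate Q t) =
      ∑ c, liftMat A (rCreate Q c) * (qMinor (fun i j => Q j i) (fun i j => x j i))ᵀ * sc (x c t) := by
  have h1 := congrArg Matrix.transpose (rAnnih_mul_qMinor hp.swap h.swap t)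
  rw [transpose_liftMat_mul, Matrix.transpose_sum] at h1
  simp only [transpose_mul_sc, transpose_mul_liftMat] at h1
  exact h1

/-- The expansions of a quantum minor over the columns and over the rows agree. By induction on
the degree: the Euler operator multiplies both sides by the same nonzero `q`-integer. -/
lemma transpose_qMinor (hp : IsParam q Q) (h : IsQuantumMatrix q Q x) :
    (qMinor (fun i j => Q j i) (fun i j => x j i))ᵀ = qMinor Q x := by
  ext J K
  induction hn : K.card generalizing J K with
  | zero =>
    obtain rfl := Finset.card_eq_zero.1 hn
    rw [Matrix.transpose_apply, qMinor_empty]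
    split_ifs with hJ
    · rw [hJ, qMinor_empty, if_pos rfl]
    · rw [qMinor_eq_zero hp h]
      rw [Finset.card_empty]
      exact fun h' => hJ (Finset.card_eq_zero.1 h')
  | succ n ih =>
    by_cases hJK : J.card = K.card
    · have h1 : (liftMat A (degMat I (qInt q)) * qMinor Q x) J K =
          ((qMinor (fun i j => Q j i) (fun i j => x j i))ᵀ * liftMat A (degMat I (qInt q))) J K := by
        rw [← sum_lCreate_mul_lAnnih hp, map_sum, Finset.sum_mul, Finset.mul_sum]
        simp only [map_mul, mul_assoc, lAnnih_mul_qMinor hp h]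
        simp only [← mul_assoc, transpose_qMinor_mul_lCreate hp h]
        simp only [Finset.mul_sum, Finset.sum_mul]
        rw [Finset.sum_comm, Matrix.sum_apply, Matrix.sum_apply]
        refine Finset.sum_congr rfl fun c _ => ?_
        rw [Matrix.sum_apply, Matrix.sum_apply]
        refine Finset.sum_congr rfl fun d _ => ?_
        rw [← mul_assoc, ← mul_assoc, liftMat_mul_sc, mul_assoc, mul_assoc, mul_assoc, mul_assoc,
          sc_mul_apply, sc_mul_apply, lCreate, liftMat_create_mul_apply, liftMat_create_mul_apply]
        split_ifs with hd
        · rw [lAnnih, mul_liftMat_annih_apply, mul_liftMat_annih_apply]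
          split_ifs with hc
          · rw [ih]
            rw [Finset.card_erase_of_mem hc, hn]; rfl
          · rfl
        · rfl
      rw [liftMat_degMat_mul_apply, mul_liftMat_degMat_apply, hJK, hn] at h1
      exact (smul_right_injective A (hp.qInt_ne_zero n) h1).symm
    · rw [qMinor_eq_zero hp h hJK, Matrix.transpose_apply,
        qMinor_eq_zero hp.swap h.swap (Ne.symm hJK)]

/-- Expansion of the quantum minors along the first column. -/
lemma qMinor_mul_lCreate (hp : IsParam q Q) (h : IsQuantumMatrix q Q x) (t : I) :
    qMinor Q x * liftMat A (lCreate Q t) =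
      ∑ c, sc (x c t) * (liftMat A (lCreate Q c) * qMinor Q x) := by
  rw [← transpose_qMinor hp h]; exact transpose_qMinor_mul_lCreate hp h t

/-- Expansion of the quantum minors along the last column. -/
lemma qMinor_mul_rCreate (hp : IsParam q Q) (h : IsQuantumMatrix q Q x) (t : I) :
    qMinor Q x * liftMat A (rCreate Q t) =
      ∑ c, liftMat A (rCreate Q c) * qMinor Q x * sc (x c t) := by
  rw [← transpose_qMinor hp h]; exact transpose_qMinor_mul_rCreate hp h t

end Minor

/-! ### Contractions of the braiding -/

section ScalarIdentities

variable {I F : Type*} [LinearOrder I] [Fintype I] [Field F] {q : F} {p : I → I → F}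

lemma create_mul_degMat_congr (f : I → I → F) (c : I) {g h : ℕ → F}
    (hgh : ∀ n < Fintype.card I, g n = h n) :
    create f c * degMat I g = create f c * degMat I h := by
  ext J L
  rw [degMat, degMat, Matrix.mul_diagonal, Matrix.mul_diagonal, create, Matrix.of_apply]
  split_ifs with h1
  · rw [hgh]
    exact Finset.card_lt_univ_of_notMem h1.1
  · simp

/-- A weighted contraction of the braiding against left multiplications. -/
lemma sum_braidMat_mul_lCreate (hp : IsParam q p) (s : I) :
    ∑ c, wGt I q c • (braidMat p s c * lCreate p c) =
      -(rCreate p s * degMat I fun n => q ^ (2 * n)) := by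
  have h1 : ∀ c, wGt I q c • (braidMat p s c * lCreate p c) =
      wGt I q c • (lAnnih p c * lCreate p c) * rCreate p s -
        rCreate p s * wGt I q c • (lAnnih p c * lCreate p c) := by
    intro c
    rw [braidMat, sub_mul, Matrix.mul_assoc, ← lCreate_mul_rCreate, smul_sub, Matrix.smul_mul,
      Matrix.mul_smul, Matrix.mul_assoc, Matrix.mul_assoc]
  rw [Finset.sum_congr rfl fun c _ => h1 c, Finset.sum_sub_distrib, ← Finset.sum_mul,
    ← Finset.mul_sum, sum_lAnnih_mul_lCreate hp]
  have h2 := degMat_mul_create (I := I) (fun c k => if c < k then -p k c else 1) s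
    (fun n => q ^ (2 * n) * qInt q (Fintype.card I - n))
  rw [← rCreate] at h2
  rw [h2, ← Matrix.mul_sub, ← Matrix.mul_neg, degMat, degMat, degMat, Matrix.diagonal_sub,
    Matrix.diagonal_neg]
  refine create_mul_degMat_congr _ s
    (g := fun n => q ^ (2 * (n + 1)) * qInt q (Fintype.card I - (n + 1)) -
      q ^ (2 * n) * qInt q (Fintype.card I - n)) (h := fun n => -q ^ (2 * n)) fun n hn => ?_
  obtain ⟨m, hm⟩ : ∃ m, Fintype.card I - n = m + 1 := ⟨Fintype.card I - n - 1, by omega⟩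
  rw [hm, show Fintype.card I - (n + 1) = m by omega, qInt_succ']
  ring

/-- The Euler operator inside of which a right multiplication and a right removal act. These commute
with the left operators, so that only the degree is shifted. -/
lemma sum_lCreate_mul_mul_lAnnih (hp : IsParam q p) (a b : I) :
    q ^ 2 • ∑ t, lCreate p t * (rCreate p a * rAnnih p b) * lAnnih p t =
      (degMat I (qInt q) - 1) * (rCreate p a * rAnnih p b) := by
  have h1 : ∀ t, lCreate p t * (rCreate p a * rAnnih p b) * lAnnih p t =
      rCreate p a * (lCreate p t * lAnnih p t) * rAnnih p b := by
    intro t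
    rw [← Matrix.mul_assoc, lCreate_mul_rCreate, Matrix.mul_assoc, rAnnih_mul_lAnnih]
    simp only [Matrix.mul_assoc]
  rw [Finset.sum_congr rfl fun t _ => h1 t, ← Finset.sum_mul, ← Finset.mul_sum,
    sum_lCreate_mul_lAnnih hp]
  have h2 : degMat I (qInt q) * rCreate p a = rCreate p a + q ^ 2 • (rCreate p a *
      degMat I (qInt q)) := by
    have h3 : (degMat I fun n => qInt q (n + 1)) = 1 + q ^ 2 • degMat I (qInt q) := by
      rw [degMat, degMat, ← Matrix.diagonal_one, ← Matrix.diagonal_smul, Matrix.diagonal_add]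
      congr 1; ext J
      exact qInt_succ' q _
    rw [rCreate, degMat_mul_create, h3, Matrix.mul_add, Matrix.mul_one, Matrix.mul_smul]
  rw [sub_mul, one_mul, ← Matrix.mul_assoc, h2, add_mul, Matrix.smul_mul]
  abel

/-- Contraction of the braiding against left multiplications and right removals. -/
lemma sum_lCreate_mul_braidMat (hp : IsParam q p) (i j : I) :
    q ^ 2 • ∑ t, lCreate p t * rAnnih p j * braidMat p i t =
      -((degMat I fun n => q ^ (2 * n)) *
        ((if i = j then 1 else 0) - rAnnih p j * rCreate p i)) := by
  have hκ : (degMat I fun n => q ^ (2 * n)) = 1 - (1 - q ^ 2) • degMat I (qInt q) := by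
    rw [degMat, degMat, ← Matrix.diagonal_one, ← Matrix.diagonal_smul, Matrix.diagonal_sub]
    congr 1; ext J
    rw [Pi.smul_apply, smul_eq_mul, one_sub_sq_mul_qInt]; ring
  have h1 : ∀ t, lCreate p t * rAnnih p j * braidMat p i t =
      (lCreate p t * lAnnih p t) * (rAnnih p j * rCreate p i) -
        lCreate p t * (rAnnih p j * rCreate p i) * lAnnih p t := by
    intro t
    rw [braidMat, Matrix.mul_sub, Matrix.mul_assoc, ← Matrix.mul_assoc (rAnnih p j),
      rAnnih_mul_lAnnih]
    simp only [Matrix.mul_assoc]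
  rw [Finset.sum_congr rfl fun t _ => h1 t, Finset.sum_sub_distrib, ← Finset.sum_mul,
    sum_lCreate_mul_lAnnih hp, smul_sub]
  split_ifs with hij
  · subst hij
    set n := degMat I (qInt q)
    have h2 : q ^ 2 • ∑ t, lCreate p t * (rAnnih p i * rCreate p i) * lAnnih p t =
        q ^ 2 • n - (n - 1) * (1 - rAnnih p i * rCreate p i) := by
      rw [rAnnih_mul_rCreate_eq hp]
      simp only [Matrix.mul_sub, Matrix.sub_mul, Finset.sum_sub_distrib, Matrix.mul_one,
        smul_sub, sum_lCreate_mul_lAnnih hp, sum_lCreate_mul_mul_lAnnih hp]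
      have h3 : ∑ t, lCreate p t * ((1 - q ^ 2) • ∑ s with i < s, rCreate p s * rAnnih p s) *
          lAnnih p t = (1 - q ^ 2) • ∑ s with i < s, ∑ t,
            lCreate p t * (rCreate p s * rAnnih p s) * lAnnih p t := by
        conv_rhs => rw [Finset.sum_comm, Finset.smul_sum]
        refine Finset.sum_congr rfl fun t _ => ?_
        rw [Matrix.mul_smul, Matrix.smul_mul, Finset.mul_sum, Finset.sum_mul]
      have h4 : q ^ 2 • ∑ s with i < s, ∑ t, lCreate p t * (rCreate p s * rAnnih p s) *
          lAnnih p t = ∑ s with i < s, (n - 1) * (rCreate p s * rAnnih p s) := by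
        rw [Finset.smul_sum]
        exact Finset.sum_congr rfl fun s _ => sum_lCreate_mul_mul_lAnnih hp s s
      rw [h3, smul_comm (q ^ 2), h4]
      rw [← Finset.mul_sum, sub_mul n 1, one_mul, Matrix.mul_smul]
      simp only [Matrix.one_mul]
      abel_nf
      module
    rw [h2, hκ]
    simp only [Matrix.sub_mul, Matrix.mul_sub, Matrix.smul_mul, Matrix.mul_one, Matrix.one_mul]
    module
  · have h2 := rAnnih_mul_rCreate_of_ne (p := p) (Ne.symm hij)
    have h3 : q ^ 2 • ∑ t, lCreate p t * (rAnnih p j * rCreate p i) * lAnnih p t =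
        (degMat I (qInt q) - 1) * (rAnnih p j * rCreate p i) := by
      rw [h2]
      simp only [Matrix.mul_smul, Matrix.smul_mul, ← Finset.smul_sum]
      rw [smul_comm, sum_lCreate_mul_mul_lAnnih hp]
    rw [h3, hκ]
    simp only [Matrix.sub_mul, Matrix.mul_sub, Matrix.smul_mul, Matrix.one_mul,
      Matrix.mul_zero]
    module

lemma braidMat_empty (hp : IsParam q p) (s c : I) (L : Finset I) :
    braidMat p s c ∅ L = if s = c ∧ L = ∅ then 1 else 0 := by
  rcases lt_trichotomy s c with h | rfl | h
  · rw [braidMat_of_lt hp h, Matrix.smul_apply, rCreate, create_mul_apply]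
    simp [h.ne]
  · rw [braidMat_self hp, Matrix.diagonal_apply]
    simp [eq_comm]
  · rw [braidMat_of_gt h]
    simp [h.ne']

end ScalarIdentities

/-! ### The relations of `X` and `Y`, and the exchange relation -/

section System

open MulOpposite

variable {I F A : Type*} [LinearOrder I] [Fintype I] [Field F] [Ring A] [Algebra F A]

/-- The relations between the entries of `X` and `Y`, entry by entry. -/
structure QSystem (q : F) (Q : I → I → F) (X Y : I → I → A) : Prop where
  param : IsParam q Q
  X_rel : IsQuantumMatrix q Q X
  Y_rel : ∀ a b c d, Q a b • (Y b d * Y a c) +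
      (if a < b then (1 - q ^ 2) • (Y a d * Y b c) else 0) =
    Q c d • (Y a c * Y b d) + (if d < c then (1 - q ^ 2) • (Y a d * Y b c) else 0)
  cross : ∀ a b c d, Q c b • (X a c * Y b d) +
      (if b = c then (1 - q ^ 2) • ∑ s with s < b, X a s * Y s d else 0) =
    Q a d • (Y b d * X a c) + (if a = d then (1 - q ^ 2) • ∑ s with a < s, Y b s * X s c else 0)

variable {q : F} {Q : I → I → F} {X Y : I → I → A}

lemma QSystem.op_Y_rel (h : QSystem q Q X Y) :
    IsQuantumMatrix q (fun i j => Q j i) (fun i j => op (Y j i)) where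
  rel a b c d := by
    have := congrArg op (h.Y_rel d c b a)
    simpa only [apply_ite op, op_add, op_smul, op_mul, op_zero] using this.symm

/-- The opposite algebra carries the same relations, with `X` and `Y` exchanged and transposed. -/
lemma QSystem.opposite (h : QSystem q Q X Y) :
    QSystem q (fun i j => Q j i) (fun i j => op (Y j i)) (fun i j => op (X j i)) where
  param := h.param.swap
  X_rel := h.op_Y_rel
  Y_rel a b c d := by
    have := congrArg op (h.X_rel.rel d c b a)
    simpa only [apply_ite op, op_add, op_smul, op_mul, op_zero] using this.symm
  cross a b c d := by
    have := congrArg op (h.cross d c b a)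
    simp only [apply_ite op, op_add, op_smul, op_mul, op_zero, Finset.op_sum] at this
    by_cases hbc : b = c <;> by_cases had : a = d
    · subst hbc had; simpa using this
    · subst hbc; simpa [had, Ne.symm had] using this
    · subst had; simpa [hbc, Ne.symm hbc] using this
    · simpa [hbc, had, Ne.symm hbc, Ne.symm had] using this

/-- The relations are also symmetric under reversal of the order of the indices. -/
lemma QSystem.dual (h : QSystem q Q X Y) :
    QSystem (I := Iᵒᵈ) q (fun i j => Q j i) Y X where
  param := h.param.swap
  X_rel := ⟨fun a b c d => by
    have := h.Y_rel b a d c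
    exact this⟩
  Y_rel a b c d := by
    have := h.X_rel.rel b a d c
    exact this
  cross a b c d := by
    have key : ∀ a b c d : I, Q b c • (Y a c * X b d) +
        (if b = c then (1 - q ^ 2) • ∑ s with b < s, Y a s * X s d else 0) =
        Q d a • (X b d * Y a c) +
          (if a = d then (1 - q ^ 2) • ∑ s with s < a, X b s * Y s c else 0) := by
      intro a b c d
      have := (h.cross b a d c).symm
      by_cases hbc : b = c <;> by_cases had : a = d
      · subst hbc had; simpa using this
      · subst hbc; simpa [had, Ne.symm had] using this
      · subst had; simpa [hbc, Ne.symm hbc] using this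
      · simpa [hbc, had, Ne.symm hbc, Ne.symm had] using this
    exact key a b c d

/-- The matrix of the quantum minors of `X`, with the columns as the first index. -/
def minorsX (Q : I → I → F) (X : I → I → A) : Matrix (Finset I) (Finset I) A :=
  qMinor (fun i j => Q j i) (fun i j => X j i)

/-- The matrix of the quantum minors of `Y`, with the columns as the first index. -/
def minorsY (Q : I → I → F) (Y : I → I → A) : Matrix (Finset I) (Finset I) A :=
  (qMinor (fun i j => Q j i) (fun i j => op (Y j i))).map unop

lemma map_unop_liftMat_mul (S : Matrix (Finset I) (Finset I) F)
    (M : Matrix (Finset I) (Finset I) Aᵐᵒᵖ) :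
    (liftMat Aᵐᵒᵖ S * M).map unop = liftMat A S * M.map unop := by
  ext J K
  simp [Matrix.mul_apply, liftMat_apply, Algebra.commutes, MulOpposite.algebraMap_apply]

lemma map_unop_mul_liftMat (S : Matrix (Finset I) (Finset I) F)
    (M : Matrix (Finset I) (Finset I) Aᵐᵒᵖ) :
    (M * liftMat Aᵐᵒᵖ S).map unop = M.map unop * liftMat A S := by
  ext J K
  simp [Matrix.mul_apply, liftMat_apply, Algebra.commutes, MulOpposite.algebraMap_apply]

lemma map_unop_sc_mul (a : Aᵐᵒᵖ) (M : Matrix (Finset I) (Finset I) Aᵐᵒᵖ) :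
    (sc a * M).map unop = M.map unop * sc (unop a) := by
  ext J K
  rw [Matrix.map_apply, sc_mul_apply, mul_sc_apply, unop_mul, Matrix.map_apply]

lemma map_unop_mul_sc (a : Aᵐᵒᵖ) (M : Matrix (Finset I) (Finset I) Aᵐᵒᵖ) :
    (M * sc a).map unop = sc (unop a) * M.map unop := by
  ext J K
  rw [Matrix.map_apply, sc_mul_apply, mul_sc_apply, unop_mul, Matrix.map_apply]

lemma map_unop_sum {ι : Type*} (s : Finset ι) (M : ι → Matrix (Finset I) (Finset I) Aᵐᵒᵖ) :
    (∑ i ∈ s, M i).map unop = ∑ i ∈ s, (M i).map unop := by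
  ext J K
  simp [Matrix.sum_apply]

lemma QSystem.lAnnih_mul_minorsY (h : QSystem q Q X Y) (t : I) :
    liftMat A (lAnnih (fun i j => Q j i) t) * minorsY Q Y =
      ∑ c, minorsY Q Y * liftMat A (lAnnih (fun i j => Q j i) c) * sc (Y c t) := by
  have := congrArg (·.map unop) (lAnnih_mul_qMinor h.param.swap h.op_Y_rel t)
  simp only [map_unop_sum, map_unop_liftMat_mul, map_unop_mul_liftMat, map_unop_sc_mul,
    unop_op] at this
  exact this

lemma QSystem.rAnnih_mul_minorsY (h : QSystem q Q X Y) (t : I) :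
    liftMat A (rAnnih (fun i j => Q j i) t) * minorsY Q Y =
      ∑ c, sc (Y c t) * (minorsY Q Y * liftMat A (rAnnih (fun i j => Q j i) c)) := by
  have := congrArg (·.map unop) (rAnnih_mul_qMinor h.param.swap h.op_Y_rel t)
  simp only [map_unop_sum, map_unop_liftMat_mul, map_unop_mul_liftMat, map_unop_mul_sc,
    unop_op] at this
  exact this

lemma QSystem.minorsY_mul_rCreate (h : QSystem q Q X Y) (t : I) :
    minorsY Q Y * liftMat A (rCreate (fun i j => Q j i) t) =
      ∑ c, sc (Y t c) * (liftMat A (rCreate (fun i j => Q j i) c) * minorsY Q Y) := by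
  have := congrArg (·.map unop) (qMinor_mul_rCreate h.param.swap h.op_Y_rel t)
  simp only [map_unop_sum, map_unop_liftMat_mul, map_unop_mul_liftMat, map_unop_mul_sc,
    unop_op] at this
  exact this

lemma QSystem.minorsX_mul_lCreate (h : QSystem q Q X Y) (t : I) :
    minorsX Q X * liftMat A (lCreate (fun i j => Q j i) t) =
      ∑ c, sc (X t c) * (liftMat A (lCreate (fun i j => Q j i) c) * minorsX Q X) :=
  qMinor_mul_lCreate h.param.swap h.X_rel.swap t

lemma QSystem.rAnnih_mul_minorsX (h : QSystem q Q X Y) (t : I) :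
    liftMat A (rAnnih (fun i j => Q j i) t) * minorsX Q X =
      ∑ c, minorsX Q X * liftMat A (rAnnih (fun i j => Q j i) c) * sc (X c t) :=
  rAnnih_mul_qMinor h.param.swap h.X_rel.swap t

lemma minorsX_empty (K : Finset I) : minorsX Q X ∅ K = if K = ∅ then 1 else 0 := qMinor_empty K

lemma minorsY_empty (K : Finset I) : minorsY Q Y ∅ K = if K = ∅ then 1 else 0 := by
  rw [minorsY, Matrix.map_apply, qMinor_empty]
  split_ifs <;> simp

lemma QSystem.minorsX_mul_degMat (h : QSystem q Q X Y) (g : ℕ → F) :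
    minorsX Q X * liftMat A (degMat I g) = liftMat A (degMat I g) * minorsX Q X :=
  qMinor_mul_degMat h.param.swap h.X_rel.swap g

/-- A family of matrices vanishes if its rows `∅` vanish and, whenever the rows `J` of the family
vanish, so do the rows `J` of the products with the `lAnnih p t`. -/
lemma eq_zero_of_lAnnih {ι : Type*} {p : I → I → F} (hp : IsParam q p)
    (D : ι → Matrix (Finset I) (Finset I) A)
    (h0 : ∀ i L, D i ∅ L = 0)
    (h1 : ∀ J, (∀ i L, D i J L = 0) → ∀ i t L, (liftMat A (lAnnih p t) * D i) J L = 0) (i : ι) :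
    D i = 0 := by
  ext J L
  induction J using Finset.induction_on generalizing i L with
  | empty => exact h0 i L
  | insert t J ht ih => exact apply_insert_of_lAnnih hp ht (h1 J ih i t L)

lemma mul_apply_eq_zero {D : Matrix (Finset I) (Finset I) A} {J : Finset I}
    (h : ∀ L, D J L = 0) (M : Matrix (Finset I) (Finset I) A) (L : Finset I) : (D * M) J L = 0 := by
  rw [Matrix.mul_apply]
  exact Finset.sum_eq_zero fun K _ => by rw [h, zero_mul]

lemma sc_smul (c : F) (a : A) : (sc (c • a) : Matrix (Finset I) (Finset I) A) = c • sc a := by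
  rw [sc, Matrix.scalar_apply, Matrix.scalar_apply, ← Matrix.diagonal_smul]
  rfl

/-- The relation between `X` and `Y`, summed with arbitrary coefficients on the left. -/
lemma QSystem.sum_mul_cross_right (h : QSystem q Q X Y)
    (G : I → I → Matrix (Finset I) (Finset I) A) (c d : I) :
    ∑ t, ∑ b, (Q t d • (G t b * sc (Y b d) * sc (X t c)) +
      if d < t then (1 - q ^ 2) • (G d b * sc (Y b t) * sc (X t c)) else 0) =
    ∑ t, ∑ b, (Q c b • (G t b * sc (X t c) * sc (Y b d)) +
      if b < c then (1 - q ^ 2) • (G t c * sc (X t b) * sc (Y b d)) else 0) := by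
  have h1 : ∑ t, ∑ b, (if d < t then (1 - q ^ 2) • (G d b * sc (Y b t) * sc (X t c)) else 0) =
      ∑ t, ∑ b, G t b * sc (if t = d then (1 - q ^ 2) • ∑ s with t < s, Y b s * X s c else 0) := by
    rw [Finset.sum_comm]
    conv_rhs => rw [Finset.sum_comm]
    refine Finset.sum_congr rfl fun b _ => ?_
    conv_rhs => rw [Finset.sum_eq_single (a := d) (by intro t _ ht; simp [ht]) (by simp)]
    rw [if_pos rfl, sc_smul, map_sum, Matrix.mul_smul, Finset.mul_sum, Finset.smul_sum,
      Finset.sum_filter]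
    refine Finset.sum_congr rfl fun t _ => ?_
    rw [map_mul, mul_assoc]
  have h2 : ∑ t, ∑ b, (if b < c then (1 - q ^ 2) • (G t c * sc (X t b) * sc (Y b d)) else 0) =
      ∑ t, ∑ b, G t b * sc (if b = c then (1 - q ^ 2) • ∑ s with s < b, X t s * Y s d else 0) := by
    refine Finset.sum_congr rfl fun b _ => ?_
    conv_rhs => rw [Finset.sum_eq_single (a := c) (by intro t _ ht; simp [ht]) (by simp)]
    rw [if_pos rfl, sc_smul, map_sum, Matrix.mul_smul, Finset.mul_sum, Finset.smul_sum,
      Finset.sum_filter]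
    refine Finset.sum_congr rfl fun t _ => ?_
    rw [map_mul, mul_assoc]
  simp only [Finset.sum_add_distrib]
  rw [h1, h2]
  simp only [← Finset.sum_add_distrib]
  refine Finset.sum_congr rfl fun t _ => Finset.sum_congr rfl fun b _ => ?_
  simp only [mul_assoc, ← map_mul, ← Matrix.mul_smul, ← sc_smul, ← mul_add, ← map_add]
  rw [h.cross]

/-- The right side of the recursion that determines both sides of the exchange relation. -/
def exchangeStep (q : F) (p : I → I → F) (Y : I → I → A)
    (D : I → I → Matrix (Finset I) (Finset I) A) (a c d : I) : Matrix (Finset I) (Finset I) A :=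
  ∑ b, (p b c • (D a c * liftMat A (lAnnih p b) * sc (Y b d)) +
    if b < c then (1 - q ^ 2) • (D a b * liftMat A (lAnnih p c) * sc (Y b d)) else 0)

lemma liftMat_lAnnih_mul_braidMat {p : I → I → F} (hp : IsParam q p) (b s c : I) :
    liftMat A (lAnnih p b) * liftMat A (braidMat p s c) =
      -(p b c • (liftMat A (braidMat p s c) * liftMat A (lAnnih p b)) +
        if b < c then (1 - q ^ 2) • (liftMat A (braidMat p s b) * liftMat A (lAnnih p c))
        else 0) := by
  rw [← map_mul, lAnnih_mul_braidMat hp, map_sub, liftMat_smul, map_mul, apply_ite (liftMat A),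
    liftMat_smul, map_mul, map_zero, neg_add, neg_smul, sub_eq_add_neg]

/-- The left side of the exchange relation satisfies the recursion, by the expansion of the minors of
`Y` along a row and the relation between `X` and `Y`. -/
lemma QSystem.lAnnih_mul_sum_left (h : QSystem q Q X Y) {p : I → I → F} (hpQ : p = fun i j => Q j i)
    (a c d : I) :
    liftMat A (lAnnih p d) *
        ∑ s, sc (X a s) * minorsY Q Y * liftMat A (braidMat p s c) =
      -exchangeStep q p Y
        (fun a c => ∑ s, sc (X a s) * minorsY Q Y * liftMat A (braidMat p s c)) a c d := by
  have hp : IsParam q p := hpQ ▸ h.param.swap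
  have hY : ∀ t, liftMat A (lAnnih p t) * minorsY Q Y =
      ∑ c, minorsY Q Y * liftMat A (lAnnih p c) * sc (Y c t) := hpQ ▸ h.lAnnih_mul_minorsY
  rw [Finset.mul_sum]
  have e1 : ∀ s, liftMat A (lAnnih p d) * (sc (X a s) * minorsY Q Y *
      liftMat A (braidMat p s c)) = -∑ b, (p b c • (sc (X a s) * minorsY Q Y *
        liftMat A (braidMat p s c) * liftMat A (lAnnih p b) * sc (Y b d)) +
        if b < c then (1 - q ^ 2) • (sc (X a s) * minorsY Q Y *
        liftMat A (braidMat p s b) * liftMat A (lAnnih p c) * sc (Y b d)) else 0) := by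
    intro s
    rw [← mul_assoc, ← mul_assoc, liftMat_mul_sc, mul_assoc (sc _), hY,
      Finset.mul_sum, Finset.sum_mul, ← Finset.sum_neg_distrib]
    refine Finset.sum_congr rfl fun b _ => ?_
    rw [mul_assoc, mul_assoc, ← liftMat_mul_sc, ← mul_assoc (minorsY Q Y * _),
      mul_assoc (minorsY Q Y), liftMat_lAnnih_mul_braidMat hp]
    split_ifs
    · simp only [mul_neg, neg_mul, mul_add, add_mul, Matrix.mul_smul, Matrix.smul_mul, mul_assoc]
    · simp only [mul_neg, neg_mul, add_zero, Matrix.mul_smul, Matrix.smul_mul, mul_assoc]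
  rw [Finset.sum_congr rfl fun s _ => e1 s, Finset.sum_neg_distrib, Finset.sum_comm, exchangeStep]
  congr 1
  refine Finset.sum_congr rfl fun b _ => ?_
  rw [Finset.sum_add_distrib, ← Finset.smul_sum, ← Finset.sum_mul, ← Finset.sum_mul]
  congr 1
  split_ifs
  · rw [← Finset.smul_sum, ← Finset.sum_mul, ← Finset.sum_mul]
  · simp

lemma exchangeStep_sum (q : F) (p : I → I → F) (X Y : I → I → A)
    (G : I → I → Matrix (Finset I) (Finset I) A) (a c d : I) :
    exchangeStep q p Y (fun a c => ∑ t, G a t * sc (X t c)) a c d =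
    ∑ t, ∑ b, (p b c • (G a t * liftMat A (lAnnih p b) * sc (X t c) * sc (Y b d)) +
        if b < c then (1 - q ^ 2) • (G a t * liftMat A (lAnnih p c) * sc (X t b) * sc (Y b d))
          else 0) := by
  have h1 : ∀ b c e, (∑ t, G a t * sc (X t c)) * liftMat A (lAnnih p b) * sc e =
      ∑ t, G a t * liftMat A (lAnnih p b) * sc (X t c) * sc e := by
    intro b c e
    rw [Finset.sum_mul, Finset.sum_mul]
    refine Finset.sum_congr rfl fun t _ => ?_
    rw [mul_assoc (G a t), ← liftMat_mul_sc, ← mul_assoc (G a t)]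
  rw [Finset.sum_comm, exchangeStep]
  refine Finset.sum_congr rfl fun b _ => ?_
  rw [Finset.sum_add_distrib, h1, Finset.smul_sum]
  congr 1
  split_ifs
  · rw [h1, Finset.smul_sum]
  · exact Finset.sum_const_zero.symm

/-- The right side of the exchange relation satisfies the same recursion. -/
lemma QSystem.lAnnih_mul_sum_right (h : QSystem q Q X Y) {p : I → I → F}
    (hpQ : p = fun i j => Q j i) (a c d : I) :
    liftMat A (lAnnih p d) *
        ∑ t, liftMat A (braidMat p a t) * minorsY Q Y * sc (X t c) =
      -exchangeStep q p Y
        (fun a c => ∑ t, liftMat A (braidMat p a t) * minorsY Q Y * sc (X t c)) a c d := by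
  have hp : IsParam q p := hpQ ▸ h.param.swap
  have hY : ∀ t, liftMat A (lAnnih p t) * minorsY Q Y =
      ∑ c, minorsY Q Y * liftMat A (lAnnih p c) * sc (Y c t) := hpQ ▸ h.lAnnih_mul_minorsY
  have hpq : ∀ b c, p b c = Q c b := fun b c => by rw [hpQ]
  rw [exchangeStep_sum q p X Y (fun a t => liftMat A (braidMat p a t) * minorsY Q Y)]
  have e2 := h.sum_mul_cross_right (fun t b => liftMat A (braidMat p a t) * minorsY Q Y *
    liftMat A (lAnnih p b)) c d
  simp only [← hpq] at e2
  rw [← e2, Finset.mul_sum, ← Finset.sum_neg_distrib]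
  refine Finset.sum_congr rfl fun t _ => ?_
  rw [← mul_assoc, ← mul_assoc, liftMat_lAnnih_mul_braidMat hp, neg_mul, neg_mul, add_mul, add_mul,
    Finset.sum_add_distrib]
  congr 2
  · rw [Matrix.smul_mul, Matrix.smul_mul, mul_assoc _ _ (minorsY Q Y), hY, Finset.mul_sum,
      Finset.sum_mul, Finset.smul_sum]
    refine Finset.sum_congr rfl fun b _ => ?_
    rw [← mul_assoc, ← mul_assoc]
  · split_ifs
    · rw [Matrix.smul_mul, Matrix.smul_mul, mul_assoc _ _ (minorsY Q Y), hY, Finset.mul_sum,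
        Finset.sum_mul, Finset.smul_sum]
      refine Finset.sum_congr rfl fun b _ => ?_
      rw [← mul_assoc, ← mul_assoc]
    · simp

lemma exchangeStep_sub (p : I → I → F) (Y : I → I → A)
    (D E : I → I → Matrix (Finset I) (Finset I) A) (a c d : I) :
    exchangeStep q p Y D a c d - exchangeStep q p Y E a c d =
      exchangeStep q p Y (fun a c => D a c - E a c) a c d := by
  simp only [exchangeStep]
  rw [← Finset.sum_sub_distrib]
  refine Finset.sum_congr rfl fun b _ => ?_
  split_ifs
  · simp only [sub_mul, smul_sub]; abel
  · simp only [sub_mul, smul_sub]; abel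

lemma exchangeStep_apply_eq_zero (p : I → I → F) (Y : I → I → A)
    {D : I → I → Matrix (Finset I) (Finset I) A} {J : Finset I} (hD : ∀ a c K, D a c J K = 0)
    (a c d : I) (K : Finset I) : exchangeStep q p Y D a c d J K = 0 := by
  rw [exchangeStep, Matrix.sum_apply]
  refine Finset.sum_eq_zero fun b _ => ?_
  rw [Matrix.add_apply, Matrix.smul_apply, mul_assoc, mul_apply_eq_zero (hD a c), smul_zero,
    zero_add]
  split_ifs
  · rw [Matrix.smul_apply, mul_assoc, mul_apply_eq_zero (hD a b), smul_zero]
  · rfl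

/-- The exchange relation between an entry of `X` and all the quantum minors of `Y`. -/
lemma QSystem.exchange (h : QSystem q Q X Y) {p : I → I → F} (hpQ : p = fun i j => Q j i)
    (a c : I) :
    ∑ s, sc (X a s) * minorsY Q Y * liftMat A (braidMat p s c) =
      ∑ t, liftMat A (braidMat p a t) * minorsY Q Y * sc (X t c) := by
  have hp : IsParam q p := hpQ ▸ h.param.swap
  have hD := eq_zero_of_lAnnih (A := A) hp (fun i : I × I =>
    (∑ s, sc (X i.1 s) * minorsY Q Y * liftMat A (braidMat p s i.2)) -
      ∑ t, liftMat A (braidMat p i.1 t) * minorsY Q Y * sc (X t i.2)) ?_ ?_ (a, c)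
  -- The row `∅` of both sides is `X a c`, and both sides satisfy the same recursion on the rows.
  · exact sub_eq_zero.1 hD
  · rintro ⟨a, c⟩ K
    simp only [Matrix.sub_apply, Matrix.sum_apply]
    have e1 : ∀ s, (sc (X a s) * minorsY Q Y * liftMat A (braidMat p s c) :
          Matrix (Finset I) (Finset I) A) ∅ K =
        if s = c then (if K = ∅ then X a s else 0) else 0 := by
      intro s
      rw [mul_assoc, sc_mul_apply, Matrix.mul_apply, Finset.sum_eq_single ∅
        (by intro M _ hM; rw [minorsY_empty, if_neg hM, zero_mul]) (by simp), minorsY_empty,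
        if_pos rfl, one_mul, liftMat_apply, braidMat_empty hp]
      by_cases h1 : s = c <;> by_cases h2 : K = ∅ <;> simp [h1, h2]
    have e2 : ∀ t, (liftMat A (braidMat p a t) * minorsY Q Y * sc (X t c) :
          Matrix (Finset I) (Finset I) A) ∅ K =
        if a = t then (if K = ∅ then X t c else 0) else 0 := by
      intro t
      rw [mul_sc_apply, Matrix.mul_apply, Finset.sum_eq_single ∅
        (by intro M _ hM; rw [liftMat_apply, braidMat_empty hp, if_neg (fun h => hM h.2), map_zero,
              zero_mul]) (by simp), minorsY_empty, liftMat_apply, braidMat_empty hp]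
      by_cases h1 : a = t <;> by_cases h2 : K = ∅ <;> simp [h1, h2]
    simp only [e1, e2, Finset.sum_ite_eq, Finset.sum_ite_eq', Finset.mem_univ, if_true, sub_self]
  · rintro J hJ ⟨a, c⟩ t K
    rw [mul_sub, h.lAnnih_mul_sum_left hpQ, h.lAnnih_mul_sum_right hpQ, neg_sub_neg, ← neg_sub,
      exchangeStep_sub, Matrix.neg_apply, neg_eq_zero]
    exact exchangeStep_apply_eq_zero _ _ (fun a c K => hJ (a, c) K) _ _ _ _

end System

/-! ### The adjugate recursion -/

section Recursion

variable {I F A : Type*} [LinearOrder I] [Fintype I] [Field F] [Ring A] [Algebra F A]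

lemma trace_liftMat_mul (S : Matrix (Finset I) (Finset I) F) (M : Matrix (Finset I) (Finset I) A) :
    Matrix.trace (liftMat A S * M) = Matrix.trace (M * liftMat A S) := by
  simp only [Matrix.trace, Matrix.diag_apply, Matrix.mul_apply, liftMat_apply]
  rw [Finset.sum_comm]
  exact Finset.sum_congr rfl fun J _ => Finset.sum_congr rfl fun K _ => Algebra.commutes _ _

lemma trace_sc_mul (a : A) (M : Matrix (Finset I) (Finset I) A) :
    Matrix.trace ((sc a : Matrix (Finset I) (Finset I) A) * M) = a * Matrix.trace M := by
  simp only [Matrix.trace, Matrix.diag_apply, sc_mul_apply, Finset.mul_sum]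

/-- The projection to the degree `k`, with the weight `∏_{c ∈ K} w c`. -/
def gradeMat (w : I → F) (k : ℕ) : Matrix (Finset I) (Finset I) F :=
  weightMat w * degMat I fun n => if n = k then 1 else 0

/-- The weighted sum of the products of the quantum minors of size `k` of `Y` and of `X`. -/
def tau (q : F) (Q : I → I → F) (X Y : I → I → A) (k : ℕ) : A :=
  Matrix.trace (minorsY Q Y * liftMat A (gradeMat (wGt I q) k) * minorsX Q X)

/-- The partial contraction of the products of quantum minors of `Y` and `X`, which leaves the
indices `i` and `j` open. -/
def adjCoeff (q : F) (Q : I → I → F) (X Y : I → I → A) (k : ℕ) : Matrix I I A :=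
  Matrix.of fun i j => Matrix.trace (minorsY Q Y * liftMat A (gradeMat (wGt I q) k) * minorsX Q X *
    liftMat A (rAnnih (fun i j => Q j i) j * rCreate (fun i j => Q j i) i))

/-- The matrix `X Y`. -/
def prodMat (X Y : I → I → A) : Matrix I I A := Matrix.of X * Matrix.of Y

variable {q : F} {Q : I → I → F} {X Y : I → I → A}

lemma gradeMat_eq (w : I → F) (k : ℕ) :
    gradeMat w k = (degMat I fun n => if n = k then 1 else 0) * weightMat w :=
  weightMat_mul_degMat _ _

/-- The weighted degree projections intertwine the right multiplication with the braiding. -/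
lemma rCreate_mul_gradeMat {p : I → I → F} (hp : IsParam q p) (s : I) (k : ℕ) :
    rCreate p s * gradeMat (wGt I q) k = -(q ^ (2 * k))⁻¹ •
      ∑ c, braidMat p s c * gradeMat (wGt I q) (k + 1) * lCreate p c := by
  have h1 : ∀ c, gradeMat (wGt I q) (k + 1) * lCreate p c =
      wGt I q c • (lCreate p c * ((degMat I fun n => if n = k then 1 else 0) *
        weightMat (wGt I q))) := by
    intro c
    rw [gradeMat_eq, mul_assoc, lCreate, weightMat_mul_create, Matrix.mul_smul, ← mul_assoc,
      degMat_mul_create]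
    simp only [Nat.add_right_cancel_iff, mul_assoc]
  have h2 : ∑ c, braidMat p s c * gradeMat (wGt I q) (k + 1) * lCreate p c =
      (∑ c, wGt I q c • (braidMat p s c * lCreate p c)) * gradeMat (wGt I q) k := by
    rw [Finset.sum_mul]
    refine Finset.sum_congr rfl fun c _ => ?_
    rw [mul_assoc, h1, ← gradeMat_eq, Matrix.mul_smul, Matrix.smul_mul, mul_assoc]
  have hq := pow_ne_zero (2 * k) hp.ne_zero
  have h3 : (degMat I fun n => q ^ (2 * n)) * gradeMat (wGt I q) k = q ^ (2 * k) • gradeMat (wGt I q) k := by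
    rw [gradeMat_eq, ← mul_assoc, degMat_mul_degMat, ← Matrix.smul_mul, degMat, degMat,
      ← Matrix.diagonal_smul]
    congr 2; ext J
    by_cases hJ : J.card = k <;> simp [hJ]
  rw [h2, sum_braidMat_mul_lCreate hp, neg_mul, smul_neg, neg_smul, neg_neg, mul_assoc, h3,
    Matrix.mul_smul, smul_smul, inv_mul_cancel₀ hq, one_smul]

lemma QSystem.gradeMat_mul_minorsX (h : QSystem q Q X Y) (k : ℕ) :
    liftMat A (gradeMat (wGt I q) k) * minorsX Q X =
      liftMat A (weightMat (wGt I q)) * minorsX Q X *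
        liftMat A (degMat I fun n => if n = k then (1 : F) else 0) := by
  rw [gradeMat, map_mul, mul_assoc, mul_assoc, h.minorsX_mul_degMat]

/-- The matrices `adjCoeff k` satisfy the recursion of the coefficients of an adjugate. -/
lemma QSystem.mul_adjCoeff_add (h : QSystem q Q X Y) (k : ℕ) :
    prodMat X Y * adjCoeff q Q X Y k + adjCoeff q Q X Y (k + 1) =
      Matrix.scalar I (tau q Q X Y (k + 1)) := by
  have hp := h.param.swap
  obtain ⟨p, hpQ⟩ : ∃ p : I → I → F, p = fun i j => Q j i := ⟨_, rfl⟩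
  have hp : IsParam q p := hpQ ▸ h.param.swap
  have hr : ∀ s, ∑ l, sc (Y s l) * (liftMat A (rCreate p l) * minorsY Q Y) =
      minorsY Q Y * liftMat A (rCreate p s) := fun s => hpQ ▸ (h.minorsY_mul_rCreate s).symm
  have hl : ∀ t, ∑ c, sc (X t c) * (liftMat A (lCreate p c) * minorsX Q X) =
      minorsX Q X * liftMat A (lCreate p t) := fun t => hpQ ▸ (h.minorsX_mul_lCreate t).symm
  have he := h.exchange hpQ
  have hq := h.param.ne_zero
  ext i j
  have hadj : ∀ k i, adjCoeff q Q X Y k i j = Matrix.trace (minorsY Q Y *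
      liftMat A (gradeMat (wGt I q) k) * minorsX Q X * liftMat A (rAnnih p j * rCreate p i)) := by
    intro k i; rw [hpQ]; rfl
  set My := minorsY Q Y
  set Mx := minorsX Q X
  set G : ℕ → Matrix (Finset I) (Finset I) A := fun k => liftMat A (gradeMat (wGt I q) k) with hG
  have e1 : (prodMat X Y * adjCoeff q Q X Y k) i j =
      Matrix.trace ((∑ s, sc (X i s) * (My * liftMat A (rCreate p s))) *
        (G k * Mx * liftMat A (rAnnih p j))) := by
    rw [Matrix.mul_apply, Finset.sum_mul, Matrix.trace_sum]
    simp only [prodMat, Matrix.mul_apply, Matrix.of_apply, Finset.sum_mul]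
    rw [Finset.sum_comm]
    refine Finset.sum_congr rfl fun s _ => ?_
    rw [mul_assoc, trace_sc_mul, ← hr, Finset.sum_mul, Matrix.trace_sum, Finset.mul_sum]
    refine Finset.sum_congr rfl fun l _ => ?_
    rw [mul_assoc (sc _), trace_sc_mul, hadj, map_mul, ← mul_assoc, ← trace_liftMat_mul, mul_assoc]
    simp only [hG, mul_assoc]
  -- Pass the right multiplication through the weight, then exchange `X` with the minors of `Y`, and
  -- absorb the entry of `X` into the minors of `X` by a column expansion.
  have e2 : (∑ s, sc (X i s) * (My * liftMat A (rCreate p s))) * (G k * Mx) =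
      -(q ^ (2 * k))⁻¹ • ∑ t, liftMat A (braidMat p i t) * My * G (k + 1) * Mx *
        liftMat A (lCreate p t) := by
    have e3 : ∀ s, sc (X i s) * (My * liftMat A (rCreate p s)) * (G k * Mx) =
        -(q ^ (2 * k))⁻¹ • ∑ c, sc (X i s) * My * liftMat A (braidMat p s c) *
          (G (k + 1) * liftMat A (lCreate p c) * Mx) := by
      intro s
      have : liftMat A (rCreate p s) * G k = -(q ^ (2 * k))⁻¹ •
          ∑ c, liftMat A (braidMat p s c) * G (k + 1) * liftMat A (lCreate p c) := by
        rw [← map_mul, rCreate_mul_gradeMat hp, liftMat_smul, map_sum]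
        simp only [map_mul, hG]
      rw [mul_assoc (sc _), mul_assoc My, ← mul_assoc (liftMat A _), this, Matrix.smul_mul,
        Matrix.mul_smul, Matrix.mul_smul, Finset.sum_mul, Finset.mul_sum, Finset.mul_sum]
      simp only [mul_assoc]
    rw [Finset.sum_mul, Finset.sum_congr rfl fun s _ => e3 s, ← Finset.smul_sum, Finset.sum_comm]
    congr 1
    have e4 : ∀ c, ∑ s, sc (X i s) * My * liftMat A (braidMat p s c) *
          (G (k + 1) * liftMat A (lCreate p c) * Mx) = ∑ t, liftMat A (braidMat p i t) * My *
            G (k + 1) * (sc (X t c) * (liftMat A (lCreate p c) * Mx)) := by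
      intro c
      rw [← Finset.sum_mul, he, Finset.sum_mul]
      refine Finset.sum_congr rfl fun t _ => ?_
      rw [mul_assoc (_ * My), ← mul_assoc (sc _), ← mul_assoc (sc _), hG, ← liftMat_mul_sc]
      simp only [mul_assoc]
    rw [Finset.sum_congr rfl fun c _ => e4 c, Finset.sum_comm]
    refine Finset.sum_congr rfl fun t _ => ?_
    rw [← Finset.mul_sum, hl, mul_assoc _ Mx]
  have e5 : ∀ S, Matrix.trace (My * G (k + 1) * Mx * liftMat A S) =
      Matrix.trace (My * liftMat A (weightMat (wGt I q)) * Mx *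
        liftMat A ((degMat I fun n => if n = k + 1 then (1 : F) else 0) * S)) := by
    intro S
    rw [mul_assoc My, hG, h.gradeMat_mul_minorsX, map_mul]
    simp only [My, Mx, mul_assoc]
  -- The scalar operators that remain after the trace has been rotated.
  have e6 : ∑ t, (degMat I fun n => if n = k + 1 then 1 else 0) *
      (lCreate p t * rAnnih p j * braidMat p i t) = -(q ^ (2 * k)) •
        ((degMat I fun n => if n = k + 1 then 1 else 0) *
          ((if i = j then 1 else 0) - rAnnih p j * rCreate p i)) := by
    have h1 := sum_lCreate_mul_braidMat hp i j
    have h2 : (degMat I fun n => if n = k + 1 then (1 : F) else 0) *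
        (degMat I fun n => q ^ (2 * n)) =
        q ^ (2 * (k + 1)) • degMat I fun n => if n = k + 1 then 1 else 0 := by
      rw [degMat_mul_degMat, degMat, degMat, ← Matrix.diagonal_smul]
      congr 1; ext J
      by_cases hJ : J.card = k + 1 <;> simp [hJ]
    have h3 := congrArg (fun M => (degMat I fun n => if n = k + 1 then (1 : F) else 0) * M) h1
    simp only [Matrix.mul_smul, mul_neg, ← mul_assoc, h2] at h3
    rw [← Finset.mul_sum]
    apply smul_right_injective _ (pow_ne_zero 2 hq)
    simp only [← mul_assoc] at h3 ⊢
    simp only [h3, Matrix.smul_mul, smul_smul, neg_smul, smul_neg]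
    rw [show 2 * (k + 1) = 2 + 2 * k by ring, pow_add]
  have e7 : (prodMat X Y * adjCoeff q Q X Y k) i j =
      Matrix.trace (My * G (k + 1) * Mx *
        liftMat A ((if i = j then 1 else 0) - rAnnih p j * rCreate p i)) := by
    rw [e1, ← mul_assoc, e2, Matrix.smul_mul, Matrix.trace_smul, Finset.sum_mul, Matrix.trace_sum]
    have e8 : ∀ t, Matrix.trace (liftMat A (braidMat p i t) * My * G (k + 1) * Mx *
        liftMat A (lCreate p t) * liftMat A (rAnnih p j)) =
        Matrix.trace (My * liftMat A (weightMat (wGt I q)) * Mx *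
          liftMat A ((degMat I fun n => if n = k + 1 then (1 : F) else 0) *
            (lCreate p t * rAnnih p j * braidMat p i t))) := by
      intro t
      rw [← e5, map_mul, map_mul]
      simp only [mul_assoc]
      rw [trace_liftMat_mul]
      simp only [mul_assoc]
    rw [Finset.sum_congr rfl fun t _ => e8 t, ← Matrix.trace_sum, ← Finset.mul_sum, ← map_sum, e6,
      liftMat_smul, Matrix.mul_smul, Matrix.trace_smul, smul_smul, neg_mul_neg,
      inv_mul_cancel₀ (pow_ne_zero _ hq), one_smul, e5]
  rw [Matrix.add_apply, e7, hadj, map_sub, mul_sub, Matrix.trace_sub, sub_add_cancel,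
    Matrix.scalar_apply, Matrix.diagonal_apply]
  split_ifs
  · rw [map_one, mul_one]; rfl
  · rw [map_zero, mul_zero, Matrix.trace_zero]

lemma minorsY_eq_zero (h : QSystem q Q X Y) {J K : Finset I} (hJK : J.card ≠ K.card) :
    minorsY Q Y J K = 0 := by
  rw [minorsY, Matrix.map_apply, qMinor_eq_zero h.param.swap h.op_Y_rel hJK, MulOpposite.unop_zero]

lemma minorsX_eq_zero (h : QSystem q Q X Y) {J K : Finset I} (hJK : J.card ≠ K.card) :
    minorsX Q X J K = 0 := qMinor_eq_zero h.param.swap h.X_rel.swap hJK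

lemma mul_gradeMat_mul_apply (w : I → F) (M M' : Matrix (Finset I) (Finset I) A) (k : ℕ)
    (J L : Finset I) : (M * liftMat A (gradeMat w k) * M') J L =
      ∑ K with K.card = k, (∏ c ∈ K, w c) • (M J K * M' K L) := by
  have h1 : ∀ K, (M * liftMat A (gradeMat w k)) J K =
      (if K.card = k then ∏ c ∈ K, w c else 0) • M J K := by
    intro K
    rw [Matrix.mul_apply, Finset.sum_eq_single K]
    · rw [liftMat_apply, gradeMat, weightMat, degMat, Matrix.diagonal_mul_diagonal,
        Matrix.diagonal_apply_eq, ← Algebra.commutes, ← Algebra.smul_def]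
      split_ifs <;> simp
    · intro L _ hL
      rw [liftMat_apply, gradeMat, weightMat, degMat, Matrix.diagonal_mul_diagonal,
        Matrix.diagonal_apply_ne _ hL, map_zero, mul_zero]
    · simp
  rw [Matrix.mul_apply, Finset.sum_filter]
  refine Finset.sum_congr rfl fun K _ => ?_
  rw [h1]
  split_ifs <;> simp

lemma tau_eq_sum (k : ℕ) : tau q Q X Y k = ∑ L, ∑ K with K.card = k,
    (∏ c ∈ K, wGt I q c) • (minorsY Q Y L K * minorsX Q X K L) := by
  simp only [tau, Matrix.trace, Matrix.diag_apply, mul_gradeMat_mul_apply]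

lemma gradeMat_zero_mul_apply (h : QSystem q Q X Y) (J L : Finset I) :
    (minorsY Q Y * liftMat A (gradeMat (wGt I q) 0) * minorsX Q X) J L =
      if J = ∅ ∧ L = ∅ then 1 else 0 := by
  have : Finset.univ.filter (fun K : Finset I => K.card = 0) = {∅} := by
    ext; simp
  rw [mul_gradeMat_mul_apply, this, Finset.sum_singleton, minorsX_empty]
  by_cases hJ : J = ∅
  · subst hJ
    rw [minorsY_empty]; simp
  · rw [minorsY_eq_zero h (by simpa using hJ)]; simp [hJ]

lemma QSystem.tau_zero (h : QSystem q Q X Y) : tau q Q X Y 0 = 1 := by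
  simp only [tau, Matrix.trace, Matrix.diag_apply, gradeMat_zero_mul_apply h, and_self,
    Finset.sum_ite_eq', Finset.mem_univ, if_true]

lemma tau_of_card_lt {k : ℕ} (hk : Fintype.card I < k) : tau q Q X Y k = 0 := by
  rw [tau_eq_sum]
  refine Finset.sum_eq_zero fun L _ => Finset.sum_eq_zero fun K hK => ?_
  have := (Finset.mem_filter.1 hK).2
  have := Finset.card_le_univ K
  omega

lemma QSystem.adjCoeff_zero (h : QSystem q Q X Y) : adjCoeff q Q X Y 0 = 1 := by
  ext i j
  rw [adjCoeff, Matrix.of_apply, Matrix.trace, Finset.sum_eq_single ∅]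
  · rw [Matrix.diag_apply, Matrix.mul_apply, Finset.sum_eq_single ∅]
    · rw [gradeMat_zero_mul_apply h, if_pos ⟨rfl, rfl⟩, one_mul, liftMat_apply, rAnnih,
        annih_mul_apply, rCreate, create, Matrix.of_apply, Matrix.one_apply]
      by_cases hij : i = j
      · subst hij; simp
      · simp [hij, Ne.symm hij]
    · intro K _ hK; rw [gradeMat_zero_mul_apply h, if_neg (fun h => hK h.2), zero_mul]
    · simp
  · intro J _ hJ
    rw [Matrix.diag_apply, Matrix.mul_apply]
    exact Finset.sum_eq_zero fun K _ => by
      rw [gradeMat_zero_mul_apply h, if_neg (fun h => hJ h.1), zero_mul]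
  · simp

/-- There are no minors of size larger than `N`, so that the recursion stops. -/
lemma QSystem.adjCoeff_card (h : QSystem q Q X Y) :
    adjCoeff q Q X Y (Fintype.card I) = 0 := by
  ext i j
  have : (degMat I fun n => if n = Fintype.card I then (1 : F) else 0) *
      rAnnih (fun i j => Q j i) j = 0 := by
    ext J K
    rw [degMat, Matrix.diagonal_mul, rAnnih, annih, Matrix.of_apply, Matrix.zero_apply]
    by_cases hJ : j ∉ J
    · have := Finset.card_lt_univ_of_notMem hJ
      rw [if_neg this.ne, zero_mul]
    · simp [hJ]
  rw [adjCoeff, Matrix.of_apply, mul_assoc (minorsY Q Y), h.gradeMat_mul_minorsX,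
    mul_assoc (minorsY Q Y), mul_assoc (_ * _), ← map_mul, ← mul_assoc (degMat I _), this]
  simp

/-- The weighted trace of the adjugate coefficients. -/
lemma QSystem.sum_wLt_adjCoeff (h : QSystem q Q X Y) (k : ℕ) :
    ∑ i, wLt I q i • adjCoeff q Q X Y k i i =
      (q ^ (2 * k) * qInt q (Fintype.card I - k)) • tau q Q X Y k := by
  have hp := h.param.swap
  simp only [adjCoeff, Matrix.of_apply, ← Matrix.trace_smul,
    ← Matrix.mul_smul (minorsY Q Y * _ * _), ← liftMat_smul]
  rw [← Matrix.trace_sum, ← Finset.mul_sum, ← map_sum, sum_rAnnih_mul_rCreate hp,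
    mul_assoc (minorsY Q Y), h.gradeMat_mul_minorsX, mul_assoc (minorsY Q Y), mul_assoc (_ * _),
    ← map_mul, degMat_mul_degMat]
  have : (degMat I fun n => (if n = k then (1 : F) else 0) *
      (q ^ (2 * n) * qInt q (Fintype.card I - n))) = (q ^ (2 * k) * qInt q (Fintype.card I - k)) •
      degMat I fun n => if n = k then (1 : F) else 0 := by
    rw [degMat, degMat, ← Matrix.diagonal_smul]
    congr 1; ext J
    by_cases hJ : J.card = k <;> simp [hJ]
  rw [this, liftMat_smul, Matrix.mul_smul, Matrix.mul_smul, Matrix.trace_smul,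
    ← h.gradeMat_mul_minorsX, ← mul_assoc]
  rfl

lemma qInt_add (q : F) (m n : ℕ) : qInt q (m + n) = qInt q m + q ^ (2 * m) * qInt q n := by
  induction n with
  | zero => simp
  | succ n ih => rw [← add_assoc, qInt_succ, ih, qInt_succ]; ring

lemma sum_wLt (q : F) : ∑ i, wLt I q i = qInt q (Fintype.card I) := sum_pow_card_lt q Finset.univ

/-- The first form of Newton's identities. -/
lemma QSystem.qInt_smul_tau (h : QSystem q Q X Y) {k : ℕ} (hk : k < Fintype.card I) :
    qInt q (k + 1) • tau q Q X Y (k + 1) =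
      ∑ i, wLt I q i • (prodMat X Y * adjCoeff q Q X Y k) i i := by
  have h1 : prodMat X Y * adjCoeff q Q X Y k =
      Matrix.scalar I (tau q Q X Y (k + 1)) - adjCoeff q Q X Y (k + 1) :=
    eq_sub_of_add_eq (h.mul_adjCoeff_add k)
  obtain ⟨m, hm⟩ : ∃ m, Fintype.card I = k + 1 + m := ⟨_, (Nat.add_sub_cancel' hk).symm⟩
  simp only [h1, Matrix.sub_apply, Matrix.scalar_apply, Matrix.diagonal_apply_eq, smul_sub,
    Finset.sum_sub_distrib]
  rw [h.sum_wLt_adjCoeff, ← Finset.sum_smul, sum_wLt, hm, qInt_add q (k + 1) m,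
    Nat.add_sub_cancel_left, add_smul, add_sub_cancel_right]

/-- The solution of the adjugate recursion. -/
lemma QSystem.adjCoeff_eq_sum (h : QSystem q Q X Y) (k : ℕ) :
    adjCoeff q Q X Y k = ∑ r ∈ Finset.range (k + 1),
      (-1) ^ r * (prodMat X Y ^ r * Matrix.scalar I (tau q Q X Y (k - r))) := by
  induction k with
  | zero => simp [h.adjCoeff_zero, h.tau_zero]
  | succ k ih =>
    rw [eq_sub_of_add_eq' (h.mul_adjCoeff_add k), ih, Finset.sum_range_succ' _ (k + 1),
      Finset.mul_sum, sub_eq_neg_add, ← Finset.sum_neg_distrib]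
    congr 1
    · refine Finset.sum_congr rfl fun r _ => ?_
      have : Commute ((-1 : Matrix I I A) ^ r) (prodMat X Y) :=
        (Commute.neg_one_left _).pow_left r
      rw [Nat.add_sub_add_right, pow_succ' (prodMat X Y), pow_succ' (-1 : Matrix I I A) r,
        neg_one_mul, neg_mul, ← mul_assoc (prodMat X Y), ← this.eq]
      simp only [mul_assoc]
    · simp

/-- The weighted power sums of `X Y`. -/
def powerSum (q : F) (X Y : I → I → A) (r : ℕ) : A :=
  ∑ i, wLt I q i • (prodMat X Y ^ r) i i

/-- Newton's identities. -/
lemma QSystem.newton (h : QSystem q Q X Y) {k : ℕ} (hk : k < Fintype.card I) :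
    qInt q (k + 1) • tau q Q X Y (k + 1) = ∑ r ∈ Finset.range (k + 1),
      (-1) ^ r * (powerSum q X Y (r + 1) * tau q Q X Y (k - r)) := by
  rw [h.qInt_smul_tau hk, h.adjCoeff_eq_sum, Finset.mul_sum]
  simp only [Matrix.sum_apply, Finset.smul_sum]
  rw [Finset.sum_comm]
  refine Finset.sum_congr rfl fun r _ => ?_
  rw [powerSum, Finset.sum_mul, Finset.mul_sum]
  refine Finset.sum_congr rfl fun i _ => ?_
  have h1 : prodMat X Y * ((-1) ^ r * (prodMat X Y ^ r * Matrix.scalar I (tau q Q X Y (k - r)))) =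
      (-1) ^ r * (prodMat X Y ^ (r + 1) * Matrix.scalar I (tau q Q X Y (k - r))) := by
    have : Commute ((-1 : Matrix I I A) ^ r) (prodMat X Y) := (Commute.neg_one_left _).pow_left r
    rw [← mul_assoc, ← this.eq, pow_succ']
    simp only [mul_assoc]
  have h2 : ∀ M : Matrix I I A, ((-1) ^ r * M) i i = (-1) ^ r * M i i := by
    intro M
    rcases Nat.even_or_odd r with hr | hr <;> simp [hr.neg_one_pow]
  rw [h1, h2, Matrix.scalar_apply, Matrix.mul_diagonal, smul_mul_assoc, mul_smul_comm]

end Recursion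

/-! ### Identities between the weights -/

section Weights

variable {I F : Type*} [LinearOrder I] [Fintype I] [Field F]

/-- The weights form a geometric progression in the order of the indices, so that the sum telescopes. -/
lemma wLt_add_sum (q : F) {a t : I} (hat : a < t) :
    wLt I q t + (1 - q ^ 2) * ∑ b with a < b ∧ b < t, wLt I q b = q ^ 2 * wLt I q a := by
  have h1 : ∀ b, a < b → wLt I q b = q ^ 2 * wLt I q a *
      q ^ (2 * (Finset.univ.filter fun s => a < s ∧ s < b).card) := by
    intro b hab
    rw [wLt, wLt, ← pow_add, ← pow_add]
    congr 1
    have : Finset.univ.filter (· < b) = insert a (Finset.univ.filter (· < a)) ∪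
        Finset.univ.filter fun s => a < s ∧ s < b := by
      ext s
      simp only [Finset.mem_filter, Finset.mem_univ, true_and, Finset.mem_union, Finset.mem_insert]
      rcases lt_trichotomy s a with h | rfl | h
      · simp [h, h.trans hab]
      · simp [hab]
      · simp [h, h.not_gt, h.ne']
    rw [this, Finset.card_union_of_disjoint, Finset.card_insert_of_notMem (by simp)]
    · ring
    · rw [Finset.disjoint_left]
      intro s hs hs'
      have h2 := (Finset.mem_filter.1 hs').2.1
      rcases Finset.mem_insert.1 hs with rfl | h
      · exact lt_irrefl _ h2
      · exact h2.not_gt (Finset.mem_filter.1 h).2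
  have h2 := sum_pow_card_lt q (Finset.univ.filter fun s => a < s ∧ s < t)
  have h3 : ∑ b with a < b ∧ b < t, wLt I q b =
      q ^ 2 * wLt I q a * qInt q (Finset.univ.filter fun s => a < s ∧ s < t).card := by
    rw [← h2, Finset.mul_sum]
    refine Finset.sum_congr rfl fun b hb => ?_
    have hb := (Finset.mem_filter.1 hb).2
    rw [h1 b hb.1, Finset.filter_filter]
    congr 4
    ext s
    simp only [Finset.mem_filter, Finset.mem_univ, true_and]
    exact ⟨fun h => ⟨⟨h.1, h.2.trans hb.2⟩, h.2⟩, fun h => ⟨h.1.1, h.2⟩⟩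
  rw [h3, h1 t hat, mul_left_comm, one_sub_sq_mul_qInt]
  ring

lemma wLt_add_sum_lt (q : F) (t : I) :
    wLt I q t + (1 - q ^ 2) * ∑ b with b < t, wLt I q b = 1 := by
  have h2 := sum_pow_card_lt q (Finset.univ.filter (· < t))
  have h3 : ∑ b with b < t, wLt I q b = qInt q (Finset.univ.filter (· < t)).card := by
    rw [← h2]
    refine Finset.sum_congr rfl fun b hb => ?_
    have hb := (Finset.mem_filter.1 hb).2
    rw [wLt, Finset.filter_filter]
    congr 3
    ext s
    simp only [Finset.mem_filter, Finset.mem_univ, true_and]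
    exact ⟨fun h => ⟨h.trans hb, h⟩, fun h => h.2⟩
  rw [h3, one_sub_sq_mul_qInt, wLt]
  ring

lemma wGt_add_sum_gt (q : F) (t : I) :
    wGt I q t + (1 - q ^ 2) * ∑ b with t < b, wGt I q b = 1 :=
  wLt_add_sum_lt (I := Iᵒᵈ) q t

end Weights

/-! ### Power sums -/

section PowerSums

open MulOpposite

variable {I F A : Type*} [LinearOrder I] [Fintype I] [Field F] [Ring A] [Algebra F A]
variable {q : F} {Q : I → I → F} {X Y : I → I → A}

/-- The relation `B₂ R X₁ = R X₁ B₂`, entry by entry. -/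
def Intertwines (q : F) (Q : I → I → F) (X : I → I → A) (B : Matrix I I A) : Prop :=
  ∀ a b c d, Q a d • (B b d * X a c) +
      (if a = d then (1 - q ^ 2) • ∑ s with a < s, B b s * X s c else 0) =
    Q a b • (X a c * B b d) + (if a < b then (1 - q ^ 2) • (X b c * B a d) else 0)

lemma mul_ite_smul_sum (P : Prop) [Decidable P] (c : F) (a : A) (s : Finset I) (f : I → A) :
    a * (if P then c • ∑ i ∈ s, f i else 0) = if P then c • ∑ i ∈ s, a * f i else 0 := by
  rw [mul_ite, mul_zero, mul_smul_comm, Finset.mul_sum]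

lemma ite_smul_sum_mul (P : Prop) [Decidable P] (c : F) (a : A) (s : Finset I) (f : I → A) :
    (if P then c • ∑ i ∈ s, f i else 0) * a = if P then c • ∑ i ∈ s, f i * a else 0 := by
  rw [ite_mul, zero_mul, smul_mul_assoc, Finset.sum_mul]

lemma sum_ite_smul_sum_comm (P : Prop) [Decidable P] (c : F) (s : Finset I) (f : I → I → A) :
    ∑ e, (if P then c • ∑ i ∈ s, f e i else 0) = if P then c • ∑ i ∈ s, ∑ e, f e i else 0 := by
  split_ifs
  · rw [← Finset.smul_sum, Finset.sum_comm]
  · simp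

/-- The matrix `X Y` intertwines: move the entry of `X` first past `Y` and then past `X`. -/
lemma QSystem.intertwines_prodMat (h : QSystem q Q X Y) : Intertwines q Q X (prodMat X Y) := by
  intro a b c d
  simp only [prodMat, Matrix.mul_apply, Matrix.of_apply]
  have h1 : ∀ e, X b e * (Q a d • (Y e d * X a c) +
      (if a = d then (1 - q ^ 2) • ∑ s with a < s, Y e s * X s c else 0)) =
      Q c e • (X b e * X a c * Y e d) +
        (if e = c then (1 - q ^ 2) • ∑ s with s < e, X b e * (X a s * Y s d) else 0) := by
    intro e
    rw [← h.cross, mul_add, mul_smul_comm, mul_ite_smul_sum, mul_assoc]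
  have h2 : ∑ e, (if e = c then (1 - q ^ 2) • ∑ s with s < e, X b e * (X a s * Y s d) else 0) =
      ∑ e, (if e < c then (1 - q ^ 2) • (X b c * X a e) else 0) * Y e d := by
    rw [Finset.sum_ite_eq' Finset.univ c, if_pos (Finset.mem_univ c), Finset.smul_sum,
      Finset.sum_filter]
    refine Finset.sum_congr rfl fun e _ => ?_
    rw [ite_mul, zero_mul, smul_mul_assoc, mul_assoc]
  have h3 := Finset.sum_congr (s₁ := Finset.univ) rfl fun e _ => h1 e
  rw [Finset.sum_add_distrib, h2, ← Finset.sum_add_distrib] at h3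
  have h4 : ∀ e, Q c e • (X b e * X a c * Y e d) +
      (if e < c then (1 - q ^ 2) • (X b c * X a e) else 0) * Y e d =
      Q a b • (X a c * (X b e * Y e d)) +
        (if a < b then (1 - q ^ 2) • (X b c * (X a e * Y e d)) else 0) := by
    intro e
    rw [← smul_mul_assoc, ← add_mul, ← h.X_rel.rel, add_mul, smul_mul_assoc, ite_mul, zero_mul,
      smul_mul_assoc, mul_assoc, mul_assoc]
  rw [Finset.sum_congr rfl fun e _ => h4 e] at h3
  simp only [mul_add, mul_smul_comm, mul_ite_smul_sum, Finset.sum_add_distrib,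
    sum_ite_smul_sum_comm, ← Finset.smul_sum] at h3
  simp only [Finset.sum_mul, mul_assoc]
  rw [h3, Finset.mul_sum, Finset.mul_sum]
  congr 1
  split_ifs
  · rw [Finset.smul_sum]
  · simp

lemma Intertwines.one : Intertwines q Q X (1 : Matrix I I A) := by
  intro a b c d
  have h1 : ∑ s with a < s, (1 : Matrix I I A) b s * X s c = if a < b then X b c else 0 := by
    simp [Matrix.one_apply, Finset.sum_filter]
  rw [h1]
  congr 1
  · by_cases hbd : b = d
    · subst hbd; simp
    · simp [hbd]
  · by_cases had : a = d <;> by_cases hab : a < b <;> simp [had, hab, Matrix.one_apply] <;> simp_all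

/-- Multiplication on the right by an intertwining matrix preserves the relations of `Y` with
`X`. -/
lemma QSystem.cross_mul (h : QSystem q Q X Y) {B' : Matrix I I A}
    (h' : Intertwines q Q X B') (a b c d : I) :
    Q c b • (X a c * (Matrix.of Y * B') b d) +
      (if b = c then (1 - q ^ 2) • ∑ s with s < b, X a s * (Matrix.of Y * B') s d else 0) =
    Q a d • ((Matrix.of Y * B') b d * X a c) +
      (if a = d then (1 - q ^ 2) • ∑ s with a < s, (Matrix.of Y * B') b s * X s c else 0) := by
  simp only [Matrix.mul_apply, Matrix.of_apply]
  have h1 : ∀ e, Y b e * (Q a d • (B' e d * X a c) +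
      (if a = d then (1 - q ^ 2) • ∑ s with a < s, B' e s * X s c else 0)) =
      Q a e • (Y b e * X a c * B' e d) +
        (if a < e then (1 - q ^ 2) • (Y b e * X e c * B' a d) else 0) := by
    intro e
    rw [h', mul_add, mul_smul_comm, mul_ite, mul_zero, mul_smul_comm, mul_assoc, mul_assoc]
  have h2 : ∑ e, (if a < e then (1 - q ^ 2) • (Y b e * X e c * B' a d) else 0) =
      ∑ e, (if a = e then (1 - q ^ 2) • ∑ s with a < s, Y b s * X s c else 0) * B' e d := by
    simp only [ite_mul, zero_mul]
    rw [Finset.sum_ite_eq Finset.univ a, if_pos (Finset.mem_univ a), smul_mul_assoc, Finset.sum_mul,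
      Finset.smul_sum, Finset.sum_filter]
  have h3 := Finset.sum_congr (s₁ := Finset.univ) rfl fun e _ => h1 e
  rw [Finset.sum_add_distrib, h2, ← Finset.sum_add_distrib] at h3
  have h4 : ∀ e, Q a e • (Y b e * X a c * B' e d) +
      (if a = e then (1 - q ^ 2) • ∑ s with a < s, Y b s * X s c else 0) * B' e d =
      Q c b • (X a c * (Y b e * B' e d)) +
        (if b = c then (1 - q ^ 2) • ∑ s with s < b, X a s * (Y s e * B' e d) else 0) := by
    intro e
    rw [← smul_mul_assoc, ← add_mul, ← h.cross, add_mul, smul_mul_assoc, ite_smul_sum_mul]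
    simp only [mul_assoc]
  rw [Finset.sum_congr rfl fun e _ => h4 e] at h3
  simp only [mul_add, mul_smul_comm, mul_ite_smul_sum, Finset.sum_add_distrib,
    sum_ite_smul_sum_comm, ← Finset.smul_sum] at h3
  simp only [Finset.sum_mul, Finset.mul_sum, mul_assoc] at h3 ⊢
  exact h3.symm

/-- Intertwining matrices are closed under products. -/
lemma Intertwines.mul {B B' : Matrix I I A} (h : Intertwines q Q X B)
    (h' : Intertwines q Q X B') : Intertwines q Q X (B * B') := by
  intro a b c d
  simp only [Matrix.mul_apply]
  have h1 : ∀ e, B b e * (Q a d • (B' e d * X a c) +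
      (if a = d then (1 - q ^ 2) • ∑ s with a < s, B' e s * X s c else 0)) =
      Q a e • (B b e * X a c * B' e d) +
        (if a < e then (1 - q ^ 2) • (B b e * X e c * B' a d) else 0) := by
    intro e
    rw [h', mul_add, mul_smul_comm, mul_ite, mul_zero, mul_smul_comm, mul_assoc, mul_assoc]
  have h2 : ∑ e, (if a < e then (1 - q ^ 2) • (B b e * X e c * B' a d) else 0) =
      ∑ e, (if a = e then (1 - q ^ 2) • ∑ s with a < s, B b s * X s c else 0) * B' e d := by
    simp only [ite_mul, zero_mul]
    rw [Finset.sum_ite_eq Finset.univ a, if_pos (Finset.mem_univ a), smul_mul_assoc, Finset.sum_mul,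
      Finset.smul_sum, Finset.sum_filter]
  have h3 := Finset.sum_congr (s₁ := Finset.univ) rfl fun e _ => h1 e
  rw [Finset.sum_add_distrib, h2, ← Finset.sum_add_distrib] at h3
  have h4 : ∀ e, Q a e • (B b e * X a c * B' e d) +
      (if a = e then (1 - q ^ 2) • ∑ s with a < s, B b s * X s c else 0) * B' e d =
      Q a b • (X a c * (B b e * B' e d)) +
        (if a < b then (1 - q ^ 2) • (X b c * (B a e * B' e d)) else 0) := by
    intro e
    rw [← smul_mul_assoc, ← add_mul, h, add_mul, smul_mul_assoc, ite_mul, zero_mul,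
      smul_mul_assoc, mul_assoc, mul_assoc]
  rw [Finset.sum_congr rfl fun e _ => h4 e] at h3
  simp only [mul_add, mul_smul_comm, mul_ite_smul_sum, Finset.sum_add_distrib,
    sum_ite_smul_sum_comm, ← Finset.smul_sum] at h3
  simp only [Finset.sum_mul, mul_assoc]
  rw [h3, Finset.mul_sum, Finset.mul_sum]
  congr 1
  split_ifs
  · rw [Finset.smul_sum]
  · simp

lemma QSystem.intertwines_pow (h : QSystem q Q X Y) (r : ℕ) :
    Intertwines q Q X (prodMat X Y ^ (r + 1)) := by
  induction r with
  | zero => simpa using h.intertwines_prodMat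
  | succ r ih => rw [pow_succ]; exact ih.mul h.intertwines_prodMat

/-- The weighted trace of a matrix that intertwines with `X` commutes with the entries of `X`. -/
lemma Intertwines.commute (hp : IsParam q Q) {B : Matrix I I A} (h : Intertwines q Q X B)
    (a c : I) : Commute (∑ b, wLt I q b • B b b) (X a c) := by
  have hq := hp.ne_zero
  have h1 : ∀ b, B b b * X a c - X a c * B b b = (1 - q ^ 2) •
      ((if a < b then (Q a b)⁻¹ • (X b c * B a b) else 0) -
        if a = b then ∑ s with a < s, B a s * X s c else 0) := by
    intro b
    have h2 := h a b c b
    have hab := hp.apply_ne_zero a b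
    apply smul_right_injective A hab
    simp only [smul_sub, smul_ite, smul_zero, smul_smul]
    rw [mul_comm (1 - q ^ 2), ← mul_assoc, mul_inv_cancel₀ hab, one_mul, sub_eq_sub_iff_add_eq_add,
      add_comm _ (Q a b • _)]
    by_cases hab : a = b
    · subst hab
      simp only [hp.diag, one_mul] at h2 ⊢
      simpa using h2
    · simpa [hab] using h2
  have h5 : ∀ s, a < s → q ^ 2 • (Q a s)⁻¹ • (X s c * B a s) =
      B a s * X s c + (1 - q ^ 2) • ∑ t with s < t, B a t * X t c := by
    intro s has
    have h6 := h s a c s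
    rw [if_pos rfl, if_neg has.not_gt, hp.diag, one_smul, add_zero] at h6
    rw [h6, smul_smul, ← hp.mul_swap has.ne, mul_right_comm, mul_inv_cancel₀ (hp.apply_ne_zero _ _),
      one_mul]
  have h7 : ∑ b with a < b, wLt I q b • q ^ 2 • (Q a b)⁻¹ • (X b c * B a b) =
      ∑ t with a < t, (q ^ 2 * wLt I q a) • (B a t * X t c) := by
    have h8 : ∑ b with a < b, (wLt I q b * (1 - q ^ 2)) • ∑ t with b < t, B a t * X t c =
        ∑ t with a < t, ((1 - q ^ 2) * ∑ b with a < b ∧ b < t, wLt I q b) • (B a t * X t c) := by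
      simp only [Finset.smul_sum, Finset.mul_sum, Finset.sum_smul]
      rw [Finset.sum_sigma', Finset.sum_sigma']
      refine Finset.sum_nbij' (fun x => ⟨x.2, x.1⟩) (fun x => ⟨x.2, x.1⟩) ?_ ?_ ?_ ?_ ?_
      · rintro ⟨b, t⟩ h; simp at h ⊢; exact ⟨h.1.trans h.2, h⟩
      · rintro ⟨b, t⟩ h; simp at h ⊢; exact h.2
      · rintro ⟨b, t⟩ h; rfl
      · rintro ⟨b, t⟩ h; rfl
      · rintro ⟨b, t⟩ h; rw [mul_comm]
    have h9 : ∀ b ∈ Finset.univ.filter (a < ·), wLt I q b • q ^ 2 • (Q a b)⁻¹ • (X b c * B a b) =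
        wLt I q b • (B a b * X b c) +
          (wLt I q b * (1 - q ^ 2)) • ∑ t with b < t, B a t * X t c := by
      intro b hb
      rw [h5 b (Finset.mem_filter.1 hb).2, smul_add, smul_smul]
    rw [Finset.sum_congr rfl h9, Finset.sum_add_distrib, h8, ← Finset.sum_add_distrib]
    refine Finset.sum_congr rfl fun t ht => ?_
    rw [← add_smul, wLt_add_sum q (Finset.mem_filter.1 ht).2]
  rw [Commute, SemiconjBy, ← sub_eq_zero, Finset.sum_mul, Finset.mul_sum,
    ← Finset.sum_sub_distrib]
  simp only [smul_mul_assoc, mul_smul_comm, ← smul_sub, h1]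
  apply smul_right_injective A (pow_ne_zero 2 hq)
  simp only [smul_sub, Finset.sum_sub_distrib, smul_zero]
  rw [sub_eq_zero]
  simp only [smul_ite, smul_zero, Finset.sum_ite_eq, Finset.mem_univ, if_true]
  rw [← Finset.sum_filter]
  have h10 := congrArg ((1 - q ^ 2) • ·) h7
  simp only [Finset.smul_sum] at h10 ⊢
  refine Eq.trans (Finset.sum_congr rfl fun b _ => ?_) (h10.trans
    (Finset.sum_congr rfl fun b _ => ?_))
  · simp only [smul_smul]; congr 1; ring
  · simp only [smul_smul]; congr 1; ring

lemma QSystem.commute_powerSum_X (h : QSystem q Q X Y) (r : ℕ) (a c : I) :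
    Commute (powerSum q X Y (r + 1)) (X a c) :=
  (h.intertwines_pow r).commute h.param a c

lemma prodMat_op_pow (r : ℕ) (i j : I) :
    (prodMat (fun i j => op (Y j i)) (fun i j => op (X j i)) ^ r) i j =
      op ((prodMat X Y ^ r) j i) := by
  induction r generalizing i j with
  | zero => simp [Matrix.one_apply, eq_comm, apply_ite op]
  | succ r ih =>
    rw [pow_succ, pow_succ', Matrix.mul_apply, Matrix.mul_apply, Finset.op_sum]
    refine Finset.sum_congr rfl fun s _ => ?_
    rw [ih, op_mul]
    congr 1
    simp [prodMat, Matrix.mul_apply, Finset.op_sum]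

lemma powerSum_op (r : ℕ) :
    powerSum q (fun i j => op (Y j i)) (fun i j => op (X j i)) r = op (powerSum q X Y r) := by
  simp only [powerSum, prodMat_op_pow, Finset.op_sum, op_smul]

/-- The power sums commute with `Y` since they commute with `X` in the opposite algebra. -/
lemma QSystem.commute_powerSum_Y (h : QSystem q Q X Y) (r : ℕ) (a c : I) :
    Commute (powerSum q X Y (r + 1)) (Y a c) := by
  have := h.opposite.commute_powerSum_X r c a
  rw [powerSum_op] at this
  exact commute_op.1 this

/-- The weighted traces of the powers of `Y X` agree with those of `X Y`. -/
lemma QSystem.powerSum_dual (h : QSystem q Q X Y) (r : ℕ) :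
    powerSum (I := Iᵒᵈ) q Y X (r + 1) = powerSum q X Y (r + 1) := by
  -- With `C = Y (X Y) ^ r`, the two power sums are the weighted traces of `X C` and `C X`. The relation
  -- between `Y` and `X` holds for `C` in place of `Y`, and summing it with the weights of both indices
  -- turns its two sides into these traces.
  set C : Matrix I I A := Matrix.of Y * prodMat X Y ^ r with hC
  have hXC : prodMat X Y ^ (r + 1) = Matrix.of X * C := by
    rw [pow_succ', prodMat, mul_assoc, hC]; rfl
  have hCX : (Matrix.of Y * Matrix.of X) ^ (r + 1) = C * Matrix.of X := by
    rw [hC, prodMat]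
    have h1 : SemiconjBy (Matrix.of Y) (Matrix.of X * Matrix.of Y) (Matrix.of Y * Matrix.of X) := by
      rw [SemiconjBy, mul_assoc]
    rw [pow_succ, ← mul_assoc, ← (h1.pow_right r).eq]
  have hZ : Intertwines q Q X (prodMat X Y ^ r) := by
    cases r with
    | zero => exact .one
    | succ r => exact h.intertwines_pow r
  have hcross : ∀ a b, X a b * C b a + (1 - q ^ 2) • ∑ s with s < b, X a s * C s a =
      C b a * X a b + (1 - q ^ 2) • ∑ s with a < s, C b s * X s b := by
    intro a b
    simpa [h.param.diag] using h.cross_mul hZ a b b a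
  have hl : ∑ a, ∑ b, (wLt I q a * wGt I q b) • (X a b * C b a + (1 - q ^ 2) •
      ∑ s with s < b, X a s * C s a) = ∑ a, wLt I q a • (Matrix.of X * C) a a := by
    refine Finset.sum_congr rfl fun a _ => ?_
    simp only [mul_smul, ← Finset.smul_sum]
    congr 1
    simp only [smul_add, Finset.sum_add_distrib, Finset.smul_sum, Finset.sum_filter]
    rw [Finset.sum_comm, ← Finset.sum_add_distrib, Matrix.mul_apply]
    refine Finset.sum_congr rfl fun s _ => ?_
    have := congrArg (· • (X a s * C s a)) (wGt_add_sum_gt (I := I) q s)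
    simp only [add_smul, one_smul, Finset.mul_sum, Finset.sum_smul, Finset.sum_filter] at this
    refine Eq.trans (congrArg _ ?_) this
    refine Finset.sum_congr rfl fun b _ => ?_
    split_ifs
    · rw [smul_smul, mul_comm]
    · simp
  have hr : ∑ a, ∑ b, (wLt I q a * wGt I q b) • (C b a * X a b + (1 - q ^ 2) •
      ∑ s with a < s, C b s * X s b) = ∑ b, wGt I q b • (C * Matrix.of X) b b := by
    rw [Finset.sum_comm]
    refine Finset.sum_congr rfl fun b _ => ?_
    simp only [mul_comm (wLt I q _), mul_smul, ← Finset.smul_sum]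
    congr 1
    simp only [smul_add, Finset.sum_add_distrib, Finset.smul_sum, Finset.sum_filter]
    rw [Finset.sum_comm, ← Finset.sum_add_distrib, Matrix.mul_apply]
    refine Finset.sum_congr rfl fun s _ => ?_
    have := congrArg (· • (C b s * X s b)) (wLt_add_sum_lt (I := I) q s)
    simp only [add_smul, one_smul, Finset.mul_sum, Finset.sum_smul, Finset.sum_filter] at this
    refine Eq.trans (congrArg _ ?_) this
    refine Finset.sum_congr rfl fun a _ => ?_
    split_ifs
    · rw [smul_smul, mul_comm]
    · simp
  simp only [hcross] at hl
  rw [hr, ← hXC, ← hCX] at hl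
  exact hl

/-- Power sums that commute with an element force the `tau k` to commute with it. -/
lemma QSystem.commute_tau (h : QSystem q Q X Y) {z : A}
    (hz : ∀ r, Commute (powerSum q X Y (r + 1)) z) (k : ℕ) : Commute (tau q Q X Y k) z := by
  induction k using Nat.strong_induction_on with
  | _ k ih =>
    cases k with
    | zero => rw [h.tau_zero]; exact Commute.one_left z
    | succ k =>
      by_cases hk : k < Fintype.card I
      · have h0 := h.param.qInt_ne_zero k
        have : tau q Q X Y (k + 1) = (qInt q (k + 1))⁻¹ • ∑ r ∈ Finset.range (k + 1),
            (-1) ^ r * (powerSum q X Y (r + 1) * tau q Q X Y (k - r)) := by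
          rw [← h.newton hk, smul_smul, inv_mul_cancel₀ h0, one_smul]
        rw [this]
        refine Commute.smul_left (Commute.sum_left _ _ _ fun r _ => ?_) _
        exact ((Commute.neg_one_left z).pow_left r).mul_left
          ((hz r).mul_left (ih (k - r) (by omega)))
      · rw [tau_of_card_lt (by omega)]; exact Commute.zero_left z

/-- The `tau k` are determined by the power sums. -/
lemma QSystem.tau_eq_of_powerSum {J : Type*} [LinearOrder J] [Fintype J] {Q' : J → J → F}
    {X' Y' : J → J → A} (h : QSystem q Q X Y) (h' : QSystem q Q' X' Y')
    (hc : Fintype.card J = Fintype.card I)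
    (hz : ∀ r, powerSum q X' Y' (r + 1) = powerSum q X Y (r + 1)) (k : ℕ) :
    tau q Q' X' Y' k = tau q Q X Y k := by
  induction k using Nat.strong_induction_on with
  | _ k ih =>
    cases k with
    | zero => rw [h.tau_zero, h'.tau_zero]
    | succ k =>
      by_cases hk : k < Fintype.card I
      · apply smul_right_injective A (h.param.qInt_ne_zero k)
        change qInt q (k + 1) • _ = qInt q (k + 1) • _
        rw [h.newton hk, h'.newton (hc ▸ hk)]
        exact Finset.sum_congr rfl fun r _ => by rw [hz, ih (k - r) (by omega)]
      · rw [tau_of_card_lt (by omega), tau_of_card_lt (by omega)]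

/-- Reversing the order of the indices and exchanging `X` with `Y` does not change the `tau k`. -/
lemma QSystem.tau_dual (h : QSystem q Q X Y) (k : ℕ) :
    tau (I := Iᵒᵈ) q (fun i j => Q j i) Y X k = tau q Q X Y k :=
  h.tau_eq_of_powerSum h.dual (Fintype.card_congr OrderDual.ofDual) h.powerSum_dual k

end PowerSums

/-! ### Reversal of the order -/

section Dual

variable {I F A : Type*} [LinearOrder I] [Fintype I] [Field F] [Ring A] [Algebra F A]
variable {q : F} {Q : I → I → F} {X Y : I → I → A}

/-- A matrix is determined by its row `∅` and its products with the `rAnnih p t`, when these are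
given in terms of the previous rows. -/
lemma eq_of_rAnnih {p : I → I → F} (hp : IsParam q p) {M M' : Matrix (Finset I) (Finset I) A}
    (h0 : ∀ L, M ∅ L = M' ∅ L)
    (h1 : ∀ J, (∀ L, M J L = M' J L) → ∀ t L,
      (liftMat A (rAnnih p t) * M) J L = (liftMat A (rAnnih p t) * M') J L) : M = M' := by
  ext J L
  induction J using Finset.induction_on generalizing L with
  | empty => exact h0 L
  | insert t J ht ih =>
    have := apply_insert_of_rAnnih (A := A) hp ht (M := M - M') (K := L)
      (by rw [mul_sub, Matrix.sub_apply, h1 J ih t L, sub_self])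
    exact sub_eq_zero.1 this

lemma mul_apply_congr {M M' : Matrix (Finset I) (Finset I) A} {J : Finset I}
    (h : ∀ L, M J L = M' J L) (B : Matrix (Finset I) (Finset I) A) (L : Finset I) :
    (M * B) J L = (M' * B) J L := by
  simp only [Matrix.mul_apply, h]

lemma QSystem.eq_minorsY (h : QSystem q Q X Y) {M : Matrix (Finset I) (Finset I) A}
    (h0 : ∀ L, M ∅ L = if L = ∅ then 1 else 0)
    (h1 : ∀ t, liftMat A (rAnnih (fun i j => Q j i) t) * M =
      ∑ c, sc (Y c t) * (M * liftMat A (rAnnih (fun i j => Q j i) c))) : M = minorsY Q Y := by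
  refine eq_of_rAnnih h.param.swap (fun L => by rw [h0, minorsY_empty]) fun J hJ t L => ?_
  rw [h1, h.rAnnih_mul_minorsY, Matrix.sum_apply, Matrix.sum_apply]
  refine Finset.sum_congr rfl fun c _ => ?_
  rw [sc_mul_apply, sc_mul_apply, mul_apply_congr hJ]

lemma QSystem.eq_minorsX (h : QSystem q Q X Y) {M : Matrix (Finset I) (Finset I) A}
    (h0 : ∀ L, M ∅ L = if L = ∅ then 1 else 0)
    (h1 : ∀ t, liftMat A (rAnnih (fun i j => Q j i) t) * M =
      ∑ c, M * liftMat A (rAnnih (fun i j => Q j i) c) * sc (X c t)) : M = minorsX Q X := by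
  refine eq_of_rAnnih h.param.swap (fun L => by rw [h0, minorsX_empty]) fun J hJ t L => ?_
  rw [h1, h.rAnnih_mul_minorsX, Matrix.sum_apply, Matrix.sum_apply]
  refine Finset.sum_congr rfl fun c _ => ?_
  rw [mul_sc_apply, mul_sc_apply, mul_apply_congr hJ]

/-- The quantum minors of `Y` can be read off in the reversed order of the indices. -/
lemma QSystem.minorsX_dual (h : QSystem q Q X Y) :
    minorsX (I := Iᵒᵈ) (fun i j => Q j i) Y = minorsY Q Y :=
  h.eq_minorsY (M := minorsX (I := Iᵒᵈ) (fun i j => Q j i) Y)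
    (fun L => minorsX_empty (I := Iᵒᵈ) L)
    fun t => lAnnih_mul_qMinor h.dual.param.swap h.dual.X_rel.swap t

/-- The quantum minors of `X` can be read off in the reversed order of the indices. -/
lemma QSystem.minorsY_dual (h : QSystem q Q X Y) :
    minorsY (I := Iᵒᵈ) (fun i j => Q j i) X = minorsX Q X :=
  h.eq_minorsX (M := minorsY (I := Iᵒᵈ) (fun i j => Q j i) X)
    (fun L => minorsY_empty (I := Iᵒᵈ) L) fun t => h.dual.lAnnih_mul_minorsY t

/-- The coefficients `tau k` with the minors of `X` before those of `Y`. -/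
lemma QSystem.tau_eq_sum_minorsX_mul_minorsY (h : QSystem q Q X Y) (k : ℕ) :
    tau q Q X Y k = ∑ K, ∑ L with L.card = k,
      (∏ c ∈ L, wLt I q c) • (minorsX Q X K L * minorsY Q Y L K) := by
  refine (h.tau_dual k).symm.trans ((tau_eq_sum (I := Iᵒᵈ) k).trans ?_)
  rw [← h.minorsX_dual, ← h.minorsY_dual]
  rfl

end Dual

/-! ### Chains of braid generators -/

section Chain

variable {F E : Type*} [Field F] [Ring E] [Algebra F E]

/-- The product `x 0 * x 1 * ⋯ * x (n - 1)`. -/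
def upProd (x : ℕ → E) : ℕ → E
  | 0 => 1
  | n + 1 => upProd x n * x n

/-- The product `y (n - 1) * ⋯ * y 1 * y 0`. -/
def downProd (y : ℕ → E) : ℕ → E
  | 0 => 1
  | n + 1 => y n * downProd y n

lemma upProd_succ' (x : ℕ → E) (n : ℕ) : upProd x (n + 1) = x 0 * upProd (fun i => x (i + 1)) n := by
  induction n with
  | zero => simp [upProd]
  | succ n ih => rw [upProd, ih, upProd, mul_assoc]

lemma prod_ofFn_eq_upProd {n : ℕ} (g : Fin n → E) (h : ℕ → E) (hg : ∀ m : Fin n, g m = h m) :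
    (List.ofFn g).prod = upProd h n := by
  induction n with
  | zero => simp [upProd]
  | succ n ih =>
    rw [List.ofFn_succ', List.concat_eq_append, List.prod_append, ih _ fun m => hg m.castSucc,
      List.prod_singleton, hg, upProd]
    simp

lemma Commute.upProd_right {a : E} {x : ℕ → E} {n : ℕ} (h : ∀ j < n, Commute a (x j)) :
    Commute a (upProd x n) := by
  induction n with
  | zero => exact Commute.one_right a
  | succ n ih => exact (ih fun j hj => h j (by omega)).mul_right (h n (by omega))

lemma Commute.downProd_right {a : E} {x : ℕ → E} {n : ℕ} (h : ∀ j < n, Commute a (x j)) :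
    Commute a (downProd x n) := by
  induction n with
  | zero => exact Commute.one_right a
  | succ n ih => exact (h n (by omega)).mul_right (ih fun j hj => h j (by omega))

/-- Elements `x i`, `y i` and `h i` that satisfy the relations of `X_i`, `Y_i` and `R̂_{i,i+1}`, for
the legs `i < n`. -/
structure BraidRelations (n : ℕ) (x y h : ℕ → E) : Prop where
  exchange : ∀ i, i + 1 < n → y i * h i * x i = x (i + 1) * h i * y (i + 1)
  yy : ∀ i, i + 1 < n → Commute (h i) (y (i + 1) * y i)
  commute_x : ∀ i j, i + 1 < n → j < n → j ≠ i → j ≠ i + 1 → Commute (h i) (x j)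
  commute_y : ∀ i j, i + 1 < n → j < n → j ≠ i → j ≠ i + 1 → Commute (h i) (y j)

variable {n : ℕ} {x y h : ℕ → E}

/-- The element `y 0` moves through a chain of braid generators and shifts the factors `x i` by one
leg. -/
lemma BraidRelations.exchange_upProd (H : BraidRelations n x y h) {j : ℕ} (hj : j < n) :
    y 0 * upProd h j * upProd x j = upProd (fun i => x (i + 1)) j * upProd h j * y j := by
  induction j with
  | zero => simp [upProd]
  | succ j ih =>
    have h1 : Commute (h j) (upProd x j) :=
      Commute.upProd_right fun i hi => H.commute_x j i hj (by omega) (by omega) (by omega)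
    have h2 : Commute (x (j + 1)) (upProd h j) :=
      Commute.upProd_right fun i hi => (H.commute_x i (j + 1) (by omega) hj (by omega) (by omega)).symm
    calc y 0 * upProd h (j + 1) * upProd x (j + 1)
        = y 0 * upProd h j * (h j * upProd x j) * x j := by simp only [upProd, mul_assoc]
      _ = (y 0 * upProd h j * upProd x j) * h j * x j := by rw [h1.eq]; simp only [mul_assoc]
      _ = upProd (fun i => x (i + 1)) j * upProd h j * (y j * h j * x j) := by
          rw [ih (by omega)]; simp only [mul_assoc]
      _ = upProd (fun i => x (i + 1)) j * (upProd h j * x (j + 1)) * h j * y (j + 1) := by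
          rw [H.exchange j hj]; simp only [mul_assoc]
      _ = _ := by rw [← h2.eq]; simp only [upProd, mul_assoc]

/-- A braid generator commutes with a product of the `y j` unless this ends between its two legs. -/
lemma BraidRelations.commute_downProd (H : BraidRelations n x y h) {i m : ℕ} (hi : i + 1 < n)
    (hm : m ≤ n) (him : m ≤ i ∨ i + 1 < m) : Commute (h i) (downProd y m) := by
  have h0 : ∀ m ≤ i, Commute (h i) (downProd y m) := fun m hm' =>
    Commute.downProd_right fun j hj => H.commute_y i j hi (by omega) (by omega) (by omega)
  rcases him with him | him
  · exact h0 m him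
  · obtain ⟨d, rfl⟩ : ∃ d, m = i + 2 + d := ⟨m - (i + 2), by omega⟩
    clear him
    induction d with
    | zero =>
      have : downProd y (i + 2) = y (i + 1) * y i * downProd y i := by simp only [downProd, mul_assoc]
      rw [add_zero, this]
      exact (H.yy i hi).mul_right (h0 i le_rfl)
    | succ d ih =>
      exact (H.commute_y i (i + 2 + d) hi (by omega) (by omega) (by omega)).mul_right
        (ih (by omega))

/-- Each factor `x 0 * y 0 * h 0 * ⋯ * h (k - 2)` fills one further leg with `x` and with `y`. The
element `U` plays the role of the Levi-Civita tensor, an eigenvector of all `h i`. -/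
lemma BraidRelations.mul_wedge (H : BraidRelations n x y h) {c : F} {U : E}
    (hU : ∀ i, i + 1 < n → h i * U = c • U) {j k : ℕ} (hjk : j < k) (hk : k ≤ n) :
    x 0 * y 0 * upProd h (k - 1) * (upProd x j * downProd y j * U) =
      c ^ (k - 1) • (upProd x (j + 1) * downProd y (j + 1) * U) := by
  have h1 : ∀ i m, i + 1 < n → m ≤ n → (m ≤ i ∨ i + 1 < m) →
      h i * (downProd y m * U) = c • (downProd y m * U) := by
    intro i m hi hm him
    rw [← mul_assoc, (H.commute_downProd hi hm him).eq, mul_assoc, hU i hi, mul_smul_comm]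
  -- The braid generators beyond the leg `j` reach `U` and act on it as the scalar `c`.
  have h2 : ∀ d, j + d < n → upProd h (j + d) * (upProd x j * downProd y j * U) =
      c ^ d • (upProd h j * (upProd x j * downProd y j * U)) := by
    intro d hd
    induction d with
    | zero => simp
    | succ d ih =>
      have h3 : Commute (h (j + d)) (upProd x j) := Commute.upProd_right fun i hi =>
        H.commute_x (j + d) i hd (by omega) (by omega) (by omega)
      rw [← add_assoc, upProd, mul_assoc, mul_assoc (upProd x j), ← mul_assoc (h (j + d)), h3.eq,
        mul_assoc (upProd x j), h1 (j + d) j hd (by omega) (.inl (by omega)), mul_smul_comm,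
        mul_smul_comm, ← mul_assoc (upProd x j), ih (by omega), smul_smul, pow_succ']
  -- Once `y` fills the leg `j` as well, the remaining braid generators reach `U`.
  have h4 : ∀ i ≤ j, upProd h i * (downProd y (j + 1) * U) = c ^ i • (downProd y (j + 1) * U) := by
    intro i hi
    induction i with
    | zero => simp [upProd]
    | succ i ih =>
      rw [upProd, mul_assoc, h1 i (j + 1) (by omega) (by omega) (.inr (by omega)), mul_smul_comm,
        ih (by omega), smul_smul, pow_succ']
  obtain ⟨d, hd⟩ : ∃ d, k - 1 = j + d := ⟨k - 1 - j, by omega⟩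
  rw [hd, mul_assoc (x 0 * y 0), h2 d (by omega), mul_smul_comm]
  calc c ^ d • (x 0 * y 0 * (upProd h j * (upProd x j * downProd y j * U)))
      = c ^ d • (x 0 * (y 0 * upProd h j * upProd x j) * (downProd y j * U)) := by
        simp only [mul_assoc]
    _ = c ^ d • (upProd x (j + 1) * (upProd h j * (downProd y (j + 1) * U))) := by
        rw [H.exchange_upProd (by omega), upProd_succ', downProd]; simp only [mul_assoc]
    _ = _ := by
        rw [h4 j le_rfl, mul_smul_comm, smul_smul, ← pow_add, add_comm d j, mul_assoc]

/-- The power of the chain that enters the coefficients distributes `X` and `Y` over the first `k` legs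
of the Levi-Civita tensor. -/
lemma BraidRelations.pow_mul_wedge (H : BraidRelations n x y h) {c : F} {U : E}
    (hU : ∀ i, i + 1 < n → h i * U = c • U) {k : ℕ} (hk : k ≤ n) :
    (x 0 * y 0 * upProd h (k - 1)) ^ k * U =
      c ^ ((k - 1) * k) • (upProd x k * downProd y k * U) := by
  have : ∀ j ≤ k, (x 0 * y 0 * upProd h (k - 1)) ^ j * U =
      c ^ ((k - 1) * j) • (upProd x j * downProd y j * U) := by
    intro j hj
    induction j with
    | zero => simp [upProd, downProd]
    | succ j ih =>
      rw [pow_succ', mul_assoc, ih (by omega), mul_smul_comm, H.mul_wedge hU hj hk, smul_smul,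
        mul_add, mul_one, pow_add]
  exact this k le_rfl

end Chain

/-! ### Matrices in the legs of a tensor product -/

section Legs

variable {N : ℕ} {S : Type*} [Ring S]

lemma sum_atLegs_mul {k l : Fin N} (hkl : k ≠ l) (M : Matrix (Fin N × Fin N) (Fin N × Fin N) S)
    (a : Fin N → Fin N) (f : (Fin N → Fin N) → S) :
    ∑ b, atLegs k l M a b * f b = ∑ e : Fin N × Fin N, M (a k, a l) e *
      f (Function.update (Function.update a k e.1) l e.2) := by
  symm
  rw [← Finset.sum_filter_add_sum_filter_not Finset.univ
    (fun b : Fin N → Fin N => ∀ m, m ≠ k → m ≠ l → a m = b m),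
    Finset.sum_eq_zero (s := Finset.univ.filter fun b : Fin N → Fin N =>
      ¬∀ m, m ≠ k → m ≠ l → a m = b m), add_zero]
  · refine Finset.sum_bij' (fun e _ => Function.update (Function.update a k e.1) l e.2)
      (fun b _ => (b k, b l)) ?_ ?_ ?_ ?_ ?_
    · intro e _
      simp only [Finset.mem_filter, Finset.mem_univ, true_and]
      intro m hk hl
      rw [Function.update_of_ne hl, Function.update_of_ne hk]
    · simp
    · rintro ⟨s, t⟩ _
      simp [Function.update_of_ne hkl]
    · intro b hb
      simp only [Finset.mem_filter, Finset.mem_univ, true_and] at hb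
      ext m
      by_cases hl : m = l
      · subst hl; simp
      · by_cases hk : m = k
        · subst hk; simp [Function.update_of_ne hl]
        · rw [Function.update_of_ne hl, Function.update_of_ne hk, hb m hk hl]
    · rintro ⟨s, t⟩ _
      rw [atLegs, Matrix.of_apply, if_pos]
      · simp [Function.update_of_ne hkl]
      · intro m hk hl
        rw [Function.update_of_ne hl, Function.update_of_ne hk]
  · intro b hb
    simp only [Finset.mem_filter, Finset.mem_univ, true_and] at hb
    rw [atLegs, Matrix.of_apply, if_neg hb, zero_mul]

lemma sum_atLeg_mul (k : Fin N) (M : Matrix (Fin N) (Fin N) S)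
    (a : Fin N → Fin N) (f : (Fin N → Fin N) → S) :
    ∑ b, atLeg k M a b * f b = ∑ s, M (a k) s * f (Function.update a k s) := by
  symm
  rw [← Finset.sum_filter_add_sum_filter_not Finset.univ
    (fun b : Fin N → Fin N => ∀ m, m ≠ k → a m = b m),
    Finset.sum_eq_zero (s := Finset.univ.filter fun b : Fin N → Fin N =>
      ¬∀ m, m ≠ k → a m = b m), add_zero]
  · refine Finset.sum_bij' (fun s _ => Function.update a k s) (fun b _ => b k) ?_ ?_ ?_ ?_ ?_
    · intro e _
      simp only [Finset.mem_filter, Finset.mem_univ, true_and]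
      intro m hk
      rw [Function.update_of_ne hk]
    · simp
    · simp
    · intro b hb
      simp only [Finset.mem_filter, Finset.mem_univ, true_and] at hb
      ext m
      by_cases hk : m = k
      · subst hk; simp
      · rw [Function.update_of_ne hk, hb m hk]
    · intro s _
      rw [atLeg, Matrix.of_apply, if_pos]
      · simp
      · intro m hk
        rw [Function.update_of_ne hk]
  · intro b hb
    simp only [Finset.mem_filter, Finset.mem_univ, true_and] at hb
    rw [atLeg, Matrix.of_apply, if_neg hb, zero_mul]

lemma atLeg_comm_apply (k : Fin N) (M : Matrix (Fin N) (Fin N) S) (a b : Fin N → Fin N) :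
    atLeg k M a b = atLeg k Mᵀ b a := by
  simp only [atLeg, Matrix.of_apply, Matrix.transpose_apply]
  exact if_congr (forall₂_congr fun m _ => eq_comm) rfl rfl

lemma sum_mul_atLeg (k : Fin N) (M : Matrix (Fin N) (Fin N) S)
    (b : Fin N → Fin N) (f : (Fin N → Fin N) → S) :
    ∑ a, f a * atLeg k M a b = ∑ s, f (Function.update b k s) * M s (b k) := by
  have := sum_atLeg_mul (S := Sᵐᵒᵖ) k (Mᵀ.map MulOpposite.op) b fun a => MulOpposite.op (f a)
  apply MulOpposite.op_injective
  simp only [Finset.op_sum, MulOpposite.op_mul]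
  refine Eq.trans (Finset.sum_congr rfl fun a _ => ?_) this
  rw [atLeg_comm_apply]
  simp only [atLeg, Matrix.of_apply, Matrix.map_apply, apply_ite MulOpposite.op,
    MulOpposite.op_zero]

lemma atLegs_mul {k l : Fin N} (hkl : k ≠ l) (M M' : Matrix (Fin N × Fin N) (Fin N × Fin N) S) :
    atLegs k l M * atLegs k l M' = atLegs k l (M * M') := by
  ext a b
  rw [Matrix.mul_apply, sum_atLegs_mul hkl]
  simp only [atLegs, Matrix.of_apply, Matrix.mul_apply]
  have h1 : ∀ e : Fin N × Fin N, (∀ m, m ≠ k → m ≠ l →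
      Function.update (Function.update a k e.1) l e.2 m = b m) ↔
      ∀ m, m ≠ k → m ≠ l → a m = b m := by
    intro e
    refine forall₃_congr fun m hk hl => ?_
    rw [Function.update_of_ne hl, Function.update_of_ne hk]
  simp only [h1, Function.update_self, Function.update_of_ne hkl, Prod.mk.eta]
  split_ifs <;> simp

lemma atLegs_leg₁ {k l : Fin N} (hkl : k ≠ l) (M : Matrix (Fin N) (Fin N) S) :
    atLegs k l (leg₁ M) = atLeg k M := by
  ext a b
  simp only [atLegs, atLeg, leg₁, Matrix.of_apply, Matrix.kroneckerMap_apply, Matrix.one_apply]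
  by_cases h : ∀ m, m ≠ k → a m = b m
  · rw [if_pos h, if_pos fun m hk _ => h m hk, if_pos (h l hkl.symm), mul_one]
  · rw [if_neg h]
    split_ifs with h1 h2
    · exact absurd (fun m hk => if hl : m = l then hl ▸ h2 else h1 m hk hl) h
    · rw [mul_zero]
    · rfl

lemma atLegs_leg₂ {k l : Fin N} (hkl : k ≠ l) (M : Matrix (Fin N) (Fin N) S) :
    atLegs k l (leg₂ M) = atLeg l M := by
  ext a b
  simp only [atLegs, atLeg, leg₂, Matrix.of_apply, Matrix.kroneckerMap_apply, Matrix.one_apply]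
  by_cases h : ∀ m, m ≠ l → a m = b m
  · rw [if_pos h, if_pos fun m _ hl => h m hl, if_pos (h k hkl), one_mul]
  · rw [if_neg h]
    split_ifs with h1 h2
    · exact absurd (fun m hl => if hk : m = k then hk ▸ h2 else h1 m hk hl) h
    · rw [zero_mul]
    · rfl

lemma atLeg_mul (k : Fin N) (M M' : Matrix (Fin N) (Fin N) S) :
    atLeg k M * atLeg k M' = atLeg k (M * M') := by
  ext a b
  rw [Matrix.mul_apply, sum_atLeg_mul]
  simp only [atLeg, Matrix.of_apply, Matrix.mul_apply]
  have h1 : ∀ e : Fin N, (∀ m, m ≠ k → Function.update a k e m = b m) ↔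
      ∀ m, m ≠ k → a m = b m := by
    intro e
    refine forall₂_congr fun m hk => ?_
    rw [Function.update_of_ne hk]
  simp only [h1, Function.update_self]
  split_ifs <;> simp

/-- Matrices of central elements in two legs commute with matrices in a third leg. -/
lemma atLegs_commute_atLeg {k l j : Fin N} (hjk : j ≠ k) (hjl : j ≠ l)
    (T : Matrix (Fin N × Fin N) (Fin N × Fin N) S) (hT : ∀ e e' s, Commute (T e e') s)
    (M : Matrix (Fin N) (Fin N) S) : Commute (atLegs k l T) (atLeg j M) := by
  ext a b
  rw [Matrix.mul_apply, Matrix.mul_apply, sum_mul_atLeg, sum_atLeg_mul,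
    Finset.sum_eq_single (a j), Finset.sum_eq_single (b j)]
  · simp only [atLegs, Matrix.of_apply, Function.update_of_ne hjk.symm,
      Function.update_of_ne hjl.symm]
    rw [ite_mul, mul_ite, zero_mul, mul_zero, (hT _ _ _).eq]
    refine if_congr (forall₃_congr fun m hk hl => ?_) rfl rfl
    by_cases hm : m = j
    · subst hm; simp
    · simp [Function.update_of_ne hm]
  · intro s _ hs
    rw [atLegs, Matrix.of_apply, if_neg, mul_zero]
    intro h
    simpa [hs] using h j hjk hjl
  · simp
  · intro s _ hs
    rw [atLegs, Matrix.of_apply, if_neg, zero_mul]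
    intro h
    exact hs (by simpa using (h j hjk hjl).symm)
  · simp

end Legs

/-! ### Words of right multiplications and removals -/

section Words

variable {I F : Type*} [LinearOrder I] [Fintype I] [Field F]

/-- The product `r_{l_n} ⋯ r_{l_1}` of right multiplications. -/
def rWord (p : I → I → F) (l : List I) : Matrix (Finset I) (Finset I) F :=
  (l.map (rCreate p)).reverse.prod

/-- The product `φ_{l_1} ⋯ φ_{l_n}` of right removals. -/
def aWord (p : I → I → F) (l : List I) : Matrix (Finset I) (Finset I) F :=
  (l.map (rAnnih p)).prod

variable {q : F} {Q p : I → I → F}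

lemma rWord_append (l l' : List I) : rWord p (l ++ l') = rWord p l' * rWord p l := by
  simp [rWord]

lemma aWord_append (l l' : List I) : aWord p (l ++ l') = aWord p l * aWord p l' := by
  simp [aWord]

lemma rWord_cons (a : I) (l : List I) : rWord p (a :: l) = rWord p l * rCreate p a := by
  simp [rWord]

lemma aWord_cons (a : I) (l : List I) : aWord p (a :: l) = rAnnih p a * aWord p l := by
  simp [aWord]

/-- The coefficient of a word in the quantum exterior algebra: `∏ (-Q (σ j) (σ i))` over the pairs
`i < j` with `σ i > σ j`. -/
def wordCoeff (Q : I → I → F) {m : ℕ} (σ : Fin m → I) : F :=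
  ∏ x : Fin m × Fin m with x.1 < x.2 ∧ σ x.2 < σ x.1, -Q (σ x.2) (σ x.1)

lemma wordCoeff_eq_prod (Q : I → I → F) {m : ℕ} (σ : Fin m → I) :
    wordCoeff Q σ = ∏ i, ∏ j, if i < j ∧ σ j < σ i then -Q (σ j) (σ i) else 1 := by
  rw [wordCoeff, Finset.prod_filter, Fintype.prod_prod_type]

lemma wordCoeff_succ (Q : I → I → F) {m : ℕ} (σ : Fin (m + 1) → I) :
    wordCoeff Q σ = wordCoeff Q (fun i => σ i.castSucc) *
      ∏ i : Fin m, if σ (Fin.last m) < σ i.castSucc then -Q (σ (Fin.last m)) (σ i.castSucc)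
        else 1 := by
  rw [wordCoeff_eq_prod, wordCoeff_eq_prod, Fin.prod_univ_castSucc, ← Finset.prod_mul_distrib]
  have h1 : ∏ j, (if Fin.last m < j ∧ σ j < σ (Fin.last m) then -Q (σ j) (σ (Fin.last m)) else 1) =
      1 := Finset.prod_eq_one fun j _ => if_neg fun h => (Fin.le_last j).not_gt h.1
  rw [h1, mul_one]
  refine Finset.prod_congr rfl fun i _ => ?_
  rw [Fin.prod_univ_castSucc]
  simp [Fin.castSucc_lt_last]

/-- The action of a word of right multiplications on the vacuum. -/
lemma rWord_ofFn_apply_empty {m : ℕ} (σ : Fin m → I) (K : Finset I) :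
    rWord (fun i j => Q j i) (List.ofFn σ) K ∅ =
      if Function.Injective σ ∧ K = Finset.univ.image σ then wordCoeff Q σ else 0 := by
  induction m generalizing K with
  | zero =>
    simp [rWord, wordCoeff, Function.injective_of_subsingleton, Matrix.one_apply]
  | succ m ih =>
    rw [List.ofFn_succ', List.concat_eq_append, rWord_append, rWord_cons, rCreate]
    simp only [rWord, List.map_nil, List.reverse_nil, List.prod_nil, one_mul]
    rw [← rCreate, ← rWord, rCreate, create_mul_apply, ih]
    set c := σ (Fin.last m)
    set τ : Fin m → I := fun i => σ i.castSucc with hτ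
    have himg : Finset.univ.image σ = insert c (Finset.univ.image τ) := by
      ext x
      simp only [Finset.mem_image, Finset.mem_univ, true_and, Finset.mem_insert]
      constructor
      · rintro ⟨i, rfl⟩
        refine Fin.lastCases (.inl rfl) (fun j => .inr ⟨j, rfl⟩) i
      · rintro (rfl | ⟨j, rfl⟩)
        · exact ⟨_, rfl⟩
        · exact ⟨_, rfl⟩
    have hinj : Function.Injective σ ↔ Function.Injective τ ∧ c ∉ Finset.univ.image τ := by
      constructor
      · intro h
        refine ⟨h.comp (Fin.castSucc_injective m), ?_⟩
        simp only [Finset.mem_image, Finset.mem_univ, true_and, not_exists]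
        intro j hj
        exact (Fin.castSucc_lt_last j).ne (h hj)
      · rintro ⟨h, hc⟩
        simp only [Finset.mem_image, Finset.mem_univ, true_and, not_exists] at hc
        intro i j
        refine Fin.lastCases ?_ (fun i => ?_) i <;> refine Fin.lastCases ?_ (fun j => ?_) j
        · intro _; rfl
        · intro h'; exact absurd h'.symm (hc j)
        · intro h'; exact absurd h' (hc i)
        · intro h'; exact congrArg _ (h h')
    by_cases hc : c ∈ K
    · rw [if_pos hc]
      by_cases hK : Function.Injective τ ∧ K.erase c = Finset.univ.image τ
      · rw [if_pos hK, if_pos, wordCoeff_succ, mul_comm, hK.2]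
        · congr 1
          exact Finset.prod_image fun i _ j _ h => hK.1 h
        · rw [hinj, himg, ← hK.2, Finset.insert_erase hc]
          exact ⟨⟨hK.1, Finset.notMem_erase c K⟩, rfl⟩
      · rw [if_neg hK, mul_zero, if_neg]
        rintro ⟨h1, h2⟩
        rw [hinj] at h1
        exact hK ⟨h1.1, by rw [h2, himg, Finset.erase_insert h1.2]⟩
    · rw [if_neg hc, if_neg]
      rintro ⟨-, h2⟩
      exact hc (by rw [h2, himg]; exact Finset.mem_insert_self _ _)

lemma prod_wLt_eq (q : F) (N : ℕ) :
    ∏ c : Fin N, wLt (Fin N) q c = ∏ i ∈ Finset.range N, q ^ (2 * i) := by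
  rw [← Fin.prod_univ_eq_prod_range (fun i => q ^ (2 * i))]
  refine Finset.prod_congr rfl fun c _ => ?_
  have : Finset.univ.filter (· < c) = Finset.Iio c := by ext; simp
  rw [wLt, this, Fin.card_Iio]

lemma sum_cons {M : Type*} [AddCommMonoid M] {n : ℕ} (f : (Fin (n + 1) → I) → M) :
    ∑ b, f b = ∑ x, ∑ c : Fin n → I, f (Fin.cons x c) := by
  rw [← Fintype.sum_prod_type']
  exact (Fintype.sum_equiv (Fin.consEquiv fun _ => I) _ _ fun x => rfl).symm

lemma sum_append {M : Type*} [AddCommMonoid M] {m n : ℕ} (f : (Fin (m + n) → I) → M) :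
    ∑ b, f b = ∑ c : Fin m → I, ∑ d : Fin n → I, f (Fin.append c d) := by
  rw [← Fintype.sum_prod_type']
  exact (Fintype.sum_equiv (Fin.appendEquiv m n) _ _ fun x => rfl).symm

lemma rAnnih_mul_gradeMat_mul_rCreate (hp : IsParam q p) (k : ℕ) :
    ∑ c, rAnnih p c * gradeMat (wLt I q) (k + 1) * rCreate p c =
      (q ^ (2 * k) * qInt q (Fintype.card I - k)) • gradeMat (wLt I q) k := by
  have h1 : ∀ c, rAnnih p c * gradeMat (wLt I q) (k + 1) * rCreate p c =
      wLt I q c • (rAnnih p c * rCreate p c) * gradeMat (wLt I q) k := by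
    intro c
    rw [gradeMat_eq, mul_assoc, mul_assoc, rCreate, weightMat_mul_create, Matrix.mul_smul,
      ← mul_assoc (degMat I _), degMat_mul_create, gradeMat_eq]
    simp only [Nat.add_right_cancel_iff, mul_assoc, Matrix.mul_smul, Matrix.smul_mul]
  rw [Finset.sum_congr rfl fun c _ => h1 c, ← Finset.sum_mul, sum_rAnnih_mul_rCreate hp,
    gradeMat_eq, ← mul_assoc, degMat_mul_degMat, ← Matrix.smul_mul]
  congr 1
  rw [degMat, degMat, ← Matrix.diagonal_smul]
  congr 1; ext J
  by_cases hJ : J.card = k <;> simp [hJ]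

lemma rCreate_mul_degMat_mul_rAnnih (hp : IsParam q p) (k : ℕ) :
    ∑ c, rCreate p c * (degMat I fun n => if n = k then 1 else 0) * rAnnih p c =
      qInt q (k + 1) • degMat I fun n => if n = k + 1 then 1 else 0 := by
  have h1 : ∀ c, rCreate p c * (degMat I fun n => if n = k then 1 else 0) * rAnnih p c =
      (degMat I fun n => if n = k + 1 then 1 else 0) * (rCreate p c * rAnnih p c) := by
    intro c
    rw [← mul_assoc, rCreate, degMat_mul_create]
    simp only [Nat.add_right_cancel_iff]
  rw [Finset.sum_congr rfl fun c _ => h1 c, ← Finset.mul_sum, sum_rCreate_mul_rAnnih hp,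
    degMat_mul_degMat, degMat, degMat, ← Matrix.diagonal_smul]
  congr 1; ext J
  by_cases hJ : J.card = k + 1 <;> simp [hJ]

/-- Contracting `m` indices lowers the degree of a weighted projection by `m`. -/
lemma sum_aWord_mul_mul_rWord (hp : IsParam q p) (m k : ℕ) :
    ∑ d : Fin m → I, aWord p (List.ofFn d) * gradeMat (wLt I q) (k + m) * rWord p (List.ofFn d) =
      (∏ i ∈ Finset.range m, q ^ (2 * (k + i)) * qInt q (Fintype.card I - (k + i))) •
        gradeMat (wLt I q) k := by
  induction m generalizing k with
  | zero => simp [aWord, rWord]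
  | succ m ih =>
    rw [sum_cons]
    have h1 : ∀ x, ∑ d : Fin m → I, aWord p (List.ofFn (Fin.cons x d : Fin (m + 1) → I)) *
        gradeMat (wLt I q) (k + (m + 1)) * rWord p (List.ofFn (Fin.cons x d : Fin (m + 1) → I)) =
        rAnnih p x * (∑ d : Fin m → I, aWord p (List.ofFn d) * gradeMat (wLt I q) (k + 1 + m) *
          rWord p (List.ofFn d)) * rCreate p x := by
      intro x
      rw [Finset.mul_sum, Finset.sum_mul, show k + (m + 1) = k + 1 + m by ring]
      refine Finset.sum_congr rfl fun d _ => ?_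
      rw [List.ofFn_cons, aWord_cons, rWord_cons]
      simp only [mul_assoc]
    rw [Finset.sum_congr rfl fun x _ => h1 x, ih (k + 1)]
    simp only [Matrix.mul_smul, Matrix.smul_mul, ← Finset.smul_sum]
    rw [rAnnih_mul_gradeMat_mul_rCreate hp, smul_smul, Finset.prod_range_succ']
    simp only [add_zero, add_assoc, add_comm 1]

/-- Restoring `m` contracted indices raises the degree of a projection by `m`. -/
lemma sum_rWord_mul_mul_aWord (hp : IsParam q p) (m k : ℕ) :
    ∑ d : Fin m → I, rWord p (List.ofFn d) * (degMat I fun n => if n = k then 1 else 0) *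
        aWord p (List.ofFn d) =
      (∏ i ∈ Finset.range m, qInt q (k + i + 1)) • degMat I fun n => if n = k + m then 1 else 0 := by
  induction m generalizing k with
  | zero => simp [aWord, rWord]
  | succ m ih =>
    rw [sum_cons, Finset.sum_comm]
    have h1 : ∀ d : Fin m → I, ∑ x, rWord p (List.ofFn (Fin.cons x d : Fin (m + 1) → I)) *
        (degMat I fun n => if n = k then 1 else 0) *
          aWord p (List.ofFn (Fin.cons x d : Fin (m + 1) → I)) =
        rWord p (List.ofFn d) * (∑ x, rCreate p x * (degMat I fun n => if n = k then 1 else 0) *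
          rAnnih p x) * aWord p (List.ofFn d) := by
      intro d
      rw [Finset.mul_sum, Finset.sum_mul]
      refine Finset.sum_congr rfl fun x _ => ?_
      rw [List.ofFn_cons, aWord_cons, rWord_cons]
      simp only [mul_assoc]
    rw [Finset.sum_congr rfl fun d _ => h1 d, rCreate_mul_degMat_mul_rAnnih hp]
    simp only [Matrix.mul_smul, Matrix.smul_mul, ← Finset.smul_sum]
    rw [ih (k + 1), smul_smul, Finset.prod_range_succ', mul_comm]
    simp only [add_zero, add_assoc, add_comm 1]

end Words

/-! ### The relations of the algebra, entry by entry -/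

section Entries

variable {N : ℕ}

/-- The parameters `q_ij`, as a function of two indices. -/
def paramQ (N : ℕ) (i j : Fin N) : ParamField N := QQ i j

/-- The entries of `X`, as a function of two indices. -/
def entryX (N : ℕ) (i j : Fin N) : OqR N := matX N i j

/-- The entries of `Y`, as a function of two indices. -/
def entryY (N : ℕ) (i j : Fin N) : OqR N := matY N i j

/-- The specialization of all parameters to `1` sends a `q`-integer to a nonzero number. -/
lemma qInt_qq_ne_zero (N n : ℕ) : qInt (qq N) (n + 1) ≠ 0 := by
  have h1 : qInt (qq N) (n + 1) = algebraMap (ParamPoly N) (ParamField N)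
      (∑ k ∈ Finset.range (n + 1), MvPolynomial.X none ^ (2 * k)) := by
    rw [map_sum, qInt]
    exact Finset.sum_congr rfl fun k _ => by rw [map_pow]; rfl
  rw [h1]
  intro h
  have h2 := (map_eq_zero_iff _ (IsFractionRing.injective (ParamPoly N) (ParamField N))).1 h
  have h3 := congrArg (MvPolynomial.eval fun _ => (1 : ℂ)) h2
  simp only [map_sum, map_pow, MvPolynomial.eval_X, one_pow, Finset.sum_const, Finset.card_range,
    map_zero, nsmul_eq_mul, mul_one] at h3
  exact Nat.succ_ne_zero n (Nat.cast_eq_zero.1 h3)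

lemma isParam_paramQ (N : ℕ) : IsParam (qq N) (paramQ N) where
  ne_zero := param_ne_zero none
  diag := QQ_self
  qInt_ne_zero := qInt_qq_ne_zero N
  mul_swap := QQ_mul_QQ

lemma scal_RMat_mul_apply (M : Matrix (Fin N × Fin N) (Fin N × Fin N) (OqR N))
    (a b : Fin N) (e : Fin N × Fin N) : (scal (OqR N) (RMat N) * M) (a, b) e =
      paramQ N a b • M (a, b) e + if a < b then (1 - qq N ^ 2) • M (b, a) e else 0 := by
  simp only [Matrix.mul_apply, scal, Matrix.map_apply, RMat_apply, map_add, add_mul,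
    Finset.sum_add_distrib]
  congr 1
  · rw [Finset.sum_eq_single (a, b)]
    · rw [if_pos rfl, Algebra.smul_def]; rfl
    · intro e' _ he'; rw [if_neg he'.symm, map_zero, zero_mul]
    · simp
  · rw [Finset.sum_eq_single (b, a)]
    · by_cases h : a < b <;> simp [h, Algebra.smul_def]
    · intro e' _ he'; rw [if_neg, map_zero, zero_mul]; exact fun h => he' h.2
    · simp

lemma mul_scal_RMat_apply (M : Matrix (Fin N × Fin N) (Fin N × Fin N) (OqR N))
    (c d : Fin N) (e : Fin N × Fin N) : (M * scal (OqR N) (RMat N)) e (c, d) =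
      paramQ N c d • M e (c, d) + if d < c then (1 - qq N ^ 2) • M e (d, c) else 0 := by
  simp only [Matrix.mul_apply, scal, Matrix.map_apply, RMat_apply, map_add, mul_add,
    Finset.sum_add_distrib]
  congr 1
  · rw [Finset.sum_eq_single (c, d)]
    · rw [if_pos rfl, Algebra.smul_def, ← Algebra.commutes]; rfl
    · intro e' _ he'; rw [if_neg he', map_zero, mul_zero]
    · simp
  · rw [Finset.sum_eq_single (d, c)]
    · rw [Algebra.smul_def, Algebra.commutes]
      by_cases h : d < c <;> simp [h]
    · intro e' _ he'
      rw [if_neg, map_zero, mul_zero]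
      intro h
      exact he' (by rw [← Prod.swap_swap e', ← h.2]; rfl)
    · simp

lemma leg₁_mul_apply (M : Matrix (Fin N) (Fin N) (OqR N))
    (B : Matrix (Fin N × Fin N) (Fin N × Fin N) (OqR N)) (a b : Fin N) (e : Fin N × Fin N) :
    (leg₁ M * B) (a, b) e = ∑ s, M a s * B (s, b) e := by
  rw [Matrix.mul_apply, Fintype.sum_prod_type]
  refine Finset.sum_congr rfl fun s _ => ?_
  rw [Finset.sum_eq_single b] <;> simp +contextual [leg₁, Matrix.one_apply, eq_comm]

lemma leg₂_mul_apply (M : Matrix (Fin N) (Fin N) (OqR N))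
    (B : Matrix (Fin N × Fin N) (Fin N × Fin N) (OqR N)) (a b : Fin N) (e : Fin N × Fin N) :
    (leg₂ M * B) (a, b) e = ∑ s, M b s * B (a, s) e := by
  rw [Matrix.mul_apply, Fintype.sum_prod_type, Finset.sum_comm]
  refine Finset.sum_congr rfl fun s _ => ?_
  rw [Finset.sum_eq_single a] <;> simp +contextual [leg₂, Matrix.one_apply, eq_comm]

lemma leg₁_apply (M : Matrix (Fin N) (Fin N) (OqR N)) (a b c d : Fin N) :
    leg₁ M (a, b) (c, d) = if b = d then M a c else 0 := by
  simp [leg₁, Matrix.one_apply]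

lemma leg₂_apply (M : Matrix (Fin N) (Fin N) (OqR N)) (a b c d : Fin N) :
    leg₂ M (a, b) (c, d) = if a = c then M b d else 0 := by
  simp [leg₂, Matrix.one_apply]

lemma leg₁_mul_leg₂_apply (M M' : Matrix (Fin N) (Fin N) (OqR N)) (a b c d : Fin N) :
    (leg₁ M * leg₂ M') (a, b) (c, d) = M a c * M' b d := by
  rw [leg₁_mul_apply, Finset.sum_eq_single c] <;>
    simp +contextual [leg₂, Matrix.one_apply]

lemma leg₂_mul_leg₁_apply (M M' : Matrix (Fin N) (Fin N) (OqR N)) (a b c d : Fin N) :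
    (leg₂ M * leg₁ M') (a, b) (c, d) = M b d * M' a c := by
  rw [leg₂_mul_apply, Finset.sum_eq_single d] <;>
    simp +contextual [leg₁, Matrix.one_apply]

/-- The defining relations of the algebra, read entry by entry. -/
lemma qsystem (N : ℕ) : QSystem (qq N) (paramQ N) (entryX N) (entryY N) where
  param := isParam_paramQ N
  X_rel := ⟨fun a b c d => by
    have := congrFun (congrFun (rel_XX N) (a, b)) (c, d)
    rw [mul_assoc, scal_RMat_mul_apply, mul_scal_RMat_apply] at this
    simp only [leg₁_mul_leg₂_apply, leg₂_mul_leg₁_apply] at this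
    exact this⟩
  Y_rel a b c d := by
    have := congrFun (congrFun (rel_YY N) (a, b)) (c, d)
    rw [mul_assoc, scal_RMat_mul_apply, mul_scal_RMat_apply] at this
    simp only [leg₁_mul_leg₂_apply, leg₂_mul_leg₁_apply] at this
    exact this
  cross a b c d := by
    have := congrFun (congrFun (rel_XY N) (a, b)) (c, d)
    rw [mul_assoc, mul_assoc, leg₁_mul_apply, leg₂_mul_apply] at this
    simp only [scal_RMat_mul_apply, mul_add, Finset.sum_add_distrib, mul_ite, mul_zero,
      mul_smul_comm, leg₁_apply, leg₂_apply, smul_ite, smul_zero, Finset.sum_ite_eq',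
      Finset.mem_univ, if_true] at this
    have h1 : ∑ s, (if s < b then (if b = c then (1 - qq N ^ 2) • (matX N a s * matY N s d) else 0)
        else 0) = if b = c then (1 - qq N ^ 2) • ∑ s with s < b, matX N a s * matY N s d
          else 0 := by
      by_cases hbc : b = c <;> simp [hbc, Finset.sum_filter, Finset.smul_sum]
    have h2 : ∑ s, (if a < s then (if a = d then (1 - qq N ^ 2) • (matY N b s * matX N s c) else 0)
        else 0) = if a = d then (1 - qq N ^ 2) • ∑ s with a < s, matY N b s * matX N s c
          else 0 := by
      by_cases had : a = d <;> simp [had, Finset.sum_filter, Finset.smul_sum]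
    rw [h1, h2] at this
    exact this

end Entries

/-! ### The braiding of the legs and the Levi-Civita tensor -/

section Tensors

variable {N : ℕ}

lemma flipMat_apply (a b : Fin N × Fin N) : flipMat N a b = if b = a.swap then 1 else 0 := by
  obtain ⟨a1, a2⟩ := a
  obtain ⟨b1, b2⟩ := b
  simp only [flipMat, Matrix.sum_apply, Matrix.kroneckerMap_apply]
  rw [Finset.sum_eq_single a1 (by intro c _ hc; simp [Matrix.single_apply, hc]) (by simp),
    Finset.sum_eq_single a2 (by intro c _ hc; simp [Matrix.single_apply, hc]) (by simp)]
  by_cases h1 : a2 = b1 <;> by_cases h2 : a1 = b2 <;> simp_all [eq_comm]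

lemma RHat_apply (a b : Fin N) (e : Fin N × Fin N) : RHat N (a, b) e = RMat N (b, a) e := by
  rw [RHat, Matrix.mul_apply, Finset.sum_eq_single (b, a)]
  · simp [flipMat_apply]
  · intro c _ hc; rw [flipMat_apply, if_neg (by exact hc), zero_mul]
  · simp

lemma scal_flipMat_mul_apply (M : Matrix (Fin N × Fin N) (Fin N × Fin N) (OqR N))
    (a e : Fin N × Fin N) : (scal (OqR N) (flipMat N) * M) a e = M a.swap e := by
  rw [Matrix.mul_apply, Finset.sum_eq_single a.swap]
  · simp [scal, flipMat_apply]
  · intro c _ hc; rw [scal, Matrix.map_apply, flipMat_apply, if_neg hc, map_zero, zero_mul]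
  · simp

lemma mul_scal_flipMat_apply (M : Matrix (Fin N × Fin N) (Fin N × Fin N) (OqR N))
    (a e : Fin N × Fin N) : (M * scal (OqR N) (flipMat N)) e a = M e a.swap := by
  rw [Matrix.mul_apply, Finset.sum_eq_single a.swap]
  · simp [scal, flipMat_apply]
  · intro c _ hc
    rw [scal, Matrix.map_apply, flipMat_apply, if_neg, map_zero, mul_zero]
    rintro rfl; exact hc (Prod.swap_swap c).symm
  · simp

lemma scal_flipMat_mul_leg₁ (M : Matrix (Fin N) (Fin N) (OqR N)) :
    scal (OqR N) (flipMat N) * leg₁ M = leg₂ M * scal (OqR N) (flipMat N) := by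
  ext ⟨a, b⟩ ⟨c, d⟩
  rw [scal_flipMat_mul_apply, mul_scal_flipMat_apply, Prod.swap_prod_mk, Prod.swap_prod_mk,
    leg₁_apply, leg₂_apply]

lemma scal_flipMat_mul_leg₂ (M : Matrix (Fin N) (Fin N) (OqR N)) :
    scal (OqR N) (flipMat N) * leg₂ M = leg₁ M * scal (OqR N) (flipMat N) := by
  ext ⟨a, b⟩ ⟨c, d⟩
  rw [scal_flipMat_mul_apply, mul_scal_flipMat_apply, Prod.swap_prod_mk, Prod.swap_prod_mk,
    leg₁_apply, leg₂_apply]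

lemma scal_RHat : scal (OqR N) (RHat N) = scal (OqR N) (flipMat N) * scal (OqR N) (RMat N) := by
  rw [scal, RHat, Matrix.map_mul]; rfl

/-- `Y₁ R̂ X₁ = X₂ R̂ Y₂`. -/
lemma leg_Y_RHat_X : leg₁ (matY N) * scal (OqR N) (RHat N) * leg₁ (matX N) =
    leg₂ (matX N) * scal (OqR N) (RHat N) * leg₂ (matY N) := by
  rw [scal_RHat, ← mul_assoc, ← mul_assoc, ← scal_flipMat_mul_leg₂, ← scal_flipMat_mul_leg₁,
    mul_assoc, mul_assoc, ← mul_assoc (leg₂ _), ← rel_XY]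
  simp only [mul_assoc]

/-- `R̂ Y₂ Y₁ = Y₂ Y₁ R̂`. -/
lemma RHat_YY : scal (OqR N) (RHat N) * (leg₂ (matY N) * leg₁ (matY N)) =
    leg₂ (matY N) * leg₁ (matY N) * scal (OqR N) (RHat N) := by
  rw [scal_RHat, mul_assoc, ← mul_assoc (scal _ _) (leg₂ _), rel_YY, mul_assoc, ← mul_assoc,
    scal_flipMat_mul_leg₁, mul_assoc, ← mul_assoc (scal _ _) (leg₂ _), scal_flipMat_mul_leg₂]
  simp only [mul_assoc]

/-- The matrix `X` in the leg `i`. -/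
def xLeg (N i : ℕ) : Matrix (Fin N → Fin N) (Fin N → Fin N) (OqR N) :=
  if h : i < N then atLeg ⟨i, h⟩ (matX N) else 1

/-- The matrix `Y` in the leg `i`. -/
def yLeg (N i : ℕ) : Matrix (Fin N → Fin N) (Fin N → Fin N) (OqR N) :=
  if h : i < N then atLeg ⟨i, h⟩ (matY N) else 1

/-- The matrix `R̂` in the legs `i` and `i + 1`. -/
def rLegs (N i : ℕ) : Matrix (Fin N → Fin N) (Fin N → Fin N) (OqR N) :=
  if h : i + 1 < N then atLegs ⟨i, by omega⟩ ⟨i + 1, h⟩ (scal (OqR N) (RHat N)) else 1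

lemma scal_commute (T : Matrix (Fin N × Fin N) (Fin N × Fin N) (ParamField N))
    (e e' : Fin N × Fin N) (s : OqR N) : Commute (scal (OqR N) T e e') s :=
  Algebra.commutes (T e e') s

lemma braidRelations (N : ℕ) : BraidRelations N (xLeg N) (yLeg N) (rLegs N) where
  exchange i hi := by
    have hne : (⟨i, by omega⟩ : Fin N) ≠ ⟨i + 1, hi⟩ := by simp
    rw [yLeg, yLeg, rLegs, xLeg, xLeg, dif_pos (by omega), dif_pos hi, dif_pos (by omega),
      dif_pos hi, dif_pos hi, ← atLegs_leg₁ hne, ← atLegs_leg₁ hne, ← atLegs_leg₂ hne,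
      ← atLegs_leg₂ hne, atLegs_mul hne, atLegs_mul hne, atLegs_mul hne, atLegs_mul hne,
      leg_Y_RHat_X]
  yy i hi := by
    have hne : (⟨i, by omega⟩ : Fin N) ≠ ⟨i + 1, hi⟩ := by simp
    rw [yLeg, yLeg, rLegs, dif_pos (by omega), dif_pos (by omega), dif_pos (by omega),
      ← atLegs_leg₁ hne, ← atLegs_leg₂ hne, Commute, SemiconjBy, atLegs_mul hne, atLegs_mul hne,
      atLegs_mul hne, RHat_YY]
  commute_x i j hi hj hij hij' := by
    rw [xLeg, rLegs, dif_pos hi, dif_pos hj]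
    exact atLegs_commute_atLeg (k := ⟨i, by omega⟩) (l := ⟨i + 1, hi⟩) (j := ⟨j, hj⟩)
      (fun h => hij (congrArg Fin.val h)) (fun h => hij' (congrArg Fin.val h))
      (scal (OqR N) (RHat N)) (scal_commute _) _
  commute_y i j hi hj hij hij' := by
    rw [yLeg, rLegs, dif_pos hi, dif_pos hj]
    exact atLegs_commute_atLeg (k := ⟨i, by omega⟩) (l := ⟨i + 1, hi⟩) (j := ⟨j, hj⟩)
      (fun h => hij (congrArg Fin.val h)) (fun h => hij' (congrArg Fin.val h))
      (scal (OqR N) (RHat N)) (scal_commute _) _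

lemma chain_eq {k : ℕ} (h1 : 1 ≤ k) (hk : k ≤ N) :
    chain k h1 hk = xLeg N 0 * yLeg N 0 * upProd (rLegs N) (k - 1) := by
  rw [chain, xLeg, yLeg, dif_pos (by omega), dif_pos (by omega), atLeg_mul]
  congr 1
  refine prod_ofFn_eq_upProd _ _ fun m => ?_
  rw [rLegs, dif_pos (by omega)]

section Lists

variable {α : Type*} {n : ℕ}

lemma take_ofFn_congr {a b : Fin n → α} {m : ℕ} (h : ∀ j : Fin n, (j : ℕ) < m → a j = b j) :
    (List.ofFn a).take m = (List.ofFn b).take m := by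
  refine List.ext_getElem (by simp) fun i h1 h2 => ?_
  simp only [List.length_take, List.length_ofFn, lt_inf_iff] at h1
  simpa using h ⟨i, h1.2⟩ h1.1

lemma drop_ofFn_congr {a b : Fin n → α} {m : ℕ} (h : ∀ j : Fin n, m ≤ (j : ℕ) → a j = b j) :
    (List.ofFn a).drop m = (List.ofFn b).drop m := by
  refine List.ext_getElem (by simp) fun i h1 h2 => ?_
  simp only [List.length_drop, List.length_ofFn] at h1
  simpa using h ⟨m + i, by omega⟩ (by simp)

lemma drop_ofFn_eq_cons (a : Fin n → α) (j : Fin n) :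
    (List.ofFn a).drop j = a j :: (List.ofFn a).drop (j + 1) := by
  rw [List.drop_eq_getElem_cons (by simp)]
  simp

lemma take_succ_ofFn (a : Fin n → α) (j : Fin n) :
    (List.ofFn a).take (j + 1) = (List.ofFn a).take j ++ [a j] := by
  rw [List.take_add_one]
  simp

end Lists

lemma negqC_eq_wordCoeff {m : ℕ} (σ : Fin m → Fin N) : negqC σ = wordCoeff (paramQ N) σ := rfl

/-- The Levi-Civita tensor consists of the top coefficients of the words. -/
lemma uVec_eq (a : Fin N → Fin N) :
    uVec N a = rWord (fun i j => paramQ N j i) (List.ofFn a) Finset.univ ∅ := by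
  rw [rWord_ofFn_apply_empty, uVec, Finset.sum_apply]
  simp only [Pi.smul_apply, Pi.single_apply, smul_eq_mul, mul_ite, mul_one, mul_zero]
  split_ifs with h
  · have hb : Function.Bijective a := Finite.injective_iff_bijective.1 h.1
    rw [Finset.sum_eq_single (Equiv.ofBijective a hb)]
    · exact if_pos rfl
    · intro σ _ hσ
      rw [if_neg]
      rintro rfl
      exact hσ (Equiv.ext fun i => rfl)
    · simp
  · refine Finset.sum_eq_zero fun σ _ => if_neg ?_
    rintro rfl
    exact h ⟨σ.injective, (Finset.image_univ_of_surjective σ.surjective).symm⟩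

lemma conjTranspose_rCreate (c : Fin N) :
    (rCreate (fun i j => paramQ N j i) c)ᴴ = rAnnih (fun i j => paramQ N j i) c := by
  ext J K
  rw [Matrix.conjTranspose_apply, rCreate, rAnnih, create, annih, Matrix.of_apply, Matrix.of_apply,
    apply_ite star, star_zero, star_prod]
  refine if_congr Iff.rfl (Finset.prod_congr rfl fun k _ => ?_) rfl
  rw [apply_ite star, star_neg, star_one, paramQ, paramQ, star_QQ]

/-- The dual Levi-Civita tensor is obtained from the adjoint operators. -/
lemma vVec_eq (a : Fin N → Fin N) :
    vVec N a = aWord (fun i j => paramQ N j i) (List.ofFn a) ∅ Finset.univ := by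
  have : (rWord (fun i j => paramQ N j i) (List.ofFn a))ᴴ =
      aWord (fun i j => paramQ N j i) (List.ofFn a) := by
    rw [rWord, Matrix.conjTranspose_list_prod, List.map_reverse, List.reverse_reverse, List.map_map,
      aWord]
    congr 2
    funext c
    exact conjTranspose_rCreate c
  rw [vVec, Pi.star_apply, uVec_eq, ← this, Matrix.conjTranspose_apply]

lemma rCreate_mul_rCreate {I F : Type*} [LinearOrder I] [Fintype I] [Field F] {p : I → I → F}
    {a b : I} (h : a < b) : rCreate p a * rCreate p b = -p b a • (rCreate p b * rCreate p a) := by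
  have := create_mul_create (f := fun c k => if c < k then -p k c else 1)
    (g := fun c k => if c < k then -p k c else 1) h.ne (u := 1) (v := -p b a)
    (by simp [h, h.not_gt])
  simpa [rCreate] using this

/-- The right multiplications are antisymmetric with respect to the braiding. -/
lemma rCreate_braid {I F : Type*} [LinearOrder I] [Fintype I] [Field F] {q : F} {p : I → I → F}
    (hp : IsParam q p) (a b : I) :
    p a b • (rCreate p a * rCreate p b) +
      (if b < a then (1 - q ^ 2) • (rCreate p b * rCreate p a) else 0) =
        -q ^ 2 • (rCreate p b * rCreate p a) := by
  rcases lt_trichotomy a b with h | rfl | h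
  · rw [if_neg h.not_gt, rCreate_mul_rCreate h, smul_smul, mul_neg, hp.mul_swap h.ne, add_zero]
  · simp [rCreate, create_mul_create_self]
  · rw [if_pos h, rCreate_mul_rCreate h, smul_smul, smul_smul, ← add_smul]
    congr 1; ring

/-- The Levi-Civita tensor is an eigenvector of `R̂`. -/
lemma sum_RHat_uVec (a : Fin N → Fin N) {i : ℕ} (hi : i + 1 < N) :
    ∑ e : Fin N × Fin N, RHat N (a ⟨i, by omega⟩, a ⟨i + 1, hi⟩) e *
      uVec N (Function.update (Function.update a ⟨i, by omega⟩ e.1) ⟨i + 1, hi⟩ e.2) =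
      -qq N ^ 2 * uVec N a := by
  set k : Fin N := ⟨i, by omega⟩ with hk
  set l : Fin N := ⟨i + 1, hi⟩ with hl
  have hkl : k ≠ l := by simp [hk, hl]
  have hkv : (k : ℕ) = i := rfl
  have hlv : (l : ℕ) = i + 1 := rfl
  -- In the word of a tensor that differs from `a` only in the legs `i` and `i + 1`, only the product
  -- of the two neighbouring right multiplications changes.
  have hsplit : ∀ b : Fin N → Fin N, (∀ m, m ≠ k → m ≠ l → b m = a m) →
      uVec N b = (rWord (fun i j => paramQ N j i) ((List.ofFn a).drop (i + 2)) *
        (rCreate (fun i j => paramQ N j i) (b l) * rCreate (fun i j => paramQ N j i) (b k)) *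
          rWord (fun i j => paramQ N j i) ((List.ofFn a).take i)) Finset.univ ∅ := by
    intro b hb
    have h1 : List.ofFn b = (List.ofFn a).take i ++ b k :: b l :: (List.ofFn a).drop (i + 2) := by
      rw [← List.take_append_drop i (List.ofFn b)]
      congr 1
      · exact take_ofFn_congr fun j hj => hb j
          (fun h => by rw [h] at hj; omega) (fun h => by rw [h] at hj; omega)
      · rw [drop_ofFn_eq_cons b k]
        congr 1
        rw [drop_ofFn_eq_cons b l]
        congr 1
        exact drop_ofFn_congr fun j hj => hb j
          (fun h => by rw [h] at hj; omega) (fun h => by rw [h] at hj; omega)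
    rw [uVec_eq, h1, rWord_append, rWord_cons, rWord_cons]
    simp only [mul_assoc]
  have hp := (isParam_paramQ N).swap
  simp only [RHat_apply, RMat_apply, add_mul, Finset.sum_add_distrib]
  rw [Finset.sum_eq_single (a l, a k) (by intro e _ he; rw [if_neg he.symm, zero_mul]) (by simp),
    Finset.sum_eq_single (a k, a l) (by intro e _ he; rw [if_neg (fun h => he h.2), zero_mul])
      (by simp), if_pos rfl]
  have h2 := rCreate_braid hp (a k) (a l)
  have h3 := congrArg (fun M => (rWord (fun i j => paramQ N j i) ((List.ofFn a).drop (i + 2)) * M *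
    rWord (fun i j => paramQ N j i) ((List.ofFn a).take i)) Finset.univ ∅) h2
  simp only [mul_add, add_mul, Matrix.mul_smul, Matrix.smul_mul, Matrix.add_apply,
    Matrix.smul_apply, smul_eq_mul] at h3
  rw [hsplit _ fun m hmk hml => by rw [Function.update_of_ne hml, Function.update_of_ne hmk],
    hsplit _ fun m hmk hml => by rw [Function.update_of_ne hml, Function.update_of_ne hmk],
    hsplit a fun m _ _ => rfl]
  simp only [Function.update_self, Function.update_of_ne hkl]
  rw [← h3]
  congr 1
  by_cases h : a l < a k
  · simp [h]
  · simp [h]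

end Tensors

/-! ### Evaluation of the coefficients on the Levi-Civita tensor -/

section Sigma

variable {N : ℕ}

/-- The Levi-Civita tensor, as a matrix with constant rows. -/
def uMat (N : ℕ) : Matrix (Fin N → Fin N) (Fin N → Fin N) (OqR N) :=
  Matrix.of fun a _ => algebraMap (ParamField N) (OqR N) (uVec N a)

/-- The dual Levi-Civita tensor, as a matrix with constant columns. -/
def vMat (N : ℕ) : Matrix (Fin N → Fin N) (Fin N → Fin N) (OqR N) :=
  Matrix.of fun _ a => algebraMap (ParamField N) (OqR N) (vVec N a)

lemma rLegs_mul_uMat {i : ℕ} (hi : i + 1 < N) :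
    rLegs N i * uMat N = (-qq N ^ 2) • uMat N := by
  ext a b
  have hne : (⟨i, by omega⟩ : Fin N) ≠ ⟨i + 1, hi⟩ := by simp
  have h1 : (rLegs N i * uMat N) a b = ∑ e : Fin N × Fin N,
      algebraMap (ParamField N) (OqR N) (RHat N (a ⟨i, by omega⟩, a ⟨i + 1, hi⟩) e) *
        algebraMap (ParamField N) (OqR N)
          (uVec N (Function.update (Function.update a ⟨i, by omega⟩ e.1) ⟨i + 1, hi⟩ e.2)) := by
    rw [rLegs, dif_pos hi]
    exact sum_atLegs_mul hne (scal (OqR N) (RHat N)) a fun b =>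
      algebraMap (ParamField N) (OqR N) (uVec N b)
  rw [h1]
  simp only [← map_mul, ← map_sum]
  rw [sum_RHat_uVec a hi, map_mul, ← Algebra.smul_def]
  rfl

lemma minorsY_apply_empty (J : Finset (Fin N)) :
    minorsY (paramQ N) (entryY N) J ∅ = if J = ∅ then 1 else 0 := by
  split_ifs with h
  · rw [h, minorsY_empty, if_pos rfl]
  · exact minorsY_eq_zero (qsystem N) (by simpa using h)

lemma mul_minorsY_apply_empty (M : Matrix (Finset (Fin N)) (Finset (Fin N)) (OqR N))
    (J : Finset (Fin N)) : (M * minorsY (paramQ N) (entryY N)) J ∅ = M J ∅ := by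
  rw [Matrix.mul_apply, Finset.sum_eq_single ∅]
  · rw [minorsY_apply_empty, if_pos rfl, mul_one]
  · intro K _ hK; rw [minorsY_apply_empty, if_neg hK, mul_zero]
  · simp

lemma minorsX_mul_apply_empty (M : Matrix (Finset (Fin N)) (Finset (Fin N)) (OqR N))
    (J : Finset (Fin N)) : (minorsX (paramQ N) (entryX N) * M) ∅ J = M ∅ J := by
  rw [Matrix.mul_apply, Finset.sum_eq_single ∅]
  · rw [minorsX_empty, if_pos rfl, one_mul]
  · intro K _ hK; rw [minorsX_empty, if_neg hK, zero_mul]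
  · simp

/-- Applying `Y` to the first legs of the Levi-Civita tensor inserts the quantum minors of `Y` into
the words. -/
lemma downProd_yLeg_mul_uMat {j : ℕ} (hj : j ≤ N) (a b : Fin N → Fin N) :
    (downProd (yLeg N) j * uMat N) a b =
      (liftMat (OqR N) (rWord (fun i j => paramQ N j i) ((List.ofFn a).drop j)) *
        minorsY (paramQ N) (entryY N) *
          liftMat (OqR N) (rWord (fun i j => paramQ N j i) ((List.ofFn a).take j)))
        Finset.univ ∅ := by
  induction j generalizing a with
  | zero =>
    rw [downProd, one_mul, List.take_zero, List.drop_zero, uMat, Matrix.of_apply, uVec_eq]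
    have : rWord (fun i j => paramQ N j i) ([] : List (Fin N)) = 1 := rfl
    rw [this, map_one, mul_one, mul_minorsY_apply_empty]
    rfl
  | succ j ih =>
    have hjN : j < N := hj
    set jj : Fin N := ⟨j, hjN⟩ with hjj
    set D := rWord (fun i j => paramQ N j i) ((List.ofFn a).drop (j + 1)) with hD
    set T := rWord (fun i j => paramQ N j i) ((List.ofFn a).take j) with hT
    have h1 : (downProd (yLeg N) (j + 1) * uMat N) a b =
        ∑ s, entryY N (a jj) s *
          (downProd (yLeg N) j * uMat N) (Function.update a jj s) b := by
      rw [downProd, mul_assoc, yLeg, dif_pos hjN]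
      exact sum_atLeg_mul jj (matY N) a fun c => (downProd (yLeg N) j * uMat N) c b
    have h2 : ∀ s, (downProd (yLeg N) j * uMat N) (Function.update a jj s) b =
        (liftMat (OqR N) D * (liftMat (OqR N) (rCreate (fun i j => paramQ N j i) s) *
          minorsY (paramQ N) (entryY N)) * liftMat (OqR N) T) Finset.univ ∅ := by
      intro s
      have e1 : (List.ofFn (Function.update a jj s)).drop j =
          s :: (List.ofFn a).drop (j + 1) := by
        rw [show j = (jj : ℕ) from rfl, drop_ofFn_eq_cons, Function.update_self]
        congr 1
        exact drop_ofFn_congr fun i hi => Function.update_of_ne (fun h => by simp [h] at hi) _ _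
      have e2 : (List.ofFn (Function.update a jj s)).take j = (List.ofFn a).take j :=
        take_ofFn_congr fun i hi => Function.update_of_ne (fun h => by simp [h, hjj] at hi) _ _
      rw [ih (by omega), e1, e2, rWord_cons, map_mul, mul_assoc (liftMat (OqR N) D)]
    have h3 : (List.ofFn a).take (j + 1) = (List.ofFn a).take j ++ [a jj] :=
      take_succ_ofFn a jj
    have h4 : rWord (fun i j => paramQ N j i) [a jj] = rCreate (fun i j => paramQ N j i) (a jj) := by
      rw [rWord_cons]; exact one_mul _
    rw [h1, h3, rWord_append, map_mul, ← mul_assoc, mul_assoc (liftMat (OqR N) D), h4,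
      (qsystem N).minorsY_mul_rCreate, Finset.mul_sum, Finset.sum_mul, Matrix.sum_apply]
    refine Finset.sum_congr rfl fun s _ => ?_
    rw [h2, ← mul_assoc (liftMat (OqR N) D) (sc _), liftMat_mul_sc, mul_assoc (sc _),
      mul_assoc (sc _), sc_mul_apply]

/-- Applying `X` to the first legs of the dual Levi-Civita tensor inserts the quantum minors of `X`
into the words. -/
lemma vMat_mul_upProd_xLeg {j : ℕ} (hj : j ≤ N) (a b : Fin N → Fin N) :
    (vMat N * upProd (xLeg N) j) b a =
      (liftMat (OqR N) (aWord (fun i j => paramQ N j i) ((List.ofFn a).take j)) *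
        minorsX (paramQ N) (entryX N) *
          liftMat (OqR N) (aWord (fun i j => paramQ N j i) ((List.ofFn a).drop j)))
        ∅ Finset.univ := by
  induction j generalizing a with
  | zero =>
    rw [upProd, mul_one, List.take_zero, List.drop_zero, vMat, Matrix.of_apply, vVec_eq]
    have : aWord (fun i j => paramQ N j i) ([] : List (Fin N)) = 1 := rfl
    rw [this, map_one, one_mul, minorsX_mul_apply_empty]
    rfl
  | succ j ih =>
    have hjN : j < N := hj
    set jj : Fin N := ⟨j, hjN⟩ with hjj
    set D := aWord (fun i j => paramQ N j i) ((List.ofFn a).drop (j + 1)) with hD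
    set T := aWord (fun i j => paramQ N j i) ((List.ofFn a).take j) with hT
    have h1 : (vMat N * upProd (xLeg N) (j + 1)) b a =
        ∑ s, (vMat N * upProd (xLeg N) j) b (Function.update a jj s) * entryX N s (a jj) := by
      rw [upProd, ← mul_assoc, xLeg, dif_pos hjN]
      exact sum_mul_atLeg jj (matX N) a fun c => (vMat N * upProd (xLeg N) j) b c
    have h2 : ∀ s, (vMat N * upProd (xLeg N) j) b (Function.update a jj s) =
        (liftMat (OqR N) T * (minorsX (paramQ N) (entryX N) *
          liftMat (OqR N) (rAnnih (fun i j => paramQ N j i) s)) * liftMat (OqR N) D)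
          ∅ Finset.univ := by
      intro s
      have e1 : (List.ofFn (Function.update a jj s)).drop j =
          s :: (List.ofFn a).drop (j + 1) := by
        rw [show j = (jj : ℕ) from rfl, drop_ofFn_eq_cons, Function.update_self]
        congr 1
        exact drop_ofFn_congr fun i hi => Function.update_of_ne (fun h => by simp [h] at hi) _ _
      have e2 : (List.ofFn (Function.update a jj s)).take j = (List.ofFn a).take j :=
        take_ofFn_congr fun i hi => Function.update_of_ne (fun h => by simp [h, hjj] at hi) _ _
      rw [ih (by omega), e1, e2, aWord_cons, map_mul]
      simp only [mul_assoc, hT, hD]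
    have h3 : (List.ofFn a).take (j + 1) = (List.ofFn a).take j ++ [a jj] :=
      take_succ_ofFn a jj
    have h4 : aWord (fun i j => paramQ N j i) [a jj] = rAnnih (fun i j => paramQ N j i) (a jj) := by
      rw [aWord_cons]; exact mul_one _
    rw [h1, h3, aWord_append, map_mul, mul_assoc (liftMat (OqR N) _) _ (minorsX _ _), h4,
      (qsystem N).rAnnih_mul_minorsX, Finset.mul_sum, Finset.sum_mul, Matrix.sum_apply]
    refine Finset.sum_congr rfl fun s _ => ?_
    rw [h2, ← mul_assoc (liftMat (OqR N) T) _ (sc _), mul_assoc _ (sc _), ← liftMat_mul_sc,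
      ← mul_assoc _ _ (sc _), mul_sc_apply]

lemma mul_gradeMat_card_mul_apply {I F A : Type*} [LinearOrder I] [Fintype I] [Field F] [Ring A]
    [Algebra F A] (w : I → F) (M M' : Matrix (Finset I) (Finset I) A) (J P : Finset I) :
    (M * liftMat A (gradeMat w (Fintype.card I)) * M') J P =
      (∏ c, w c) • (M J Finset.univ * M' Finset.univ P) := by
  have : Finset.univ.filter (fun K : Finset I => K.card = Fintype.card I) = {Finset.univ} := by
    ext K; simp [Finset.card_eq_iff_eq_univ]
  rw [mul_gradeMat_mul_apply, this, Finset.sum_singleton]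

lemma trace_mul_degMat {I F A : Type*} [LinearOrder I] [Fintype I] [Field F] [Ring A]
    [Algebra F A] (M : Matrix (Finset I) (Finset I) A) (k : ℕ) :
    Matrix.trace (M * liftMat A (degMat I fun n => if n = k then (1 : F) else 0)) =
      ∑ J with J.card = k, M J J := by
  rw [Matrix.trace, Finset.sum_filter]
  refine Finset.sum_congr rfl fun J _ => ?_
  rw [Matrix.diag_apply, mul_liftMat_degMat_apply]
  split_ifs <;> simp

lemma prod_pow_two_mul {F : Type*} [Field F] (q : F) (k : ℕ) :
    ∏ i ∈ Finset.range k, q ^ (2 * i) = q ^ ((k - 1) * k) := by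
  rw [Finset.prod_pow_eq_pow_sum, ← Finset.mul_sum, mul_comm 2, Finset.sum_range_id_mul_two,
    mul_comm]

lemma prod_qInt_reflect (N m : ℕ) :
    ∏ i ∈ Finset.range m, qInt (qq N) (m - i) = qFact N m := by
  rw [qFact, ← Finset.prod_range_reflect]
  refine Finset.prod_congr rfl fun i hi => ?_
  have := Finset.mem_range.1 hi
  rw [show m - (m - 1 - i) = i + 1 by omega]
  rfl

/-- The sum over all words of the right removals and right multiplications around two operators. -/
lemma sum_words {F A : Type*} [Field F] [Ring A] [Algebra F A] {k m : ℕ} {q : F}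
    {p : Fin (k + m) → Fin (k + m) → F} (hp : IsParam q p)
    (M M' : Matrix (Finset (Fin (k + m))) (Finset (Fin (k + m))) A) :
    q ^ ((k - 1) * k) • ∑ a : Fin (k + m) → Fin (k + m),
      (liftMat A (aWord p ((List.ofFn a).take k)) * M *
        liftMat A (aWord p ((List.ofFn a).drop k))) ∅ Finset.univ *
      (liftMat A (rWord p ((List.ofFn a).drop k)) * M' *
        liftMat A (rWord p ((List.ofFn a).take k))) Finset.univ ∅ =
    ((∏ i ∈ Finset.range m, qInt q (m - i)) * ∏ i ∈ Finset.range k, qInt q (i + 1)) •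
      ∑ J with J.card = k, (M * liftMat A (gradeMat (wLt (Fin (k + m)) q) k) * M') J J := by
  set w := wLt (Fin (k + m)) q with hw
  have hD : ∏ c, w c = q ^ ((k - 1) * k) * ∏ i ∈ Finset.range m, q ^ (2 * (k + i)) := by
    rw [hw, prod_wLt_eq, Finset.prod_range_add, prod_pow_two_mul]
  have hm : ∏ i ∈ Finset.range m, q ^ (2 * (k + i)) ≠ 0 :=
    Finset.prod_ne_zero_iff.2 fun i _ => pow_ne_zero _ hp.ne_zero
  -- The product of the two top coefficients is a single coefficient of a product of operators, with
  -- the projection to the top degree in the middle. Contracting the last `m` indices lowers the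
  -- projection to the degree `k`, and contracting the first `k` indices closes the trace.
  have h1 : ∀ (c : Fin k → Fin (k + m)) (d : Fin m → Fin (k + m)),
      (∏ c, w c) • ((liftMat A (aWord p ((List.ofFn (Fin.append c d)).take k)) * M *
        liftMat A (aWord p ((List.ofFn (Fin.append c d)).drop k))) ∅ Finset.univ *
      (liftMat A (rWord p ((List.ofFn (Fin.append c d)).drop k)) * M' *
        liftMat A (rWord p ((List.ofFn (Fin.append c d)).take k))) Finset.univ ∅) =
      (liftMat A (aWord p (List.ofFn c)) * M * liftMat A (aWord p (List.ofFn d) *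
        gradeMat w (k + m) * rWord p (List.ofFn d)) * M' *
          liftMat A (rWord p (List.ofFn c))) ∅ ∅ := by
    intro c d
    have e1 : (List.ofFn (Fin.append c d)).take k = List.ofFn c := by
      rw [List.ofFn_fin_append, List.take_left' (by simp)]
    have e2 : (List.ofFn (Fin.append c d)).drop k = List.ofFn d := by
      rw [List.ofFn_fin_append, List.drop_left' (by simp)]
    rw [← mul_gradeMat_card_mul_apply, e1, e2, Fintype.card_fin, map_mul, map_mul]
    simp only [mul_assoc]
  have h2 : ∀ c : Fin k → Fin (k + m), ∑ d : Fin m → Fin (k + m),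
      (liftMat A (aWord p (List.ofFn c)) * M * liftMat A (aWord p (List.ofFn d) *
        gradeMat w (k + m) * rWord p (List.ofFn d)) * M' *
          liftMat A (rWord p (List.ofFn c))) ∅ ∅ =
      (∏ i ∈ Finset.range m, q ^ (2 * (k + i)) * qInt q (m - i)) • Matrix.trace
        (M * liftMat A (gradeMat w k) * M' * liftMat A (rWord p (List.ofFn c) *
          (degMat _ fun n => if n = 0 then (1 : F) else 0) * aWord p (List.ofFn c))) := by
    intro c
    rw [← Matrix.sum_apply, ← Finset.sum_mul, ← Finset.sum_mul, ← Finset.mul_sum, ← map_sum,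
      sum_aWord_mul_mul_rWord hp, liftMat_smul, Fintype.card_fin]
    have e3 : ∀ i, k + m - (k + i) = m - i := fun i => by omega
    simp only [e3, Matrix.mul_smul, Matrix.smul_mul, Matrix.smul_apply]
    congr 1
    have e4 : ∀ B : Matrix (Finset (Fin (k + m))) (Finset (Fin (k + m))) A, B ∅ ∅ =
        Matrix.trace (B * liftMat A (degMat _ fun n => if n = 0 then (1 : F) else 0)) := by
      intro B
      have : Finset.univ.filter (fun K : Finset (Fin (k + m)) => K.card = 0) = {∅} := by
        ext; simp
      rw [trace_mul_degMat, this, Finset.sum_singleton]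
    refine (e4 _).trans ?_
    rw [mul_assoc (liftMat A _) M, mul_assoc (liftMat A _), mul_assoc (liftMat A _),
      mul_assoc (liftMat A _), trace_liftMat_mul, map_mul, map_mul]
    simp only [mul_assoc, hw]
  have h3 := sum_rWord_mul_mul_aWord hp k 0
  simp only [zero_add] at h3
  apply smul_right_injective A hm
  simp only [smul_smul]
  rw [mul_comm _ (q ^ _), ← hD, sum_append, Finset.smul_sum]
  simp only [Finset.smul_sum, h1, h2]
  rw [← Finset.smul_sum, ← Matrix.trace_sum, ← Finset.mul_sum, ← map_sum, h3, liftMat_smul,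
    Matrix.mul_smul, Matrix.trace_smul, smul_smul, trace_mul_degMat, ← Finset.smul_sum,
    Finset.prod_mul_distrib, mul_assoc]

/-- The norm of the Levi-Civita tensor is the contraction of all indices of the top projection. -/
lemma normSqU_eq (N : ℕ) : normSqU N = qFact N N := by
  have hp := (isParam_paramQ N).swap
  have h := sum_aWord_mul_mul_rWord hp N 0
  have h1 := congrFun (congrFun h ∅) ∅
  have h2 : ∏ c, wLt (Fin N) (qq N) c ≠ 0 :=
    Finset.prod_ne_zero_iff.2 fun c _ => pow_ne_zero _ hp.ne_zero
  apply mul_left_cancel₀ h2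
  have h3 : ∀ a : Fin N → Fin N, (aWord (fun i j => paramQ N j i) (List.ofFn a) *
      gradeMat (wLt (Fin N) (qq N)) (0 + N) * rWord (fun i j => paramQ N j i) (List.ofFn a)) ∅ ∅ =
      (∏ c, wLt (Fin N) (qq N) c) * (vVec N a * uVec N a) := by
    intro a
    have := mul_gradeMat_card_mul_apply (A := ParamField N) (wLt (Fin N) (qq N))
      (aWord (fun i j => paramQ N j i) (List.ofFn a)) (rWord (fun i j => paramQ N j i) (List.ofFn a))
      ∅ ∅
    rw [Fintype.card_fin, smul_eq_mul] at this
    rw [vVec_eq, uVec_eq, ← this, zero_add]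
    rfl
  rw [Matrix.sum_apply, Finset.sum_congr rfl fun a _ => h3 a, ← Finset.mul_sum] at h1
  rw [normSqU, dotProduct, h1, prod_wLt_eq, Matrix.smul_apply, gradeMat, weightMat, degMat,
    Matrix.diagonal_mul_diagonal, Matrix.diagonal_apply_eq, Finset.prod_empty, Finset.card_empty,
    if_pos rfl, one_mul, smul_eq_mul, mul_one, Finset.prod_mul_distrib, Fintype.card_fin]
  simp only [zero_add, prod_qInt_reflect]

lemma qFact_ne_zero (N n : ℕ) : qFact N n ≠ 0 :=
  Finset.prod_ne_zero_iff.2 fun k _ => qInt_qq_ne_zero N k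

/-- The coefficients of the Cayley-Hamilton identity are the weighted sums of products of quantum
minors. -/
lemma sigma_eq_tau (N : ℕ) {k : ℕ} (hk : k ≤ N) :
    sigma N k = tau (qq N) (paramQ N) (entryX N) (entryY N) k := by
  rw [sigma]
  split_ifs with h1
  swap
  · rw [show k = 0 by omega, (qsystem N).tau_zero]
  obtain ⟨m, rfl⟩ : ∃ m, N = k + m := ⟨N - k, by omega⟩
  set N := k + m with hN
  have hp := (isParam_paramQ N).swap
  set b₀ : Fin N → Fin N := id
  have hq : qq N ≠ 0 := hp.ne_zero
  have e1 : (fun a => algebraMap (ParamField N) (OqR N) (vVec N a)) ⬝ᵥ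
      (chain k h1 hk ^ k *ᵥ fun a => algebraMap (ParamField N) (OqR N) (uVec N a)) =
      (vMat N * (chain k h1 hk ^ k * uMat N)) b₀ b₀ := rfl
  have e2 := (braidRelations N).pow_mul_wedge (U := uMat N) (fun i hi => rLegs_mul_uMat hi) hk
  have e3 : (vMat N * (upProd (xLeg N) k * downProd (yLeg N) k * uMat N)) b₀ b₀ =
      ∑ a, (vMat N * upProd (xLeg N) k) b₀ a * (downProd (yLeg N) k * uMat N) a b₀ := by
    rw [mul_assoc, ← mul_assoc (vMat N), Matrix.mul_apply]
  -- The eigenvalue of the braiding enters with the even exponent `(k - 1) * k`, so its sign drops out.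
  have e4 : (-qq N ^ 2) ^ ((k - 1) * k) = qq N ^ ((k - 1) * k) * qq N ^ ((k - 1) * k) := by
    have : Even ((k - 1) * k) := by
      obtain ⟨j, rfl⟩ : ∃ j, k = j + 1 := ⟨k - 1, by omega⟩
      exact Nat.even_mul_succ_self j
    rw [this.neg_pow, ← pow_mul, ← pow_add, two_mul]
  have e5 := sum_words (A := OqR N) hp (minorsX (paramQ N) (entryX N))
    (minorsY (paramQ N) (entryY N))
  rw [e1, chain_eq, e2, Matrix.mul_smul, Matrix.smul_apply, e3]
  simp only [vMat_mul_upProd_xLeg hk, downProd_yLeg_mul_uMat hk]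
  rw [e4, mul_smul, e5, ← Algebra.smul_def, smul_smul, smul_smul, (qsystem N).tau_eq_sum_minorsX_mul_minorsY]
  have e6 : (qq N ^ ((k - 1) * k))⁻¹ * alpha N k * qq N ^ ((k - 1) * k) *
      ((∏ i ∈ Finset.range m, qInt (qq N) (m - i)) * ∏ i ∈ Finset.range k, qInt (qq N) (i + 1)) =
      1 := by
    have h2 : ∏ i ∈ Finset.range k, qInt (qq N) (i + 1) = qFact N k := rfl
    rw [prod_qInt_reflect, h2, alpha, normSqU_eq, show N - k = m by omega]
    have := qFact_ne_zero N m
    have := qFact_ne_zero N k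
    have := qFact_ne_zero N N
    field_simp
  rw [e6, one_smul, Finset.sum_filter]
  refine Finset.sum_congr rfl fun J _ => ?_
  split_ifs with hJ
  · rw [mul_gradeMat_mul_apply]
  · refine (Finset.sum_eq_zero fun L hL => ?_).symm
    rw [minorsX_eq_zero (qsystem N), zero_mul, smul_zero]
    rw [(Finset.mem_filter.1 hL).2]; exact hJ

end Sigma

/-! ### Expansions over words -/

section Expansion

variable {I F A : Type*} [LinearOrder I] [Fintype I] [Field F] [Ring A] [Algebra F A]
  {q : F} {Q : I → I → F} {x X Y : I → I → A}

open MulOpposite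

lemma sum_snoc {M : Type*} [AddCommMonoid M] {n : ℕ} (f : (Fin (n + 1) → I) → M) :
    ∑ b, f b = ∑ c : Fin n → I, ∑ y, f (Fin.snoc c y) := by
  rw [Finset.sum_comm, ← Fintype.sum_prod_type']
  exact (Fintype.sum_equiv (Fin.snocEquiv fun _ => I) _ _ fun x => rfl).symm

lemma prod_rowOp_mul_rCreate (l : List I) (c : I) :
    (l.map (rowOp Q x)).prod * liftMat A (rCreate (fun a b => Q b a) c) =
      liftMat A (rCreate (fun a b => Q b a) c) * (l.map (rowOp Q x)).prod := by
  induction l with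
  | nil => simp
  | cons a l ih =>
    rw [List.map_cons, List.prod_cons, mul_assoc, ih, ← mul_assoc, rowOp_mul_rCreate, mul_assoc]

/-- A product of row operators on the vacuum, as a sum over words. The left multiplications in the row
operators act on the vacuum as right multiplications, which commute with the other factors. -/
lemma prod_rowOp_apply_empty {m : ℕ} (f : Fin m → I) (K : Finset I) :
    ((List.ofFn f).map (rowOp Q x)).prod K ∅ = ∑ τ : Fin m → I,
      rWord (fun i j => Q j i) (List.ofFn τ) K ∅ • (List.ofFn fun n => x (f n) (τ n)).prod := by
  induction m generalizing K with
  | zero =>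
    simp [rWord, Matrix.one_apply]
  | succ m ih =>
    rw [sum_snoc, Finset.sum_comm]
    have h1 : ∀ (c : Fin m → I) (y : I),
        rWord (fun i j => Q j i) (List.ofFn (Fin.snoc c y : Fin (m + 1) → I)) K ∅ •
          (List.ofFn fun n => x (f n) ((Fin.snoc c y : Fin (m + 1) → I) n)).prod =
        ∑ K', rCreate (fun i j => Q j i) y K K' • (rWord (fun i j => Q j i) (List.ofFn c) K' ∅ •
          (List.ofFn fun n => x (f n.castSucc) (c n)).prod * x (f (Fin.last m)) y) := by
      intro c y
      have e1 : rWord (fun i j => Q j i) (List.ofFn (Fin.snoc c y : Fin (m + 1) → I)) =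
          rCreate (fun i j => Q j i) y * rWord (fun i j => Q j i) (List.ofFn c) := by
        rw [List.ofFn_succ', List.concat_eq_append, rWord_append, Fin.snoc_last, rWord_cons]
        simp only [Fin.snoc_castSucc]
        congr 1
        exact one_mul _
      rw [e1, List.ofFn_succ', List.concat_eq_append, List.prod_append, List.prod_singleton,
        Fin.snoc_last]
      simp only [Fin.snoc_castSucc]
      rw [Matrix.mul_apply, Finset.sum_smul]
      exact Finset.sum_congr rfl fun K' _ => by rw [smul_mul_assoc, smul_smul]
    simp only [h1]
    rw [List.ofFn_succ', List.concat_eq_append, List.map_append, List.prod_append, List.map_cons,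
      List.map_nil, List.prod_singleton, rowOp, Finset.mul_sum, Matrix.sum_apply]
    refine Finset.sum_congr rfl fun y _ => ?_
    rw [← mul_assoc, mul_liftMat_vac, mul_assoc, ← liftMat_mul_sc, ← mul_assoc,
      prod_rowOp_mul_rCreate, mul_sc_apply, Finset.sum_comm, Matrix.mul_apply, Finset.sum_mul]
    refine Finset.sum_congr rfl fun K' _ => ?_
    rw [liftMat_apply, ih, ← Algebra.smul_def, smul_mul_assoc, Finset.sum_mul, Finset.smul_sum]

/-- The expansion of a quantum minor over all words. -/
lemma qMinor_eq_sum {m : ℕ} {J : Finset I} (hJ : J.card = m) (K : Finset I) :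
    qMinor Q x J K = ∑ τ : Fin m → I,
      (if Function.Injective τ ∧ K = Finset.univ.image τ then wordCoeff Q τ else 0) •
        (List.ofFn fun n => x (J.orderEmbOfFin hJ n) (τ n)).prod := by
  have h1 : J.sort (· ≤ ·) = List.ofFn (J.orderEmbOfFin hJ) := by
    refine List.ext_getElem (by simp [hJ]) fun i h h' => ?_
    rw [List.getElem_ofFn, Finset.orderEmbOfFin_apply]; rfl
  rw [qMinor, Matrix.of_apply, ordProd, h1, prod_rowOp_apply_empty]
  simp only [rWord_ofFn_apply_empty]

/-- The expansion of a quantum minor of `X` over the words, the rows being in ascending order. -/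
lemma QSystem.minorsX_eq_sum (h : QSystem q Q X Y) {m : ℕ} {J : Finset I} (hJ : J.card = m)
    (K : Finset I) : minorsX Q X K J = ∑ τ : Fin m → I,
      (if Function.Injective τ ∧ K = Finset.univ.image τ then wordCoeff Q τ else 0) •
        (List.ofFn fun n => X (J.orderEmbOfFin hJ n) (τ n)).prod := by
  rw [← qMinor_eq_sum hJ, ← transpose_qMinor h.param h.X_rel]
  rfl

/-- The expansion of a quantum minor of `Y` over the words, the columns being in descending
order. -/
lemma minorsY_eq_sum {m : ℕ} {J : Finset I} (hJ : J.card = m)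
    (K : Finset I) : minorsY Q Y J K = ∑ τ : Fin m → I,
      (if Function.Injective τ ∧ K = Finset.univ.image τ then wordCoeff (fun i j => Q j i) τ
        else 0) • (List.ofFn fun n => Y (τ n) (J.orderEmbOfFin hJ n)).reverse.prod := by
  rw [minorsY, Matrix.map_apply, qMinor_eq_sum hJ, Finset.unop_sum]
  refine Finset.sum_congr rfl fun τ _ => ?_
  rw [unop_smul, unop_list_prod, List.map_ofFn]
  rfl

/-- The weighted contraction of the quantum minors of `Y` and `X`, as a sum over words. -/
lemma QSystem.sum_minorsY_mul_minorsX (h : QSystem q Q X Y) (w : I → F) {m : ℕ} {J J' : Finset I}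
    (hJ : J.card = m) (hJ' : J'.card = m) :
    ∑ L with L.card = m, (∏ c ∈ L, w c) • (minorsY Q Y J L * minorsX Q X L J') =
      ∑ στ : (Fin m → I) × (Fin m → I) with Function.Injective στ.1 ∧ Function.Injective στ.2 ∧
        Finset.univ.image στ.1 = Finset.univ.image στ.2,
      ((∏ n, w (στ.2 n)) * wordCoeff (fun i j => Q j i) στ.1 * wordCoeff Q στ.2) •
        ((List.ofFn fun n => Y (στ.1 n) (J.orderEmbOfFin hJ n)).reverse.prod *
          (List.ofFn fun n => X (J'.orderEmbOfFin hJ' n) (στ.2 n)).prod) := by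
  rw [Finset.sum_filter]
  have h1 : ∀ L : Finset I, (if L.card = m then (∏ c ∈ L, w c) • (minorsY Q Y J L * minorsX Q X L J')
      else 0) = ∑ στ : (Fin m → I) × (Fin m → I), if Function.Injective στ.1 ∧
        Function.Injective στ.2 ∧ L = Finset.univ.image στ.1 ∧ L = Finset.univ.image στ.2 then
      ((∏ c ∈ L, w c) * wordCoeff (fun i j => Q j i) στ.1 * wordCoeff Q στ.2) •
        ((List.ofFn fun n => Y (στ.1 n) (J.orderEmbOfFin hJ n)).reverse.prod *
          (List.ofFn fun n => X (J'.orderEmbOfFin hJ' n) (στ.2 n)).prod) else 0 := by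
    intro L
    by_cases hL : L.card = m
    · rw [if_pos hL, minorsY_eq_sum hJ, h.minorsX_eq_sum hJ', Finset.sum_mul_sum,
        ← Fintype.sum_prod_type', Finset.smul_sum]
      refine Finset.sum_congr rfl fun στ _ => ?_
      by_cases h1 : Function.Injective στ.1 ∧ L = Finset.univ.image στ.1
      · by_cases h2 : Function.Injective στ.2 ∧ L = Finset.univ.image στ.2
        · rw [if_pos h1, if_pos h2, if_pos ⟨h1.1, h2.1, h1.2, h2.2⟩, smul_mul_smul_comm, smul_smul,
            mul_assoc]
        · rw [if_neg h2, zero_smul, mul_zero, smul_zero, if_neg]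
          exact fun h => h2 ⟨h.2.1, h.2.2.2⟩
      · rw [if_neg h1, zero_smul, zero_mul, smul_zero, if_neg]
        exact fun h => h1 ⟨h.1, h.2.2.1⟩
    · rw [if_neg hL]
      refine (Finset.sum_eq_zero fun στ _ => if_neg ?_).symm
      rintro ⟨h1, -, h2, -⟩
      exact hL (by rw [h2, Finset.card_image_of_injective _ h1, Finset.card_univ, Fintype.card_fin])
  rw [Finset.sum_congr rfl fun L _ => h1 L, Finset.sum_comm, Finset.sum_filter]
  refine Finset.sum_congr rfl fun στ _ => ?_
  rw [Finset.sum_eq_single (Finset.univ.image στ.2)]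
  · by_cases hc : Function.Injective στ.1 ∧ Function.Injective στ.2 ∧
        Finset.univ.image στ.1 = Finset.univ.image στ.2
    · rw [if_pos hc, if_pos ⟨hc.1, hc.2.1, hc.2.2.symm, rfl⟩,
        Finset.prod_image fun a _ b _ hab => hc.2.1 hab]
    · rw [if_neg hc, if_neg fun h => hc ⟨h.1, h.2.1, h.2.2.1.symm⟩]
  · exact fun L _ hL => if_neg fun h => hL h.2.2.2
  · simp

/-- The entries of the adjugate, as contractions of quantum minors. -/
lemma QSystem.adjCoeff_apply (h : QSystem q Q X Y) (k : ℕ) (i j : I) :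
    adjCoeff q Q X Y k i j = ∑ K with K.card = k + 1 ∧ i ∈ K ∧ j ∈ K,
      ((∏ c ∈ K with i < c, -Q i c) * ∏ c ∈ K with j < c, -Q c j) •
        ∑ L with L.card = k, (∏ c ∈ L, wGt I q c) •
          (minorsY Q Y (K.erase i) L * minorsX Q X L (K.erase j)) := by
  set B := minorsY Q Y * liftMat A (gradeMat (wGt I q) k) * minorsX Q X with hB
  have h1 : adjCoeff q Q X Y k i j = Matrix.trace
      (liftMat A (rCreate (fun i j => Q j i) i) * B * liftMat A (rAnnih (fun i j => Q j i) j)) := by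
    rw [mul_assoc, trace_liftMat_mul, mul_assoc B, ← map_mul]
    rfl
  rw [h1, Matrix.trace, Finset.sum_filter]
  refine Finset.sum_congr rfl fun K _ => ?_
  rw [Matrix.diag_apply, rAnnih, mul_liftMat_annih_apply, rCreate, liftMat_create_mul_apply,
    hB, mul_gradeMat_mul_apply]
  by_cases hi : i ∈ K
  swap
  · simp [hi]
  by_cases hj : j ∈ K
  swap
  · simp [hj]
  rw [if_pos hi, if_pos hj, Finset.prod_ite, Finset.prod_ite, Finset.prod_const_one,
    Finset.prod_const_one, mul_one, mul_one, filter_erase_gt, filter_erase_gt]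
  by_cases hK : K.card = k + 1
  · rw [if_pos ⟨hK, hi, hj⟩, ← Algebra.smul_def, ← Algebra.smul_def, smul_smul, mul_comm]
  · rw [if_neg (fun h => hK h.1)]
    have : ∑ L with L.card = k, (∏ c ∈ L, wGt I q c) •
        (minorsY Q Y (K.erase i) L * minorsX Q X L (K.erase j)) = 0 := by
      refine Finset.sum_eq_zero fun L hL => ?_
      rw [minorsX_eq_zero h, mul_zero, smul_zero]
      rw [(Finset.mem_filter.1 hL).2]
      have := Finset.card_erase_add_one hj
      omega
    rw [this, mul_zero, mul_zero]

lemma QSystem.tau_eq_sum_card (h : QSystem q Q X Y) (k : ℕ) :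
    tau q Q X Y k = ∑ J with J.card = k, ∑ L with L.card = k,
      (∏ c ∈ L, wGt I q c) • (minorsY Q Y J L * minorsX Q X L J) := by
  rw [tau_eq_sum, Finset.sum_filter]
  refine Finset.sum_congr rfl fun J _ => ?_
  split_ifs with hJ
  · rfl
  · refine Finset.sum_eq_zero fun L hL => ?_
    rw [minorsX_eq_zero h, mul_zero, smul_zero]
    rw [(Finset.mem_filter.1 hL).2]
    exact Ne.symm hJ

end Expansion

/-! ### Comparison with the minors of the matrices `X D'` and `D' Y` -/

section Minors

variable {N : ℕ}

lemma sum_embedding {M : Type*} [AddCommMonoid M] {I : Type*} [Fintype I] [DecidableEq I] {m : ℕ} {K : Finset I}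
    (hK : K.card = m) (f : (Fin m → I) → M) :
    ∑ τ : Fin m ↪ K, f (fun n => τ n) =
      ∑ τ : Fin m → I with Function.Injective τ ∧ K = Finset.univ.image τ, f τ := by
  refine Finset.sum_bij (fun τ _ n => (τ n : I)) ?_ ?_ ?_ ?_
  · intro τ _
    have h1 : Function.Injective fun n => (τ n : I) := Subtype.val_injective.comp τ.injective
    refine Finset.mem_filter.2 ⟨Finset.mem_univ _, h1, ?_⟩
    refine (Finset.eq_of_subset_of_card_le ?_ ?_).symm
    · intro c hc
      obtain ⟨n, -, rfl⟩ := Finset.mem_image.1 hc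
      exact (τ n).2
    · rw [Finset.card_image_of_injective _ h1, Finset.card_univ, Fintype.card_fin, hK]
  · intro τ _ τ' _ h
    ext n
    exact congrFun h n
  · intro τ hτ
    obtain ⟨h1, h2⟩ := (Finset.mem_filter.1 hτ).2
    refine ⟨⟨fun n => ⟨τ n, h2 ▸ Finset.mem_image_of_mem _ (Finset.mem_univ n)⟩, ?_⟩,
      Finset.mem_univ _, rfl⟩
    intro a b hab
    exact h1 (congrArg Subtype.val hab)
  · intro τ _
    rfl

lemma list_prod_smul_ofFn {F A : Type*} [Field F] [Ring A] [Algebra F A] {m : ℕ} (c : Fin m → F)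
    (a : Fin m → A) : (List.ofFn fun n => c n • a n).prod = (∏ n, c n) • (List.ofFn a).prod := by
  induction m with
  | zero => simp
  | succ m ih =>
    rw [List.ofFn_succ, List.prod_cons, ih, List.ofFn_succ, List.prod_cons, Fin.prod_univ_succ,
      smul_mul_smul_comm]

lemma matX_mul_DPrime_apply (i j : Fin N) : (matX N * DPrime N) i j =
    qq N ^ (N - 1 - (j : ℕ)) • entryX N i j := by
  rw [DPrime, Matrix.mul_diagonal, ← Algebra.commutes, Algebra.smul_def]
  rfl

/-- The diagonal matrix multiplies the minors by the product of the entries for the chosen columns. -/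
lemma minorX_mul_DPrime {J K : Finset (Fin N)} (hJK : J.card = K.card) :
    minorX (matX N * DPrime N) J K =
      (∏ c ∈ K, qq N ^ (N - 1 - (c : ℕ))) • minorsX (paramQ N) (entryX N) K J := by
  rw [minorX, sum_embedding hJK.symm fun τ => algebraMap (ParamField N) (OqR N) (negqC τ) *
    (List.ofFn fun n => (matX N * DPrime N) (J.orderEmbOfFin rfl n) (τ n)).prod,
    (qsystem N).minorsX_eq_sum rfl, Finset.smul_sum, Finset.sum_filter]
  refine Finset.sum_congr rfl fun τ _ => ?_
  split_ifs with h
  · simp only [matX_mul_DPrime_apply]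
    rw [list_prod_smul_ofFn, ← Algebra.smul_def, smul_smul, smul_smul, negqC_eq_wordCoeff, h.2,
      Finset.prod_image fun a _ b _ hab => h.1 hab, mul_comm]
  · rw [zero_smul, smul_zero]

lemma conjTranspose_DPrime_mul : (DPrime N * matY N)ᴴ = matX N * DPrime N := by
  ext i j
  rw [Matrix.conjTranspose_apply, DPrime, Matrix.diagonal_mul, Matrix.mul_diagonal, star_mul,
    star_matY, star_algebraMap, star_pow, star_param_none]

lemma star_smul_OqR (c : ParamField N) (x : OqR N) : star (c • x) = star c • star x := by
  rw [Algebra.smul_def, star_mul, star_algebraMap, ← Algebra.commutes, Algebra.smul_def]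

lemma star_wordCoeff {m : ℕ} (τ : Fin m → Fin N) :
    star (wordCoeff (paramQ N) τ) = wordCoeff (fun i j => paramQ N j i) τ := by
  rw [wordCoeff, wordCoeff]
  refine (map_prod (starRingEnd (ParamField N)) _ _).trans ?_
  refine Finset.prod_congr rfl fun x _ => ?_
  rw [starRingEnd_apply, star_neg]
  exact congrArg Neg.neg (star_QQ _ _)

lemma star_list_prod {A : Type*} [Ring A] [StarRing A] (l : List A) :
    star l.prod = (l.map star).reverse.prod := by
  induction l with
  | nil => simp
  | cons a l ih => simp [ih]

/-- The involution exchanges the minors of `X` and of `Y`, because it sends `X i j` to `Y j i` and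
`q_ij` to `q_ji` and reverses the words. -/
lemma star_minorsX (K J : Finset (Fin N)) :
    star (minorsX (paramQ N) (entryX N) K J) = minorsY (paramQ N) (entryY N) J K := by
  rw [(qsystem N).minorsX_eq_sum rfl, minorsY_eq_sum rfl, star_sum]
  refine Finset.sum_congr rfl fun τ _ => ?_
  rw [star_smul_OqR, apply_ite star, star_wordCoeff, star_zero, star_list_prod, List.map_ofFn]
  congr 4
  funext n
  exact star_matX _ _

lemma minorY_DPrime_mul {L K : Finset (Fin N)} (hLK : L.card = K.card) :
    minorY (DPrime N * matY N) L K =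
      (∏ c ∈ L, qq N ^ (N - 1 - (c : ℕ))) • minorsY (paramQ N) (entryY N) K L := by
  rw [minorY, conjTranspose_DPrime_mul, minorX_mul_DPrime hLK.symm, star_smul_OqR, star_minorsX]
  congr 1
  refine (map_prod (starRingEnd (ParamField N)) _ _).trans ?_
  refine Finset.prod_congr rfl fun x _ => ?_
  rw [starRingEnd_apply, star_pow, star_param_none]

/-- One factor of the weight comes from `X D'` and the other from `D' Y`. -/
lemma wGt_fin (q : ParamField N) (c : Fin N) : wGt (Fin N) q c =
    q ^ (N - 1 - (c : ℕ)) * q ^ (N - 1 - (c : ℕ)) := by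
  have : Finset.univ.filter (c < ·) = Finset.Ioi c := by ext; simp
  rw [wGt, this, Fin.card_Ioi, two_mul, pow_add]

/-- The numerator is the generating polynomial of the contractions of quantum minors. -/
lemma numer_eq_sum (i j : Fin N) : numer N i j = ∑ k ∈ Finset.range N,
    Polynomial.C (adjCoeff (qq N) (paramQ N) (entryX N) (entryY N) k i j) *
      Polynomial.X ^ (N - 1 - k) := by
  have h1 : ∀ k, adjCoeff (qq N) (paramQ N) (entryX N) (entryY N) k i j =
      ∑ K with i ∈ K ∧ j ∈ K, if K.card = k + 1 then
        algebraMap (ParamField N) (OqR N) (negqLeft i K * negqRight K j) *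
          ∑ L ∈ Finset.univ.powersetCard (K.card - 1),
            minorY (DPrime N * matY N) L (K.erase i) * minorX (matX N * DPrime N) (K.erase j) L
        else 0 := by
    intro k
    rw [(qsystem N).adjCoeff_apply, ← Finset.sum_filter, Finset.filter_filter]
    have e0 : Finset.univ.filter (fun K : Finset (Fin N) => K.card = k + 1 ∧ i ∈ K ∧ j ∈ K) =
        Finset.univ.filter (fun K : Finset (Fin N) => (i ∈ K ∧ j ∈ K) ∧ K.card = k + 1) := by
      ext K; simp only [Finset.mem_filter, Finset.mem_univ, true_and]; tauto
    rw [e0]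
    refine Finset.sum_congr rfl fun K hK => ?_
    obtain ⟨⟨hi, hj⟩, hc⟩ := (Finset.mem_filter.1 hK).2
    rw [← Algebra.smul_def, hc, Nat.add_sub_cancel]
    have e1 : (Finset.univ : Finset (Fin N)).powersetCard k =
        Finset.univ.filter fun L => L.card = k := by
      ext L; simp [Finset.mem_powersetCard]
    rw [e1]
    congr 1
    refine Finset.sum_congr rfl fun L hL => ?_
    have hL := (Finset.mem_filter.1 hL).2
    have hi' := Finset.card_erase_add_one hi
    have hj' := Finset.card_erase_add_one hj
    rw [minorY_DPrime_mul (by omega), minorX_mul_DPrime (by omega), smul_mul_smul_comm,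
      ← Finset.prod_mul_distrib]
    simp only [wGt_fin]
  rw [numer]
  simp only [h1, map_sum, Finset.sum_mul]
  rw [Finset.sum_comm]
  refine Finset.sum_congr rfl fun K hK => ?_
  have hK := (Finset.mem_filter.1 hK).2
  have hpos : 0 < K.card := Finset.card_pos.2 ⟨i, hK.1⟩
  have hle : K.card ≤ N := (Finset.card_le_univ K).trans_eq (Fintype.card_fin N)
  rw [Finset.sum_eq_single (K.card - 1)]
  · rw [if_pos (by omega), Polynomial.X_pow_mul, show N - 1 - (K.card - 1) = N - K.card by omega]
  · intro k _ hk
    rw [if_neg (by omega), Polynomial.C_0, zero_mul]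
  · intro h
    exact absurd (Finset.mem_range.2 (by omega)) h

end Minors

/-! ### The inverse of `t + X Y` -/

section Generating

variable {I F A : Type*} [LinearOrder I] [Fintype I] [Field F] [Ring A] [Algebra F A]
  {q : F} {Q : I → I → F} {X Y : I → I → A}

/-- The generating polynomial `∑ tau(k) t ^ (N - k)`. -/
def genTau (q : F) (Q : I → I → F) (X Y : I → I → A) : A[X] :=
  ∑ k ∈ Finset.range (Fintype.card I + 1),
    Polynomial.C (tau q Q X Y k) * Polynomial.X ^ (Fintype.card I - k)

/-- The generating matrix `∑ adjCoeff(k) t ^ (N - 1 - k)`. -/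
def genAdj (q : F) (Q : I → I → F) (X Y : I → I → A) : Matrix I I A[X] :=
  Matrix.of fun i j => ∑ k ∈ Finset.range (Fintype.card I),
    Polynomial.C (adjCoeff q Q X Y k i j) * Polynomial.X ^ (Fintype.card I - 1 - k)

/-- The matrix `t + X Y`. -/
def shiftMat (X Y : I → I → A) : Matrix I I A[X] :=
  Matrix.diagonal (fun _ => Polynomial.X) + (prodMat X Y).map Polynomial.C

/-- Telescoping of the recursion for the coefficients of the adjugate. -/
lemma QSystem.telescope (h : QSystem q Q X Y) (i j : I) :
    (∑ k ∈ Finset.range (Fintype.card I),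
        Polynomial.C (adjCoeff q Q X Y k i j) * Polynomial.X ^ (Fintype.card I - k)) +
      ∑ k ∈ Finset.range (Fintype.card I),
        Polynomial.C ((Matrix.scalar I (tau q Q X Y (k + 1)) - adjCoeff q Q X Y (k + 1)) i j) *
          Polynomial.X ^ (Fintype.card I - 1 - k) =
      Matrix.scalar I (genTau q Q X Y) i j := by
  set d := Fintype.card I with hd
  have h1 : ∀ k, Polynomial.C ((Matrix.scalar I (tau q Q X Y (k + 1)) -
      adjCoeff q Q X Y (k + 1)) i j) * Polynomial.X ^ (d - 1 - k) =
      Polynomial.C (Matrix.scalar I (tau q Q X Y (k + 1)) i j) * Polynomial.X ^ (d - (k + 1)) -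
      Polynomial.C (adjCoeff q Q X Y (k + 1) i j) * Polynomial.X ^ (d - (k + 1)) := by
    intro k
    rw [Matrix.sub_apply, Polynomial.C_sub, sub_mul, Nat.sub_sub, add_comm 1]
  have h2 := Finset.sum_range_succ' (fun k => Polynomial.C (adjCoeff q Q X Y k i j) *
    (Polynomial.X : A[X]) ^ (d - k)) d
  rw [Finset.sum_range_succ, h.adjCoeff_card, h.adjCoeff_zero, Matrix.zero_apply, Polynomial.C_0,
    zero_mul, add_zero] at h2
  simp only [h1, Finset.sum_sub_distrib]
  rw [h2, genTau, Finset.sum_range_succ', h.tau_zero]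
  simp only [Matrix.scalar_apply, Matrix.diagonal_apply, Matrix.one_apply]
  split_ifs <;> simp [← hd]; abel

lemma X_mul_C_mul_X_pow {d k : ℕ} (hk : k < d) (a : A) :
    Polynomial.X * (Polynomial.C a * Polynomial.X ^ (d - 1 - k)) =
      Polynomial.C a * Polynomial.X ^ (d - k) := by
  rw [← mul_assoc, Polynomial.X_mul_C, mul_assoc, ← pow_succ', show d - 1 - k + 1 = d - k by omega]

/-- The generating matrix is a right inverse of `t + X Y` up to the generating polynomial. -/
lemma QSystem.shiftMat_mul_genAdj (h : QSystem q Q X Y) :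
    shiftMat X Y * genAdj q Q X Y = Matrix.scalar I (genTau q Q X Y) := by
  ext1 i j
  rw [← h.telescope, shiftMat, add_mul, Matrix.add_apply, Matrix.diagonal_mul, Matrix.mul_apply]
  simp only [genAdj, Matrix.of_apply, Matrix.map_apply, Finset.mul_sum]
  congr 1
  · exact Finset.sum_congr rfl fun k hk => X_mul_C_mul_X_pow (Finset.mem_range.1 hk) _
  · rw [Finset.sum_comm]
    refine Finset.sum_congr rfl fun k _ => ?_
    rw [← h.mul_adjCoeff_add k, add_sub_cancel_right, Matrix.mul_apply, map_sum, Finset.sum_mul]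
    exact Finset.sum_congr rfl fun l _ => by rw [← mul_assoc, Polynomial.C_mul]

lemma QSystem.commute_adjCoeff (h : QSystem q Q X Y)
    (hc : ∀ k z, Commute (tau q Q X Y k) z) (k : ℕ) :
    Commute (prodMat X Y) (adjCoeff q Q X Y k) := by
  rw [h.adjCoeff_eq_sum]
  refine Commute.sum_right _ _ _ fun r _ => ?_
  refine Commute.mul_right ((Commute.neg_one_right _).pow_right r) ?_
  refine ((Commute.refl _).pow_right r).mul_right ?_
  exact (Matrix.scalar_commute _ (fun z => hc _ z) _).symm

/-- If the `tau k` are central, the `adjCoeff k` are polynomials in `X Y` with central coefficients, so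
that the right inverse is also a left inverse. -/
lemma QSystem.genAdj_mul_shiftMat (h : QSystem q Q X Y)
    (hc : ∀ k z, Commute (tau q Q X Y k) z) :
    genAdj q Q X Y * shiftMat X Y = Matrix.scalar I (genTau q Q X Y) := by
  ext1 i j
  rw [← h.telescope, shiftMat, mul_add, Matrix.add_apply, Matrix.mul_diagonal, Matrix.mul_apply]
  simp only [genAdj, Matrix.of_apply, Matrix.map_apply, Finset.sum_mul]
  congr 1
  · refine Finset.sum_congr rfl fun k hk => ?_
    rw [← Polynomial.X_mul, X_mul_C_mul_X_pow (Finset.mem_range.1 hk)]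
  · rw [Finset.sum_comm]
    refine Finset.sum_congr rfl fun k _ => ?_
    rw [← h.mul_adjCoeff_add k, add_sub_cancel_right, (h.commute_adjCoeff hc k).eq,
      Matrix.mul_apply, map_sum, Finset.sum_mul]
    refine Finset.sum_congr rfl fun l _ => ?_
    rw [mul_assoc, Polynomial.X_pow_mul_C, ← mul_assoc, Polynomial.C_mul]

end Generating

/-! ### Centrality and the localization -/

section Inverse

variable (N : ℕ)

/-- The coefficients are central: they commute with `X` and `Y` because the power sums do. -/
lemma commute_tau_OqR (k : ℕ) (z : OqR N) :
    Commute (tau (qq N) (paramQ N) (entryX N) (entryY N) k) z := by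
  obtain ⟨z, rfl⟩ := toOqR_surjective N z
  induction z using FreeAlgebra.induction with
  | grade0 c => rw [AlgHom.commutes]; exact Algebra.commute_algebraMap_right _ _
  | grade1 g =>
    cases g with
    | X i j => exact (qsystem N).commute_tau (fun r => (qsystem N).commute_powerSum_X r i j) k
    | Y i j => exact (qsystem N).commute_tau (fun r => (qsystem N).commute_powerSum_Y r i j) k
  | mul a b ha hb => rw [map_mul]; exact ha.mul_right hb
  | add a b ha hb => rw [map_add]; exact ha.add_right hb

lemma bigC_eq : bigC N = genTau (qq N) (paramQ N) (entryX N) (entryY N) := by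
  rw [bigC, genTau, Fintype.card_fin]
  refine Finset.sum_congr rfl fun k hk => ?_
  rw [sigma_eq_tau N (by have := Finset.mem_range.1 hk; omega)]

lemma numer_eq (i j : Fin N) :
    numer N i j = genAdj (qq N) (paramQ N) (entryX N) (entryY N) i j := by
  rw [numer_eq_sum, genAdj, Matrix.of_apply, Fintype.card_fin]

lemma tIXY_eq : tIXY N = shiftMat (entryX N) (entryY N) := rfl

lemma commute_C {A : Type*} [Ring A] {a : A} (ha : ∀ z, Commute a z) (f : A[X]) :
    Commute (Polynomial.C a) f := by
  ext n
  rw [Polynomial.coeff_C_mul, Polynomial.coeff_mul_C, (ha _).eq]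

lemma bigC_mem_center : bigC N ∈ Set.center (OqR N)[X] := by
  rw [Semigroup.mem_center_iff]
  intro f
  refine (Commute.eq ?_).symm
  rw [bigC_eq, genTau]
  refine Commute.sum_left _ _ _ fun k _ => ?_
  exact (commute_C (commute_tau_OqR N k) f).mul_left (Polynomial.commute_X_pow f _)

/-- A matrix with a two-sided inverse up to a central element becomes invertible over the
localization at that element. -/
lemma exists_unit_map_oreDiv {S n : Type*} [Ring S] [Fintype n] [DecidableEq n] {c : S}
    (hc : c ∈ Set.center S) {T P : Matrix n n S} (h1 : T * P = Matrix.scalar n c)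
    (h2 : P * T = Matrix.scalar n c) :
    letI := oreSetOfCentral hc
    ∃ V : (Matrix n n (OreLocalization (Submonoid.powers c) S))ˣ,
      V.val = T.map (fun p => p /ₒ 1) ∧
      ∀ i j, V⁻¹.val i j = P i j /ₒ ⟨c, Submonoid.mem_powers c⟩ := by
  let := oreSetOfCentral hc
  set φ : S →+* OreLocalization (Submonoid.powers c) S := OreLocalization.numeratorRingHom
  set u : OreLocalization (Submonoid.powers c) S := 1 /ₒ ⟨c, Submonoid.mem_powers c⟩ with hu
  have hP : ∀ r : S, r /ₒ (⟨c, Submonoid.mem_powers c⟩ : Submonoid.powers c) = u * φ r := by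
    intro r
    exact (OreLocalization.mul_div_one.trans (by rw [one_mul])).symm
  have huc : u * φ c = 1 := by
    rw [← hP]
    exact OreLocalization.div_eq_one' _
  have hcu : φ c * u = 1 := by
    obtain ⟨v, hv⟩ := OreLocalization.numerator_isUnit
      (⟨c, Submonoid.mem_powers c⟩ : Submonoid.powers c)
    have hv' : φ c = v := hv.symm
    rw [hv'] at huc ⊢
    rw [Units.mul_eq_one_iff_eq_inv.1 huc, Units.mul_inv]
  -- The inverse of a central element is central.
  have hcomm : ∀ r, φ r * u = u * φ r := by
    intro r
    have h3 : φ r * φ c = φ c * φ r := by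
      rw [← map_mul, ← map_mul, (Semigroup.mem_center_iff.1 hc r)]
    calc φ r * u = u * φ c * φ r * u := by rw [huc, one_mul]
      _ = u * φ r * (φ c * u) := by rw [mul_assoc u, ← h3]; simp only [mul_assoc]
      _ = u * φ r := by rw [hcu, mul_one]
  have e1 : T.map φ * P.map φ = Matrix.scalar n (φ c) := by
    rw [← Matrix.map_mul, h1]
    simp [Matrix.scalar_apply, Matrix.diagonal_map]
  have e2 : P.map φ * T.map φ = Matrix.scalar n (φ c) := by
    rw [← Matrix.map_mul, h2]
    simp [Matrix.scalar_apply, Matrix.diagonal_map]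
  have e3 : Matrix.scalar n u * Matrix.scalar n (φ c) = 1 := by
    rw [← map_mul, huc, map_one]
  have e4 : Matrix.scalar n (φ c) * Matrix.scalar n u = 1 := by
    rw [← map_mul, hcu, map_one]
  have e5 : Matrix.scalar n u * P.map φ = P.map φ * Matrix.scalar n u := by
    ext i j
    simp [Matrix.scalar_apply, hcomm]
  refine ⟨⟨T.map φ, Matrix.scalar n u * P.map φ, ?_, ?_⟩, rfl, ?_⟩
  · rw [e5, ← mul_assoc, e1, e4]
  · rw [mul_assoc, e2, e3]
  · intro i j
    rw [hP]
    have : (Matrix.scalar n u * P.map φ) i j = u * φ (P i j) := by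
      rw [Matrix.scalar_apply, Matrix.diagonal_mul, Matrix.map_apply]
    exact this

lemma shiftMat_invertible : ∃ hC : bigC N ∈ Set.center (OqR N)[X],
      letI := oreSetOfCentral hC
      ∃ V : (Matrix (Fin N) (Fin N) (OreLocalization (Submonoid.powers (bigC N)) (OqR N)[X]))ˣ,
        V.val = (tIXY N).map (fun p => p /ₒ 1) ∧
        ∀ i j, V⁻¹.val i j = numer N i j /ₒ ⟨bigC N, Submonoid.mem_powers (bigC N)⟩ := by
  have hP : genAdj (qq N) (paramQ N) (entryX N) (entryY N) = Matrix.of (numer N) := by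
    ext1 i j; rw [Matrix.of_apply, numer_eq]
  refine ⟨bigC_mem_center N, ?_⟩
  refine exists_unit_map_oreDiv (P := Matrix.of (numer N)) (bigC_mem_center N) ?_ ?_
  · rw [← hP, bigC_eq, tIXY_eq, (qsystem N).shiftMat_mul_genAdj]
  · rw [← hP, bigC_eq, tIXY_eq, (qsystem N).genAdj_mul_shiftMat (commute_tau_OqR N)]

end Inverse

/-! ### The commutative case -/

section Commutative

variable {I A : Type*} [LinearOrder I] [Fintype I] [CommRing A] [Algebra ℚ A]

lemma isParam_one : IsParam (1 : ℚ) (fun _ _ : I => (1 : ℚ)) where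
  ne_zero := one_ne_zero
  diag _ := rfl
  qInt_ne_zero n := by
    simp only [qInt, one_pow, Finset.sum_const, Finset.card_range, nsmul_eq_mul, mul_one]
    exact Nat.cast_ne_zero.2 n.succ_ne_zero
  mul_swap _ := by norm_num

/-- Matrices with commuting entries satisfy the relations at `q = q_ij = 1`. -/
lemma qsystem_of_comm (x y : I → I → A) : QSystem (1 : ℚ) (fun _ _ => 1) x y where
  param := isParam_one
  X_rel := ⟨fun a b c d => by simp [mul_comm]⟩
  Y_rel a b c d := by simp [mul_comm]
  cross a b c d := by simp [mul_comm]

/-- The inversion sign of a word. -/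
def wordSign {m : ℕ} (σ : Fin m → I) : ℤˣ :=
  ∏ x : Fin m × Fin m with x.1 < x.2 ∧ σ x.2 < σ x.1, (-1)

lemma wordCoeff_one {m : ℕ} (σ : Fin m → I) :
    wordCoeff (fun _ _ => (1 : ℚ)) σ = ((wordSign σ : ℤˣ) : ℤ) := by
  simp [wordCoeff, wordSign]

/-- For a word that lists an index set, the inversion sign is the sign of the permutation. -/
lemma wordSign_comp_perm {m : ℕ} (f : Fin m → I) (hf : StrictMono f) (π : Equiv.Perm (Fin m)) :
    wordSign (fun n => f (π n)) = Equiv.Perm.sign π := by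
  rw [Equiv.Perm.sign_eq_prod_prod_Ioi, wordSign, Finset.prod_filter, Fintype.prod_prod_type]
  refine Finset.prod_congr rfl fun i _ => ?_
  have : Finset.Ioi i = Finset.univ.filter (i < ·) := by ext; simp
  rw [this, Finset.prod_filter]
  refine Finset.prod_congr rfl fun j _ => ?_
  by_cases hij : i < j
  · have hne : π i ≠ π j := fun h => hij.ne (π.injective h)
    by_cases h : π i < π j
    · simp [h, hf.lt_iff_lt, h.not_gt]
    · have h' : π j < π i := lt_of_le_of_ne (not_lt.1 h) hne.symm
      simp [h, hij, hf.lt_iff_lt, h']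
  · simp [hij]

/-- At `q = q_ij = 1`, the principal quantum minors are the principal minors. -/
lemma det_submatrix_eq_minorsX (z : I → I → A) (J : Finset I) :
    ((Matrix.of z).submatrix (Subtype.val : J → I) (Subtype.val : J → I)).det =
      minorsX (fun _ _ => (1 : ℚ)) z J J := by
  rw [(qsystem_of_comm z z).minorsX_eq_sum rfl, ← Matrix.det_transpose,
    ← Matrix.det_submatrix_equiv_self (J.orderIsoOfFin rfl).toEquiv, Matrix.det_apply]
  simp only [ite_smul, zero_smul]
  rw [← Finset.sum_filter]
  refine Finset.sum_bij (fun π _ n => J.orderEmbOfFin rfl (π n)) ?_ ?_ ?_ ?_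
  · intro π _
    have h1 : Function.Injective fun n => J.orderEmbOfFin rfl (π n) :=
      (J.orderEmbOfFin rfl).injective.comp π.injective
    refine Finset.mem_filter.2 ⟨Finset.mem_univ _, h1, ?_⟩
    refine (Finset.eq_of_subset_of_card_le ?_ ?_).symm
    · intro c hc
      obtain ⟨n, -, rfl⟩ := Finset.mem_image.1 hc
      exact J.orderEmbOfFin_mem rfl _
    · rw [Finset.card_image_of_injective _ h1, Finset.card_univ, Fintype.card_fin]
  · intro π _ π' _ h
    ext n
    exact congrArg Fin.val ((J.orderEmbOfFin rfl).injective (congrFun h n))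
  · intro τ hτ
    obtain ⟨h1, h2⟩ := (Finset.mem_filter.1 hτ).2
    have hm : ∀ n, τ n ∈ J := fun n => by
      rw [h2]; exact Finset.mem_image_of_mem _ (Finset.mem_univ n)
    have h3 : Function.Injective fun n => (J.orderIsoOfFin rfl).symm ⟨τ n, hm n⟩ := by
      intro a b hab
      exact h1 (congrArg Subtype.val ((J.orderIsoOfFin rfl).symm.injective hab))
    refine ⟨Equiv.ofBijective _ (Finite.injective_iff_bijective.1 h3), Finset.mem_univ _, ?_⟩
    funext n
    rw [Equiv.ofBijective_apply, ← Finset.coe_orderIsoOfFin_apply, OrderIso.apply_symm_apply]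
  · intro π _
    rw [wordCoeff_one, wordSign_comp_perm _ (J.orderEmbOfFin rfl).strictMono, List.prod_ofFn,
      Int.cast_smul_eq_zsmul]
    rfl

/-- The minors of the unit matrix. -/
lemma minorsY_one :
    minorsY (fun _ _ => (1 : ℚ)) (fun i j : I => if i = j then (1 : A) else 0) = 1 := by
  refine ((qsystem_of_comm (fun i j : I => if i = j then (1 : A) else 0)
    (fun i j => if i = j then 1 else 0)).eq_minorsY (fun L => ?_) fun t => ?_).symm
  · simp only [Matrix.one_apply, eq_comm]
  · rw [Finset.sum_eq_single t]
    · rw [if_pos rfl, map_one, mul_one, one_mul, one_mul]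
    · intro c _ hc
      rw [if_neg hc, map_zero, zero_mul]
    · simp

/-- At `q = q_ij = 1`, the `tau k` are the sums of the principal minors of `X Y`. Both are
determined by the traces of the powers of `X Y`, so that `Y` may be replaced by the unit matrix. -/
lemma tau_of_comm (x y : I → I → A) (k : ℕ) : tau (1 : ℚ) (fun _ _ => 1) x y k =
    ∑ J ∈ Finset.univ.powersetCard k,
      ((prodMat x y).submatrix (Subtype.val : J → I) (Subtype.val : J → I)).det := by
  set e : I → I → A := fun i j => if i = j then 1 else 0 with he
  set z : I → I → A := fun i j => prodMat x y i j with hz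
  have h1 : prodMat z e = prodMat x y := mul_one _
  have h2 : tau (1 : ℚ) (fun _ _ => 1) z e k = tau (1 : ℚ) (fun _ _ => 1) x y k :=
    (qsystem_of_comm x y).tau_eq_of_powerSum (qsystem_of_comm z e) rfl
      (fun r => by simp only [powerSum, h1]) k
  rw [← h2, tau_eq_sum, minorsY_one, Finset.powersetCard_eq_filter, Finset.powerset_univ,
    Finset.sum_filter]
  refine Finset.sum_congr rfl fun J _ => ?_
  rw [Finset.sum_filter, Finset.sum_eq_single J]
  · rw [Matrix.one_apply_eq, one_mul]
    refine if_congr Iff.rfl ?_ rfl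
    rw [Finset.prod_eq_one (fun c _ => by rw [wGt, one_pow]), one_smul]
    exact (det_submatrix_eq_minorsX z J).symm
  · intro L _ hL
    rw [Matrix.one_apply_ne hL.symm, zero_mul, smul_zero, ite_self]
  · simp

lemma charmatrix_neg_prodMat (x y : I → I → A) :
    Matrix.charmatrix (-prodMat x y) = shiftMat x y := by
  rw [Matrix.charmatrix, shiftMat, map_neg, sub_neg_eq_add]
  rfl

/-- Both sides have the sums of the principal minors of `x y` as coefficients. -/
lemma genTau_of_comm (x y : I → I → A) :
    genTau (1 : ℚ) (fun _ _ => 1) x y = (shiftMat x y).det := by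
  nontriviality A
  rw [← charmatrix_neg_prodMat, ← Matrix.charpoly, (-prodMat x y).charpoly.as_sum_range_C_mul_X_pow,
    Matrix.charpoly_natDegree_eq_dim, genTau, ← Finset.sum_range_reflect]
  refine Finset.sum_congr rfl fun k hk => ?_
  have hk : k ≤ Fintype.card I := by have := Finset.mem_range.1 hk; omega
  rw [show Fintype.card I + 1 - 1 - k = Fintype.card I - k by omega, tau_of_comm]
  congr 2
  swap
  · omega
  have h1 := Matrix.charpoly_coeff_eq_sum_minors (-prodMat x y) (Fintype.card I - k) (by omega)
  rw [show Fintype.card I - (Fintype.card I - k) = k by omega] at h1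
  rw [h1, Finset.mul_sum]
  refine Finset.sum_congr rfl fun J hJ => ?_
  have h2 : (-prodMat x y).submatrix (Subtype.val : J → I) (Subtype.val : J → I) =
      -(prodMat x y).submatrix (Subtype.val : J → I) (Subtype.val : J → I) := rfl
  rw [h2, Matrix.det_neg, Fintype.card_coe,
    (Finset.mem_powersetCard.1 hJ).2, ← mul_assoc, ← mul_pow, neg_one_mul, neg_neg, one_pow,
    one_mul]

/-- The generating matrix and the adjugate are both inverses of `t + x y` up to the determinant, which
is monic in `t` and thus cancels. -/
lemma genAdj_of_comm (x y : I → I → A) :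
    genAdj (1 : ℚ) (fun _ _ => 1) x y = (shiftMat x y).adjugate := by
  have h1 := (qsystem_of_comm x y).shiftMat_mul_genAdj
  rw [genTau_of_comm] at h1
  have hm : (shiftMat x y).det.Monic := by
    rw [← charmatrix_neg_prodMat]
    exact Matrix.charpoly_monic _
  have h2 := congrArg ((shiftMat x y).adjugate * ·) h1
  simp only [← mul_assoc, Matrix.adjugate_mul, Matrix.smul_mul, one_mul] at h2
  ext1 i j
  have h3 := congrFun (congrFun h2 i) j
  rw [Matrix.smul_apply, Matrix.scalar_apply, Matrix.mul_diagonal, smul_eq_mul, mul_comm] at h3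
  exact hm.isRegular.right h3

end Commutative

/-! ### Contractions of minors over pairs of index sets -/

section MinorSum

variable {I F A : Type*} [LinearOrder I] [Fintype I] [Field F] [Ring A] [Algebra F A]
  {q : F} {Q : I → I → F} {X Y : I → I → A}

/-- The weighted contraction `∑_L (∏_{c ∈ L} w_c) [Y]_{L,J} [X]_{J',L}` of quantum minors. -/
def minorSum (q : F) (Q : I → I → F) (X Y : I → I → A) (J J' : Finset I) : A :=
  ∑ L with L.card = J.card, (∏ c ∈ L, wGt I q c) • (minorsY Q Y J L * minorsX Q X L J')

lemma QSystem.genTau_eq_sum (h : QSystem q Q X Y) : genTau q Q X Y =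
    ∑ J, Polynomial.X ^ (Fintype.card I - J.card) * Polynomial.C (minorSum q Q X Y J J) := by
  have h1 : ∀ k, tau q Q X Y k = ∑ J, if J.card = k then minorSum q Q X Y J J else 0 := by
    intro k
    rw [h.tau_eq_sum_card, ← Finset.sum_filter]
    refine Finset.sum_congr rfl fun J hJ => ?_
    rw [minorSum, (Finset.mem_filter.1 hJ).2]
  rw [genTau]
  simp only [h1, map_sum, Finset.sum_mul]
  rw [Finset.sum_comm]
  refine Finset.sum_congr rfl fun J _ => ?_
  rw [Finset.sum_eq_single J.card]
  · rw [if_pos rfl, Polynomial.X_pow_mul]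
  · intro k _ hk
    rw [if_neg hk.symm, Polynomial.C_0, zero_mul]
  · intro h
    exact absurd (Finset.mem_range.2 (Nat.lt_succ_of_le (Finset.card_le_univ J))) h

lemma QSystem.genAdj_eq_sum (h : QSystem q Q X Y) (i j : I) : genAdj q Q X Y i j =
    ∑ K with i ∈ K ∧ j ∈ K, Polynomial.X ^ (Fintype.card I - K.card) * Polynomial.C
      (((∏ c ∈ K with i < c, -Q i c) * ∏ c ∈ K with j < c, -Q c j) •
        minorSum q Q X Y (K.erase i) (K.erase j)) := by
  have h1 : ∀ k, adjCoeff q Q X Y k i j = ∑ K with i ∈ K ∧ j ∈ K, if K.card = k + 1 then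
      ((∏ c ∈ K with i < c, -Q i c) * ∏ c ∈ K with j < c, -Q c j) •
        minorSum q Q X Y (K.erase i) (K.erase j) else 0 := by
    intro k
    rw [h.adjCoeff_apply, ← Finset.sum_filter, Finset.filter_filter]
    have e0 : Finset.univ.filter (fun K : Finset I => K.card = k + 1 ∧ i ∈ K ∧ j ∈ K) =
        Finset.univ.filter (fun K : Finset I => (i ∈ K ∧ j ∈ K) ∧ K.card = k + 1) := by
      ext K; simp only [Finset.mem_filter, Finset.mem_univ, true_and]; tauto
    rw [e0]
    refine Finset.sum_congr rfl fun K hK => ?_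
    obtain ⟨⟨hi, hj⟩, hc⟩ := (Finset.mem_filter.1 hK).2
    rw [minorSum, Finset.card_erase_of_mem hi, hc, Nat.add_sub_cancel]
  rw [genAdj, Matrix.of_apply]
  simp only [h1, map_sum, Finset.sum_mul]
  rw [Finset.sum_comm]
  refine Finset.sum_congr rfl fun K hK => ?_
  have hK := (Finset.mem_filter.1 hK).2
  have hpos : 0 < K.card := Finset.card_pos.2 ⟨i, hK.1⟩
  have hle : K.card ≤ Fintype.card I := Finset.card_le_univ K
  rw [Finset.sum_eq_single (K.card - 1)]
  · rw [if_pos (by omega), Polynomial.X_pow_mul,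
      show Fintype.card I - 1 - (K.card - 1) = Fintype.card I - K.card by omega]
  · intro k _ hk
    rw [if_neg (by omega), Polynomial.C_0, zero_mul]
  · intro h
    exact absurd (Finset.mem_range.2 (by omega)) h

end MinorSum

/-! ### Words as commutative monomials -/

section Deformation

variable {N : ℕ}

/-- Up to the sign `s`, the coefficient `c` is an integral power product of the parameters. -/
def IsSignedMonomial (c : ParamField N) (s : ℤˣ) : Prop :=
  ∃ (a : ℤ) (b : Fin N → Fin N → ℤ), c = (((s : ℤˣ) : ℤ) : ParamField N) * paramMonomial a b

lemma paramMonomial_mul (a a' : ℤ) (b b' : Fin N → Fin N → ℤ) :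
    paramMonomial (a + a') (b + b') = paramMonomial a b * paramMonomial a' b' := by
  have h : ∀ i j, (QQ i j : ParamField N) ≠ 0 := (isParam_paramQ N).apply_ne_zero
  simp only [paramMonomial, Pi.add_apply, zpow_add₀ (isParam_paramQ N).ne_zero,
    zpow_add₀ (h _ _), Finset.prod_mul_distrib]
  ring

lemma IsSignedMonomial.one : IsSignedMonomial (1 : ParamField N) 1 :=
  ⟨0, 0, by simp [paramMonomial]⟩

lemma IsSignedMonomial.mul {c c' : ParamField N} {s s' : ℤˣ} (h : IsSignedMonomial c s)
    (h' : IsSignedMonomial c' s') : IsSignedMonomial (c * c') (s * s') := by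
  obtain ⟨a, b, rfl⟩ := h
  obtain ⟨a', b', rfl⟩ := h'
  refine ⟨a + a', b + b', ?_⟩
  rw [paramMonomial_mul]
  push_cast
  ring

lemma IsSignedMonomial.prod {ι : Type*} (t : Finset ι) {c : ι → ParamField N} {s : ι → ℤˣ}
    (h : ∀ i ∈ t, IsSignedMonomial (c i) (s i)) :
    IsSignedMonomial (∏ i ∈ t, c i) (∏ i ∈ t, s i) := by
  classical
  induction t using Finset.induction_on with
  | empty => exact .one
  | insert a t ha ih =>
    rw [Finset.prod_insert ha, Finset.prod_insert ha]
    exact (h a (Finset.mem_insert_self _ _)).mul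
      (ih fun i hi => h i (Finset.mem_insert_of_mem hi))

lemma isSignedMonomial_qq_pow (n : ℕ) : IsSignedMonomial (qq N ^ n) 1 :=
  ⟨n, 0, by simp [paramMonomial]⟩

lemma isSignedMonomial_neg_paramQ (i j : Fin N) : IsSignedMonomial (-paramQ N i j) (-1) := by
  refine ⟨0, fun a b => if a = i ∧ b = j then 1 else 0, ?_⟩
  have : ∏ a, ∏ b, (QQ a b : ParamField N) ^ (if a = i ∧ b = j then (1 : ℤ) else 0) = QQ i j := by
    rw [Finset.prod_eq_single i, Finset.prod_eq_single j]
    · simp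
    · intro b _ hb; simp [hb]
    · simp
    · intro a _ ha; exact Finset.prod_eq_one fun b _ => by simp [ha]
    · simp
  rw [paramMonomial, this]
  simp [paramQ]

lemma isSignedMonomial_wordCoeff {m : ℕ} (σ : Fin m → Fin N) :
    IsSignedMonomial (wordCoeff (paramQ N) σ) (wordSign σ) :=
  .prod _ fun _ _ => isSignedMonomial_neg_paramQ _ _

lemma isSignedMonomial_wordCoeff_swap {m : ℕ} (σ : Fin m → Fin N) :
    IsSignedMonomial (wordCoeff (fun i j => paramQ N j i) σ) (wordSign σ) :=
  .prod _ fun _ _ => isSignedMonomial_neg_paramQ _ _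

/-- A family of ordered words that are distinct as commutative monomials exhibits a
deformation. -/
lemma isDeformation_of_words {ι : Type*} [Fintype ι] {z : (OqR N)[X]} {z₀ : CommPoly N}
    (w : ι → YXWord N) (c : ι → ParamField N) (s : ι → ℤˣ)
    (hw : Function.Injective fun i => (w i).classical)
    (hc : ∀ i, IsSignedMonomial (c i) (s i))
    (hz : z = ∑ i, Polynomial.C (algebraMap (ParamField N) (OqR N) (c i)) * (w i).quantum)
    (hz₀ : z₀ = ∑ i, (((s i : ℤˣ) : ℤ) : CommPoly N) * (w i).classical) : IsDeformation z z₀ := by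
  classical
  choose a b hab using hc
  have hw' : Function.Injective w := fun i j h => hw (congrArg YXWord.classical h)
  refine ⟨Finset.univ.image w, Function.extend w s 1, Function.extend w a 0,
    Function.extend w b 0, ?_, ?_, ?_⟩
  · intro u hu v hv huv
    obtain ⟨i, -, rfl⟩ := Finset.mem_image.1 (Finset.mem_coe.1 hu)
    obtain ⟨j, -, rfl⟩ := Finset.mem_image.1 (Finset.mem_coe.1 hv)
    exact congrArg w (hw huv)
  · rw [hz, Finset.sum_image fun i _ j _ h => hw' h]
    refine Finset.sum_congr rfl fun i _ => ?_
    rw [hw'.extend_apply, hw'.extend_apply, hw'.extend_apply, hab, map_mul, map_intCast,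
      Polynomial.C_mul, map_intCast]
  · rw [hz₀, Finset.sum_image fun i _ j _ h => hw' h]
    refine Finset.sum_congr rfl fun i _ => ?_
    rw [hw'.extend_apply]

lemma list_prod_map_X {σ R ι : Type*} [CommSemiring R] [DecidableEq σ] (l : List ι) (g : ι → σ) :
    (l.map fun p => (MvPolynomial.X (g p) : MvPolynomial σ R)).prod =
      MvPolynomial.monomial (Multiset.toFinsupp (l.map g : Multiset σ)) 1 := by
  induction l with
  | nil => simp
  | cons a l ih =>
    rw [List.map_cons, List.prod_cons, ih, List.map_cons, ← Multiset.cons_coe,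
      ← Multiset.singleton_add, map_add, Multiset.toFinsupp_singleton, MvPolynomial.X,
      MvPolynomial.monomial_mul, one_mul]

lemma classical_eq (w : YXWord N) : w.classical = Polynomial.X ^ w.1 * Polynomial.C
    ((w.2.1.map fun p => (MvPolynomial.X (Gen.Y p.1 p.2) : MvPolynomial (Gen N) ℤ)).prod *
      (w.2.2.map fun p => MvPolynomial.X (Gen.X p.1 p.2)).prod) := by
  rw [YXWord.classical, map_mul, map_list_prod, map_list_prod, List.map_map, List.map_map]
  rfl

/-- The factors of a word can be read off from its commutative value. -/
lemma mem_iff_of_classical_eq {w w' : YXWord N} (h : w.classical = w'.classical) :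
    (∀ p, p ∈ w.2.1 ↔ p ∈ w'.2.1) ∧ ∀ p, p ∈ w.2.2 ↔ p ∈ w'.2.2 := by
  classical
  have h1 : ∀ w : YXWord N, w.classical = Polynomial.monomial w.1 (MvPolynomial.monomial
      (Multiset.toFinsupp ((w.2.1.map fun p => Gen.Y p.1 p.2 : List (Gen N)) +
        (w.2.2.map fun p => Gen.X p.1 p.2 : List (Gen N)) : Multiset (Gen N))) 1) := by
    intro w
    rw [classical_eq, list_prod_map_X, list_prod_map_X, MvPolynomial.monomial_mul, one_mul,
      map_add, Polynomial.X_pow_mul, Polynomial.C_mul_X_pow_eq_monomial]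
  rw [h1, h1, Polynomial.monomial_eq_monomial_iff] at h
  have h2 : ∀ f : Gen N →₀ ℕ, MvPolynomial.monomial f (1 : ℤ) ≠ 0 := fun f =>
    (MvPolynomial.monomial_eq_zero (s := f) (b := (1 : ℤ))).not.2 one_ne_zero
  obtain ⟨-, h3⟩ | ⟨h3, -⟩ := h
  swap
  · exact absurd h3 (h2 _)
  have h4 := Multiset.toFinsupp.injective (MvPolynomial.monomial_left_injective one_ne_zero h3)
  refine ⟨fun p => ?_, fun p => ?_⟩
  · have := congrArg (Gen.Y p.1 p.2 ∈ ·) h4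
    simpa using this
  · have := congrArg (Gen.X p.1 p.2 ∈ ·) h4
    simpa using this

/-- The words in the expansion of a product of quantum minors of `Y` and `X`. -/
def minorWord {m : ℕ} (e : ℕ) {J J' : Finset (Fin N)} (hJ : J.card = m) (hJ' : J'.card = m)
    (σ τ : Fin m → Fin N) : YXWord N :=
  (e, (List.ofFn fun n => (σ n, J.orderEmbOfFin hJ n)).reverse,
    List.ofFn fun n => (J'.orderEmbOfFin hJ' n, τ n))

/-- The words in the expansion of products of minors are distinct as commutative monomials: the
second indices of the factors `y` and the first indices of the factors `x` are the given index sets,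
and the remaining indices are functions of these. -/
lemma classical_minorWord_injective {m m' : ℕ} {e e' : ℕ} {J J' K K' : Finset (Fin N)}
    {hJ : J.card = m} {hJ' : J'.card = m} {hK : K.card = m'} {hK' : K'.card = m'}
    {σ τ : Fin m → Fin N} {σ' τ' : Fin m' → Fin N}
    (h : (minorWord e hJ hJ' σ τ).classical = (minorWord e' hK hK' σ' τ').classical) :
    J = K ∧ J' = K' ∧ HEq σ σ' ∧ HEq τ τ' := by
  obtain ⟨h1, h2⟩ := mem_iff_of_classical_eq h
  simp only [minorWord, List.mem_reverse, List.mem_ofFn] at h1 h2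
  have e1 : J = K := by
    ext c
    rw [← Finset.mem_coe, ← Finset.mem_coe, ← Finset.range_orderEmbOfFin J hJ,
      ← Finset.range_orderEmbOfFin K hK]
    constructor
    · rintro ⟨n, rfl⟩
      obtain ⟨n', hn'⟩ := (h1 (σ n, _)).1 ⟨n, rfl⟩
      exact ⟨n', congrArg Prod.snd hn'⟩
    · rintro ⟨n, rfl⟩
      obtain ⟨n', hn'⟩ := (h1 (σ' n, _)).2 ⟨n, rfl⟩
      exact ⟨n', congrArg Prod.snd hn'⟩
  have e2 : J' = K' := by
    ext c
    rw [← Finset.mem_coe, ← Finset.mem_coe, ← Finset.range_orderEmbOfFin J' hJ',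
      ← Finset.range_orderEmbOfFin K' hK']
    constructor
    · rintro ⟨n, rfl⟩
      obtain ⟨n', hn'⟩ := (h2 (_, τ n)).1 ⟨n, rfl⟩
      exact ⟨n', congrArg Prod.fst hn'⟩
    · rintro ⟨n, rfl⟩
      obtain ⟨n', hn'⟩ := (h2 (_, τ' n)).2 ⟨n, rfl⟩
      exact ⟨n', congrArg Prod.fst hn'⟩
  subst e1 e2
  obtain rfl : m = m' := hJ.symm.trans hK
  refine ⟨rfl, rfl, heq_of_eq (funext fun n => ?_), heq_of_eq (funext fun n => ?_)⟩
  · obtain ⟨n', hn'⟩ := (h1 (σ n, J.orderEmbOfFin hJ n)).1 ⟨n, rfl⟩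
    obtain rfl := (J.orderEmbOfFin hJ).injective (congrArg Prod.snd hn')
    exact (congrArg Prod.fst hn').symm
  · obtain ⟨n', hn'⟩ := (h2 (J'.orderEmbOfFin hJ' n, τ n)).1 ⟨n, rfl⟩
    obtain rfl := (J'.orderEmbOfFin hJ').injective (congrArg Prod.fst hn')
    exact (congrArg Prod.snd hn').symm

/-- The variables `x_ij`, with rational coefficients. -/
def ratX (N : ℕ) (i j : Fin N) : MvPolynomial (Gen N) ℚ := MvPolynomial.X (Gen.X i j)

/-- The variables `y_ij`, with rational coefficients. -/
def ratY (N : ℕ) (i j : Fin N) : MvPolynomial (Gen N) ℚ := MvPolynomial.X (Gen.Y i j)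

/-- The inclusion of integral into rational coefficients. -/
def toRat (N : ℕ) : CommPoly N →+* (MvPolynomial (Gen N) ℚ)[X] :=
  Polynomial.mapRingHom (MvPolynomial.map (Int.castRingHom ℚ))

lemma toRat_injective : Function.Injective (toRat N) :=
  Polynomial.map_injective _ (MvPolynomial.map_injective _ Int.cast_injective)

lemma toRat_classical (w : YXWord N) : toRat N w.classical = Polynomial.X ^ w.1 * Polynomial.C
    ((w.2.1.map fun p => ratY N p.1 p.2).prod * (w.2.2.map fun p => ratX N p.1 p.2).prod) := by
  rw [classical_eq, toRat, map_mul, map_pow, Polynomial.coe_mapRingHom, Polynomial.map_X,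
    Polynomial.map_C, map_mul, map_list_prod, map_list_prod, List.map_map, List.map_map]
  simp only [Function.comp_def, MvPolynomial.map_X]
  rfl

lemma toRat_commTIXY : (commTIXY N).map (toRat N) = shiftMat (ratX N) (ratY N) := by
  ext1 i j
  rw [Matrix.map_apply, commTIXY, shiftMat, Matrix.add_apply, Matrix.add_apply, map_add]
  congr 1
  · rw [Matrix.diagonal_apply, Matrix.diagonal_apply]
    split_ifs
    · simp [toRat]
    · simp
  · rw [Matrix.map_apply, prodMat, Matrix.mul_apply, Matrix.mul_apply, map_sum, map_sum]
    refine Finset.sum_congr rfl fun l _ => ?_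
    simp [toRat, commX, commY, ratX, ratY]

/-- Sums of contractions of quantum minors, with signed monomials as coefficients, are
deformations of the sums of contractions of minors with the same signs. -/
lemma isDeformation_of_minorSum {α : Type*} [Fintype α] {z : (OqR N)[X]} {z₀ : CommPoly N}
    (J J' : α → Finset (Fin N)) (hJ : ∀ a, (J' a).card = (J a).card)
    (hinj : ∀ a b, J a = J b → J' a = J' b → a = b) (e : α → ℕ) (c : α → ParamField N)
    (s : α → ℤˣ) (hc : ∀ a, IsSignedMonomial (c a) (s a))
    (hz : z = ∑ a, Polynomial.X ^ e a * Polynomial.C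
      (c a • minorSum (qq N) (paramQ N) (entryX N) (entryY N) (J a) (J' a)))
    (hz₀ : toRat N z₀ = ∑ a, Polynomial.X ^ e a * Polynomial.C
      ((((s a : ℤˣ) : ℤ) : ℚ) • minorSum (1 : ℚ) (fun _ _ => 1) (ratX N) (ratY N) (J a) (J' a))) :
    IsDeformation z z₀ := by
  classical
  let T : α → Type := fun a => {στ : (Fin (J a).card → Fin N) × (Fin (J a).card → Fin N) //
    Function.Injective στ.1 ∧ Function.Injective στ.2 ∧
      Finset.univ.image στ.1 = Finset.univ.image στ.2}
  let w : (Σ a, T a) → YXWord N := fun x => minorWord (e x.1) rfl (hJ x.1) x.2.1.1 x.2.1.2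
  refine isDeformation_of_words (ι := Σ a, T a) w
    (fun x => c x.1 * ((∏ n, wGt (Fin N) (qq N) (x.2.1.2 n)) *
      wordCoeff (fun i j => paramQ N j i) x.2.1.1 * wordCoeff (paramQ N) x.2.1.2))
    (fun x => s x.1 * (1 * wordSign x.2.1.1 * wordSign x.2.1.2)) ?_ ?_ ?_ ?_
  · rintro ⟨a, στ, hστ⟩ ⟨b, στ', hστ'⟩ h
    obtain ⟨h1, h2, h3, h4⟩ := classical_minorWord_injective h
    obtain rfl := hinj a b h1 h2
    have h5 : στ = στ' := Prod.ext (eq_of_heq h3) (eq_of_heq h4)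
    subst h5
    rfl
  · intro x
    refine (hc _).mul ((IsSignedMonomial.mul ?_ (isSignedMonomial_wordCoeff_swap _)).mul
      (isSignedMonomial_wordCoeff _))
    have := IsSignedMonomial.prod Finset.univ (s := fun _ => 1)
      fun n _ => isSignedMonomial_qq_pow (N := N)
        (2 * (Finset.univ.filter (x.2.1.2 n < ·)).card)
    rwa [Finset.prod_const_one] at this
  · rw [hz, Fintype.sum_sigma]
    refine Finset.sum_congr rfl fun a _ => ?_
    rw [minorSum, (qsystem N).sum_minorsY_mul_minorsX _ rfl (hJ a), Finset.sum_subtype _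
      (p := fun στ : (Fin (J a).card → Fin N) × (Fin (J a).card → Fin N) =>
        Function.Injective στ.1 ∧ Function.Injective στ.2 ∧
          Finset.univ.image στ.1 = Finset.univ.image στ.2) (by simp), Finset.smul_sum, map_sum,
      Finset.mul_sum]
    refine Finset.sum_congr rfl fun στ _ => ?_
    rw [smul_smul, Algebra.smul_def, Polynomial.C_mul, ← mul_assoc, Polynomial.X_pow_mul_C,
      mul_assoc]
    congr 1
    simp only [w, minorWord, YXWord.quantum, List.map_reverse, List.map_ofFn]
    rfl
  -- Over the rationals with `q = q_ij = 1`, the same expansion has the signs as coefficients.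
  · apply toRat_injective
    rw [hz₀, map_sum, Fintype.sum_sigma]
    refine Finset.sum_congr rfl fun a _ => ?_
    rw [minorSum, (qsystem_of_comm (ratX N) (ratY N)).sum_minorsY_mul_minorsX _ rfl (hJ a),
      Finset.sum_subtype _
      (p := fun στ : (Fin (J a).card → Fin N) × (Fin (J a).card → Fin N) =>
        Function.Injective στ.1 ∧ Function.Injective στ.2 ∧
          Finset.univ.image στ.1 = Finset.univ.image στ.2) (by simp), Finset.smul_sum, map_sum,
      Finset.mul_sum]
    refine Finset.sum_congr rfl fun στ _ => ?_
    have h1 : ∏ n, wGt (Fin N) (1 : ℚ) (στ.1.2 n) = 1 :=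
      Finset.prod_eq_one fun n _ => by rw [wGt, one_pow]
    rw [map_mul, toRat_classical, map_intCast, h1, wordCoeff_one, wordCoeff_one, smul_smul, one_mul,
      one_mul, Algebra.smul_def, Polynomial.C_mul, ← mul_assoc, Polynomial.X_pow_mul_C, mul_assoc]
    refine congrArg₂ (· * ·) ?_ ?_
    · push_cast
      simp
    · simp only [w, minorWord, List.map_reverse, List.map_ofFn]
      rfl

lemma isDeformation_bigC (N : ℕ) : IsDeformation (bigC N) (commTIXY N).det := by
  refine isDeformation_of_minorSum id id (fun _ => rfl) (fun _ _ h _ => h)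
    (fun J => Fintype.card (Fin N) - J.card) (fun _ => 1) (fun _ => 1) (fun _ => .one) ?_ ?_
  · rw [bigC_eq, (qsystem N).genTau_eq_sum]
    simp
  · rw [RingHom.map_det, RingHom.mapMatrix_apply, toRat_commTIXY, ← genTau_of_comm,
      (qsystem_of_comm _ _).genTau_eq_sum]
    simp

lemma isDeformation_numer (N : ℕ) (i j : Fin N) :
    IsDeformation (numer N i j) ((commTIXY N).adjugate i j) := by
  refine isDeformation_of_minorSum (α := {K : Finset (Fin N) // i ∈ K ∧ j ∈ K})
    (fun K => K.1.erase i) (fun K => K.1.erase j) (fun K => ?_) (fun K L h _ => ?_)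
    (fun K => Fintype.card (Fin N) - K.1.card)
    (fun K => (∏ c ∈ K.1 with i < c, -paramQ N i c) * ∏ c ∈ K.1 with j < c, -paramQ N c j)
    (fun K => (∏ c ∈ K.1 with i < c, -1) * ∏ c ∈ K.1 with j < c, -1)
    (fun K => .mul (.prod _ fun _ _ => isSignedMonomial_neg_paramQ _ _)
      (.prod _ fun _ _ => isSignedMonomial_neg_paramQ _ _)) ?_ ?_
  · rw [Finset.card_erase_of_mem K.2.1, Finset.card_erase_of_mem K.2.2]
  · apply Subtype.ext
    rw [← Finset.insert_erase K.2.1, h, Finset.insert_erase L.2.1]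
  · rw [numer_eq, (qsystem N).genAdj_eq_sum, Finset.sum_subtype _
      (p := fun K : Finset (Fin N) => i ∈ K ∧ j ∈ K) (by simp)]
  · have h1 : toRat N ((commTIXY N).adjugate i j) =
        (shiftMat (ratX N) (ratY N)).adjugate i j := by
      rw [← toRat_commTIXY, ← RingHom.mapMatrix_apply, ← RingHom.map_adjugate]
      rfl
    rw [h1, ← genAdj_of_comm, (qsystem_of_comm _ _).genAdj_eq_sum, Finset.sum_subtype _
      (p := fun K : Finset (Fin N) => i ∈ K ∧ j ∈ K) (by simp)]
    refine Finset.sum_congr rfl fun K _ => ?_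
    push_cast
    rfl

end Deformation

end MultiQuantum

end

theorem theorem1p2 (N : ℕ) (hN : 2 ≤ N) :
    (∃ hC : bigC N ∈ Set.center (OqR N)[X],
      letI := oreSetOfCentral hC
      ∃ V : (Matrix (Fin N) (Fin N) (OreLocalization (Submonoid.powers (bigC N)) (OqR N)[X]))ˣ,
        V.val = (tIXY N).map (fun p => p /ₒ 1) ∧
        ∀ i j, V⁻¹.val i j = numer N i j /ₒ ⟨bigC N, Submonoid.mem_powers (bigC N)⟩) ∧
    IsDeformation (bigC N) (commTIXY N).det ∧
    ∀ i j, IsDeformation (numer N i j) ((commTIXY N).adjugate i j) :=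
  ⟨shiftMat_invertible N, isDeformation_bigC N, isDeformation_numer N⟩
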